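/- Let $X$ be a smooth $N$-dimensional manifold (Hausdorff, second countable) with local coordinates $u=(u^1,\dots,u^N)$, let $\omega^{ij}(u)$ be a smooth skew-symmetric contravariant 2-tensor field on $X$ (for example a Poisson structure), and let $D\subset TX$ be an open set such that $(u,v)\in D$ and $t\in[0,1]$ imply $(u,tv)\in D$ (for example $D=TX$). Let $M^i_j(u,u_x)$, $(u,u_x)\in D$, be a smooth field of invertible endomorphisms of the tangent spaces, let $B(u,u_x)=M(u,u_x)^{-1}$, i.e. $B^i_sM^s_j=\delta^i_j$, and suppose that $A^{ij}(u,u_x)=B^i_s(u,u_x)\,\omega^{sj}(u)$ is skew-symmetric on $D$. Summation over repeated indices is understood. Let $\Omega_D$ be the space of smooth loops $\gamma:S^1=\mathbb R/\mathbb Z\to X$, $x\mapsto u(x)$, with $(u(x),u_x(x))\in D$ for all $x$ (the whole loop space if $D=TX$). A functional on $\Omega_D$ means a function $I:\Omega_D\to\mathbb R$ with a smooth variational derivative: a covector field $\delta I/\delta u^i(x)$ along every loop which depends smoothly on $x$ and on the parameters of any smooth finite-dimensional family of loops in $\Omega_D$, and which satisfies $\partial_a I=\int_0^1 \frac{\delta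 I}{\delta u^i(x)}\,\partial_a u^i(x)\,dx$ for the derivative in every parameter direction $a$ of such a family. We say that $A$ gives a Poisson bracket on $\Omega_D$ if $$\{I,J\}=\int_0^1\frac{\delta I}{\delta u^i(x)}\,A^{ij}(u,u_x)\,\frac{\delta J}{\delta u^j(x)}\,dx$$ is a functional for all functionals $I,J$, and is skew-symmetric and satisfies the Jacobi identity. (1) $A$ gives a Poisson bracket on $\Omega_D$ if and only if, in local coordinates, for all indices $j,p,s$, all $(u,u_x)\in D$ and all $u_{xx}\in\mathbb R^N$, $$\omega^{ij}\omega^{rp}\frac{\partial M^s_r}{\partial u^i_x}=\omega^{is}\omega^{rj}\frac{\partial M^p_r}{\partial u^i_x}\qquad\text{(r1)}$$ and $$\begin{aligned} &\omega^{ij}\omega^{rp}\frac{\partial M^s_r}{\partial u^i}-\omega^{ij}\frac{d}{dx}\Big(\frac{\partial M^s_r}{\partial u^i_x}\,\omega^{rp}\Big)+\frac{\partial\omega^{ij}}{\partial u^r}\,\omega^{rp}M^s_i\\ &+\omega^{is}\omega^{rj}\frac{\partial M^p_r}{\partial u^i}+\frac{d}{dx}\big(\omega^{is}\big)\frac{\partial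 M^p_r}{\partial u^i_x}\,\omega^{rj}+\frac{\partial\omega^{is}}{\partial u^r}\,\omega^{rj}M^p_i\\ &+\omega^{ip}\omega^{rs}\frac{\partial M^j_r}{\partial u^i}+\frac{d}{dx}\big(\omega^{ip}\big)\frac{\partial M^j_r}{\partial u^i_x}\,\omega^{rs}+\frac{\partial\omega^{ip}}{\partial u^r}\,\omega^{rs}M^j_i=0,\qquad\text{(r2)} \end{aligned}$$ where $\frac{d}{dx}=u^k_x\frac{\partial}{\partial u^k}+u^k_{xx}\frac{\partial}{\partial u^k_x}$. Here it does not matter whether (r1) and (r2) are required in all smooth local coordinate systems or only in those of some family whose domains cover $X$. (2) If $\omega^{ij}(u)$ is a Poisson structure and $T_{ijk}(u)$ is a closed 3-form on $X$, then $M^s_j(u,u_x)=\delta^s_j+\omega^{sp}(u)\,T_{pjk}(u)\,u^k_x$ satisfies (r1) and (r2), in all local coordinates and for all $u,u_x,u_{xx}$. -/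

import Mathlib

open scoped Manifold ContDiff

namespace LoopPoisson

noncomputable section

/-! ### Local coordinates on a manifold

A point of `ℝ^N` is written `u`, a value of `u_x` is written `v` and a value of `u_xx` is
written `w`.  The superscript of a tensor component comes first: `M s r` is `M^s_r`. -/

/-- Smooth local coordinate systems `(u^1, …, u^N)` on `X`. -/
abbrev IsCoordinates {N : ℕ} {X : Type*} [TopologicalSpace X]
    [ChartedSpace (EuclideanSpace ℝ (Fin N)) X]
    (e : OpenPartialHomeomorph X (EuclideanSpace ℝ (Fin N))) : Prop :=
  e ∈ IsManifold.maximalAtlas (𝓡 N) ∞ X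

/-- The vector `v^k ∂/∂u^k` at `p`, for coordinates `e` around `p`. -/
def coordVector {N : ℕ} {X : Type*} [TopologicalSpace X]
    [ChartedSpace (EuclideanSpace ℝ (Fin N)) X]
    (e : OpenPartialHomeomorph X (EuclideanSpace ℝ (Fin N))) (p : X)
    (v : EuclideanSpace ℝ (Fin N)) : TangentSpace (𝓡 N) p :=
  (mfderiv (𝓡 N) (𝓡 N) e p).inverse v

/-- The vector `∂/∂u^i` at `p`. -/
def coordFrame {N : ℕ} {X : Type*} [TopologicalSpace X]
    [ChartedSpace (EuclideanSpace ℝ (Fin N)) X]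
    (e : OpenPartialHomeomorph X (EuclideanSpace ℝ (Fin N))) (p : X) (i : Fin N) :
    TangentSpace (𝓡 N) p :=
  coordVector e p (EuclideanSpace.single i 1)

/-- The covector `du^i` at `p`. -/
def coordCovector {N : ℕ} {X : Type*} [TopologicalSpace X]
    [ChartedSpace (EuclideanSpace ℝ (Fin N)) X]
    (e : OpenPartialHomeomorph X (EuclideanSpace ℝ (Fin N))) (p : X) (i : Fin N) :
    Module.Dual ℝ (TangentSpace (𝓡 N) p) where
  toFun a := EuclideanSpace.proj (𝕜 := ℝ) i (mfderiv (𝓡 N) (𝓡 N) e p a)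
  map_add' a b := by
    rw [map_add]
    rfl
  map_smul' c a := by
    rw [map_smul]
    rfl

/-- `ω^{ij}(u) = ⟨du^i, ω du^j⟩`, for a contravariant 2-tensor viewed as `ω : T^*X → TX`. -/
def bivectorComp {N : ℕ} {X : Type*} [TopologicalSpace X]
    [ChartedSpace (EuclideanSpace ℝ (Fin N)) X]
    (om : (p : X) → Module.Dual ℝ (TangentSpace (𝓡 N) p) →ₗ[ℝ] TangentSpace (𝓡 N) p)
    (e : OpenPartialHomeomorph X (EuclideanSpace ℝ (Fin N)))
    (u : EuclideanSpace ℝ (Fin N)) (i j : Fin N) : ℝ :=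
  coordCovector e (e.symm u) i (om (e.symm u) (coordCovector e (e.symm u) j))

/-- `M^i_j(u, u_x) = ⟨du^i, M(u, u_x) ∂/∂u^j⟩`. -/
def endoComp {N : ℕ} {X : Type*} [TopologicalSpace X]
    [ChartedSpace (EuclideanSpace ℝ (Fin N)) X]
    (M : (p : X) → TangentSpace (𝓡 N) p → Module.End ℝ (TangentSpace (𝓡 N) p))
    (e : OpenPartialHomeomorph X (EuclideanSpace ℝ (Fin N)))
    (u v : EuclideanSpace ℝ (Fin N)) (i j : Fin N) : ℝ :=
  coordCovector e (e.symm u) i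
    (M (e.symm u) (coordVector e (e.symm u) v) (coordFrame e (e.symm u) j))

/-- `T_{ijk}(u) = T(∂/∂u^i, ∂/∂u^j, ∂/∂u^k)`. -/
def formComp {N : ℕ} {X : Type*} [TopologicalSpace X]
    [ChartedSpace (EuclideanSpace ℝ (Fin N)) X]
    (T : (p : X) → TangentSpace (𝓡 N) p [⋀^Fin 3]→ₗ[ℝ] ℝ)
    (e : OpenPartialHomeomorph X (EuclideanSpace ℝ (Fin N)))
    (u : EuclideanSpace ℝ (Fin N)) (i j k : Fin N) : ℝ :=
  T (e.symm u)
    ![coordFrame e (e.symm u) i, coordFrame e (e.symm u) j, coordFrame e (e.symm u) k]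

/-- The partial derivative `∂f/∂y^i`. -/
def pderiv {N : ℕ} (i : Fin N) (f : EuclideanSpace ℝ (Fin N) → ℝ)
    (y : EuclideanSpace ℝ (Fin N)) : ℝ :=
  fderiv ℝ f y (EuclideanSpace.single i 1)

/-- The total derivative
`d/dx F(u, u_x) = u_x^k ∂F/∂u^k + u_xx^k ∂F/∂u_x^k` at `u = u`, `u_x = v`, `u_xx = w`. -/
def totalDeriv {N : ℕ} (F : EuclideanSpace ℝ (Fin N) → EuclideanSpace ℝ (Fin N) → ℝ)
    (u v w : EuclideanSpace ℝ (Fin N)) : ℝ :=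
  ∑ k, (v k * pderiv k (fun y => F y v) u + w k * pderiv k (fun y => F u y) v)

/-! ### Tensor fields -/

/-- A smooth skew-symmetric contravariant 2-tensor field. -/
structure IsBivector {N : ℕ} {X : Type*} [TopologicalSpace X]
    [ChartedSpace (EuclideanSpace ℝ (Fin N)) X]
    (om : (p : X) → Module.Dual ℝ (TangentSpace (𝓡 N) p) →ₗ[ℝ] TangentSpace (𝓡 N) p) :
    Prop where
  smooth : ∀ e : OpenPartialHomeomorph X (EuclideanSpace ℝ (Fin N)), IsCoordinates e →
    ∀ i j, ContDiffOn ℝ ∞ (fun u => bivectorComp om e u i j) e.target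
  skew : ∀ (p : X) (θ η : Module.Dual ℝ (TangentSpace (𝓡 N) p)), θ (om p η) = -η (om p θ)

/-- A Poisson structure on `X`: a bivector satisfying the Jacobi identity. -/
structure IsPoissonStructure {N : ℕ} {X : Type*} [TopologicalSpace X]
    [ChartedSpace (EuclideanSpace ℝ (Fin N)) X]
    (om : (p : X) → Module.Dual ℝ (TangentSpace (𝓡 N) p) →ₗ[ℝ] TangentSpace (𝓡 N) p) :
    Prop extends IsBivector om where
  jacobi : ∀ e : OpenPartialHomeomorph X (EuclideanSpace ℝ (Fin N)), IsCoordinates e →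
    ∀ u ∈ e.target, ∀ i j k,
      ∑ r, (pderiv r (fun y => bivectorComp om e y i j) u * bivectorComp om e u r k
        + pderiv r (fun y => bivectorComp om e y j k) u * bivectorComp om e u r i
        + pderiv r (fun y => bivectorComp om e y k i) u * bivectorComp om e u r j) = 0

/-- A smooth closed differential 3-form on `X`. -/
structure IsClosedThreeForm {N : ℕ} {X : Type*} [TopologicalSpace X]
    [ChartedSpace (EuclideanSpace ℝ (Fin N)) X]
    (T : (p : X) → TangentSpace (𝓡 N) p [⋀^Fin 3]→ₗ[ℝ] ℝ) : Prop where
  smooth : ∀ e : OpenPartialHomeomorph X (EuclideanSpace ℝ (Fin N)), IsCoordinates e →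
    ∀ i j k, ContDiffOn ℝ ∞ (fun u => formComp T e u i j k) e.target
  closed : ∀ e : OpenPartialHomeomorph X (EuclideanSpace ℝ (Fin N)), IsCoordinates e →
    ∀ u ∈ e.target, ∀ i j k l,
      pderiv i (fun y => formComp T e y j k l) u - pderiv j (fun y => formComp T e y i k l) u
        + pderiv k (fun y => formComp T e y i j l) u
        - pderiv l (fun y => formComp T e y i j k) u = 0

/-- The pairs `(u, u_x)` of coordinate values that lie in a set `D` of tangent vectors. -/
def coordDomain {N : ℕ} {X : Type*} [TopologicalSpace X]
    [ChartedSpace (EuclideanSpace ℝ (Fin N)) X]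
    (D : Set (TangentBundle (𝓡 N) X))
    (e : OpenPartialHomeomorph X (EuclideanSpace ℝ (Fin N))) :
    Set (EuclideanSpace ℝ (Fin N) × EuclideanSpace ℝ (Fin N)) :=
  {z | z.1 ∈ e.target ∧
    (⟨e.symm z.1, coordVector e (e.symm z.1) z.2⟩ : TangentBundle (𝓡 N) X) ∈ D}

/-- The matrix `M^i_j(u, u_x)` depends smoothly on `(u, u_x) ∈ D`. -/
def IsSmoothEndoOn {N : ℕ} {X : Type*} [TopologicalSpace X]
    [ChartedSpace (EuclideanSpace ℝ (Fin N)) X]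
    (D : Set (TangentBundle (𝓡 N) X))
    (M : (p : X) → TangentSpace (𝓡 N) p → Module.End ℝ (TangentSpace (𝓡 N) p)) : Prop :=
  ∀ e : OpenPartialHomeomorph X (EuclideanSpace ℝ (Fin N)), IsCoordinates e →
    ∀ i j, ContDiffOn ℝ ∞
      (fun z : EuclideanSpace ℝ (Fin N) × EuclideanSpace ℝ (Fin N) =>
        endoComp M e z.1 z.2 i j) (coordDomain D e)

/-- The map `a ↦ T(·, a, v)` from tangent vectors to covectors, with matrix `T_{pjk} v^k`. -/
def contractForm {V : Type*} [AddCommGroup V] [Module ℝ V] (T : V [⋀^Fin 3]→ₗ[ℝ] ℝ) (v : V) :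
    V →ₗ[ℝ] Module.Dual ℝ V :=
  have h0 (a b c : V) : Function.update ![b, a, v] 0 c = ![c, a, v] := by
    ext i; fin_cases i <;> rfl
  have h1 (a b c : V) : Function.update ![b, a, v] 1 c = ![b, c, v] := by
    ext i; fin_cases i <;> rfl
  LinearMap.mk₂ ℝ (fun a b => T ![b, a, v])
    (fun a a' b => by simpa only [h1] using T.map_update_add ![b, a, v] 1 a a')
    (fun c a b => by simpa only [h1] using T.map_update_smul ![b, a, v] 1 c a)
    (fun a b b' => by simpa only [h0] using T.map_update_add ![b, a, v] 0 b b')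
    (fun c a b => by simpa only [h0] using T.map_update_smul ![b, a, v] 0 c b)

/-- `M^s_j(u, u_x) = δ^s_j + ω^{sp}(u) T_{pjk}(u) u_x^k`. -/
def gaugeEndo {N : ℕ} {X : Type*} [TopologicalSpace X]
    [ChartedSpace (EuclideanSpace ℝ (Fin N)) X]
    (om : (p : X) → Module.Dual ℝ (TangentSpace (𝓡 N) p) →ₗ[ℝ] TangentSpace (𝓡 N) p)
    (T : (p : X) → TangentSpace (𝓡 N) p [⋀^Fin 3]→ₗ[ℝ] ℝ)
    (p : X) (v : TangentSpace (𝓡 N) p) : Module.End ℝ (TangentSpace (𝓡 N) p) :=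
  LinearMap.id + om p ∘ₗ contractForm (T p) v

/-! ### Loops and functionals -/

/-- The velocity `γ_x` of a loop, a tangent vector at `γ(x)`. -/
def velocity {N : ℕ} {X : Type*} [TopologicalSpace X]
    [ChartedSpace (EuclideanSpace ℝ (Fin N)) X]
    (γ : UnitAddCircle → X) (x : ℝ) : TangentSpace (𝓡 N) (γ x) :=
  mfderiv 𝓘(ℝ, ℝ) (𝓡 N) (fun y : ℝ => γ y) x (1 : ℝ)

/-- Smooth loops `S^1 = ℝ/ℤ → X` with `(γ, γ_x) ∈ D` everywhere; for `D = univ` this is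
the whole loop space of `X`. -/
def IsLoop {N : ℕ} {X : Type*} [TopologicalSpace X]
    [ChartedSpace (EuclideanSpace ℝ (Fin N)) X]
    (D : Set (TangentBundle (𝓡 N) X)) (γ : UnitAddCircle → X) : Prop :=
  ContMDiff 𝓘(ℝ, ℝ) (𝓡 N) ∞ (fun x : ℝ => γ x) ∧
    ∀ x : ℝ, (⟨γ x, velocity γ x⟩ : TangentBundle (𝓡 N) X) ∈ D

/-- A smooth family of loops with finitely many parameters, ranging over an open set `U`. -/
structure IsLoopFamily {N : ℕ} {X : Type*} [TopologicalSpace X]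
    [ChartedSpace (EuclideanSpace ℝ (Fin N)) X]
    (D : Set (TangentBundle (𝓡 N) X)) {m : ℕ} (U : Set (EuclideanSpace ℝ (Fin m)))
    (Γ : EuclideanSpace ℝ (Fin m) → UnitAddCircle → X) : Prop where
  isOpen : IsOpen U
  smooth : ContMDiffOn 𝓘(ℝ, EuclideanSpace ℝ (Fin m) × ℝ) (𝓡 N) ∞
    (fun z : EuclideanSpace ℝ (Fin m) × ℝ => Γ z.1 z.2) (U ×ˢ Set.univ)
  isLoop : ∀ q ∈ U, IsLoop D (Γ q)

/-- A field of covectors along every loop (a 1-form on the loop space). -/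
abbrev CovectorField (N : ℕ) (X : Type*) [TopologicalSpace X]
    [ChartedSpace (EuclideanSpace ℝ (Fin N)) X] :=
  (γ : UnitAddCircle → X) → (x : UnitAddCircle) → Module.Dual ℝ (TangentSpace (𝓡 N) (γ x))

/-- The smooth functional `I` on the space of loops in `D` has the variational derivative
`ξ = δI/δu`: along every smooth family of loops `ξ` is smooth, and the derivative of `I` in the
direction of a parameter `a` is `∫ (δI/δu^i(x)) ∂_a u^i(x) dx`. -/
structure HasVariationalDerivative {N : ℕ} {X : Type*} [TopologicalSpace X]
    [ChartedSpace (EuclideanSpace ℝ (Fin N)) X]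
    (D : Set (TangentBundle (𝓡 N) X)) (I : (UnitAddCircle → X) → ℝ)
    (ξ : CovectorField N X) : Prop where
  smooth : ∀ (m : ℕ) (U : Set (EuclideanSpace ℝ (Fin m)))
    (Γ : EuclideanSpace ℝ (Fin m) → UnitAddCircle → X), IsLoopFamily D U Γ →
    ∀ e : OpenPartialHomeomorph X (EuclideanSpace ℝ (Fin N)), IsCoordinates e →
    ∀ i, ContDiffOn ℝ ∞
      (fun z : EuclideanSpace ℝ (Fin m) × ℝ =>
        ξ (Γ z.1) z.2 (coordFrame e (Γ z.1 z.2) i))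
      {z | z.1 ∈ U ∧ Γ z.1 z.2 ∈ e.source}
  variation : ∀ (m : ℕ) (U : Set (EuclideanSpace ℝ (Fin m)))
    (Γ : EuclideanSpace ℝ (Fin m) → UnitAddCircle → X), IsLoopFamily D U Γ →
    ∀ q ∈ U, ∀ a : EuclideanSpace ℝ (Fin m),
      HasLineDerivAt ℝ (fun q' => I (Γ q'))
        (∫ x in (0 : ℝ)..1, ξ (Γ q) x
          (mfderiv 𝓘(ℝ, EuclideanSpace ℝ (Fin m)) (𝓡 N) (fun q' => Γ q' x) q a)) q a

/-- The functional `γ ↦ ∫ ξ_i(x) A^{ij}(u, u_x) η_j(x) dx`.  For `ξ = δI/δu` and `η = δJ/δu` it is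
the bracket `{I, J}`. -/
def loopBracket {N : ℕ} {X : Type*} [TopologicalSpace X]
    [ChartedSpace (EuclideanSpace ℝ (Fin N)) X]
    (A : (p : X) → TangentSpace (𝓡 N) p →
      Module.Dual ℝ (TangentSpace (𝓡 N) p) →ₗ[ℝ] TangentSpace (𝓡 N) p)
    (ξ η : CovectorField N X) (γ : UnitAddCircle → X) : ℝ :=
  ∫ x in (0 : ℝ)..1, ξ γ x (A (γ x) (velocity γ x) (η γ x))

/-- The matrix operator `A^{ij}(u, u_x)` gives a Poisson bracket on the functionals on the space
of loops in `D`: the bracket of two functionals is a functional, and the bracket is skew-symmetric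
and satisfies the Jacobi identity `{{I, J}, K} + {{J, K}, I} + {{K, I}, J} = 0`. -/
structure GivesPoissonBracket {N : ℕ} {X : Type*} [TopologicalSpace X]
    [ChartedSpace (EuclideanSpace ℝ (Fin N)) X]
    (D : Set (TangentBundle (𝓡 N) X))
    (A : (p : X) → TangentSpace (𝓡 N) p →
      Module.Dual ℝ (TangentSpace (𝓡 N) p) →ₗ[ℝ] TangentSpace (𝓡 N) p) : Prop where
  closed : ∀ (I J : (UnitAddCircle → X) → ℝ) (dI dJ : CovectorField N X),
    HasVariationalDerivative D I dI → HasVariationalDerivative D J dJ →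
    ∃ dIJ : CovectorField N X, HasVariationalDerivative D (loopBracket A dI dJ) dIJ
  skew : ∀ (I J : (UnitAddCircle → X) → ℝ) (dI dJ : CovectorField N X),
    HasVariationalDerivative D I dI → HasVariationalDerivative D J dJ →
    ∀ γ, IsLoop D γ → loopBracket A dI dJ γ = -loopBracket A dJ dI γ
  jacobi : ∀ (I J K : (UnitAddCircle → X) → ℝ) (dI dJ dK dIJ dJK dKI : CovectorField N X),
    HasVariationalDerivative D I dI → HasVariationalDerivative D J dJ →
    HasVariationalDerivative D K dK →
    HasVariationalDerivative D (loopBracket A dI dJ) dIJ →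
    HasVariationalDerivative D (loopBracket A dJ dK) dJK →
    HasVariationalDerivative D (loopBracket A dK dI) dKI →
    ∀ γ, IsLoop D γ →
      loopBracket A dIJ dK γ + loopBracket A dJK dI γ + loopBracket A dKI dJ γ = 0

/-! ### The two relations, in local coordinates -/

/-- `ω^{ij} ω^{rp} ∂M^s_r/∂u_x^i = ω^{is} ω^{rj} ∂M^p_r/∂u_x^i`. -/
def Relation1 {N : ℕ} (om : EuclideanSpace ℝ (Fin N) → Fin N → Fin N → ℝ)
    (M : EuclideanSpace ℝ (Fin N) → EuclideanSpace ℝ (Fin N) → Fin N → Fin N → ℝ)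
    (u v : EuclideanSpace ℝ (Fin N)) : Prop :=
  ∀ j p s : Fin N,
    ∑ i, ∑ r, om u i j * om u r p * pderiv i (fun y => M u y s r) v
      = ∑ i, ∑ r, om u i s * om u r j * pderiv i (fun y => M u y p r) v

/-- The second relation:
`ω^{ij} ω^{rp} ∂M^s_r/∂u^i - ω^{ij} d/dx(∂M^s_r/∂u_x^i ω^{rp}) + ∂ω^{ij}/∂u^r ω^{rp} M^s_i`
`+ ω^{is} ω^{rj} ∂M^p_r/∂u^i + d/dx(ω^{is}) ∂M^p_r/∂u_x^i ω^{rj} + ∂ω^{is}/∂u^r ω^{rj} M^p_i`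
`+ ω^{ip} ω^{rs} ∂M^j_r/∂u^i + d/dx(ω^{ip}) ∂M^j_r/∂u_x^i ω^{rs} + ∂ω^{ip}/∂u^r ω^{rs} M^j_i`
`= 0`. -/
def Relation2 {N : ℕ} (om : EuclideanSpace ℝ (Fin N) → Fin N → Fin N → ℝ)
    (M : EuclideanSpace ℝ (Fin N) → EuclideanSpace ℝ (Fin N) → Fin N → Fin N → ℝ)
    (u v w : EuclideanSpace ℝ (Fin N)) : Prop :=
  ∀ j p s : Fin N, ∑ i, ∑ r,
    (om u i j * om u r p * pderiv i (fun y => M y v s r) u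
      - om u i j * totalDeriv (fun y z => pderiv i (fun z' => M y z' s r) z * om y r p) u v w
      + pderiv r (fun y => om y i j) u * om u r p * M u v s i
      + om u i s * om u r j * pderiv i (fun y => M y v p r) u
      + totalDeriv (fun y _ => om y i s) u v w * pderiv i (fun z => M u z p r) v * om u r j
      + pderiv r (fun y => om y i s) u * om u r j * M u v p i
      + om u i p * om u r s * pderiv i (fun y => M y v j r) u
      + totalDeriv (fun y _ => om y i p) u v w * pderiv i (fun z => M u z j r) v * om u r s
      + pderiv r (fun y => om y i p) u * om u r s * M u v j i) = 0

end

end LoopPoisson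

namespace LoopPoisson

noncomputable section

open Set Filter Topology

set_option linter.unusedSectionVars false

/-! Write `ξ`, `η`, `ζ` for the variational derivatives of three functionals `I`, `J`, `K`. A
variational derivative is a closed 1-form on the loop space: along a family of loops, the two mixed
parameter derivatives of `I` agree, so the integral of `curl ξ` vanishes (`integral_curl_eq_zero`).
This has three uses.

First, the derivative of `ξ` in a direction along a loop depends only on the tangent vector, not on
the family realising it (`cofieldDeriv_eq_of_tangent`). Second, when `∫ ξ A η` is varied in a
direction `a`, closedness trades `(∂_a ξ)(Aη)` for the derivative of `ξ` along `Aη`, paired with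
`a`. After an integration by parts the variation is a covector field paired with `a`, so the bracket
of two functionals is always a functional (`hasVariationalDerivative_dBracket`). Third, in a family
moving in the directions `Aξ`, `Aη`, `Aζ`, all derivatives of `ξ`, `η`, `ζ` in the cyclic sum of
double brackets combine into curls. What remains is the integral of a density in which only `A` is
differentiated (`exists_jacobi_density`). Directions such as `Aη` are realised by displacing loops
chart by chart with cut-off steps (`LoopFam.exists_extension`). Skew-symmetry of the bracket is
pointwise, so only the Jacobi identity restricts `A`.

For `A = M⁻¹ω` put `α = ξM⁻¹`, and likewise `β`, `κ` for `η`, `ζ`. By skew-symmetry of `A` and `ω`,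
the field `Aξ` is `ωα`. Differentiating `A Mᵀ = ω` removes the inverse from the density. With `P`
the tensor `boundaryTensor` and `R` the left side of (r2), the density becomes `α_a β_b κ'_c P^{bac}
+ α'_a β_b κ_c P^{cba} + α_a β'_b κ_c P^{acb} + α_a β_b κ_c (R + dP^{bac}/dx)`
(`momentumForm_cyclic`). The relation (r1) says that `P` is cyclically invariant, and (r2) says that
`R = 0`. Under both, the density is the `x`-derivative of `α_a β_b κ_c P^{bac}`. This primitive has
a coordinate-free description and hence lives on the circle, so the integral is zero
(`givesPoissonBracket_of_relations`).

Conversely, functionals `∫ a_i(x) h^i(u) dx` give arbitrary `α`, `β`, `κ` along a loop in a chart.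
Integrating the `κ'` term by parts leaves `κ` times a factor, and choosing `κ` equal to that factor
makes it vanish pointwise (`IsClosedCurve.factor_eq_zero`). Suitable `α`, `β` then isolate (r1) and
(r2) at one point. Every `(u, u_x, u_xx)` with `(u, u_x) ∈ D` is reached by a small closed curve,
because `D` is star-shaped in the fibres (`exists_isClosedCurve`).

For the gauge endomorphism, `P` is `T` with its indices raised by `ω`, hence cyclic. In `R` the
terms without `T` are the Jacobi identity of `ω`, and the others reduce to `dT = 0`
(`relations_gaugeMatrix`). -/

/-- The model space `ℝ^N`. -/
abbrev Euc (N : ℕ) := EuclideanSpace ℝ (Fin N)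

/-! ### Coordinates, tangent vectors and tensors on the manifold -/

section Charts

variable {N : ℕ} {X : Type*} [TopologicalSpace X] [ChartedSpace (Euc N) X]

/-- The derivative of a coordinate system at a point. -/
def chartDeriv (e : OpenPartialHomeomorph X (Euc N)) (p : X) :
    TangentSpace (𝓡 N) p →L[ℝ] Euc N :=
  mfderiv (𝓡 N) (𝓡 N) e p

variable [IsManifold (𝓡 N) ∞ X] {e e' : OpenPartialHomeomorph X (Euc N)}

theorem isCoordinates_chartAt (p : X) : IsCoordinates (N := N) (chartAt (Euc N) p) :=
  IsManifold.chart_mem_maximalAtlas p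

theorem IsCoordinates.mdifferentiable (he : IsCoordinates e) :
    e.MDifferentiable (𝓡 N) (𝓡 N) :=
  ⟨(contMDiffOn_of_mem_maximalAtlas he).mdifferentiableOn (by simp),
    (contMDiffOn_symm_of_mem_maximalAtlas he).mdifferentiableOn (by simp)⟩

theorem IsCoordinates.mdifferentiableAt (he : IsCoordinates e) {p : X} (hp : p ∈ e.source) :
    MDifferentiableAt (𝓡 N) (𝓡 N) e p :=
  he.mdifferentiable.mdifferentiableAt hp

/-- The derivative of a coordinate system as a linear equivalence. -/
def chartEquiv (he : IsCoordinates e) {p : X} (hp : p ∈ e.source) :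
    TangentSpace (𝓡 N) p ≃L[ℝ] Euc N :=
  he.mdifferentiable.mfderiv hp

theorem chartEquiv_apply (he : IsCoordinates e) {p : X} (hp : p ∈ e.source)
    (V : TangentSpace (𝓡 N) p) : chartEquiv he hp V = chartDeriv e p V := rfl

theorem chartEquiv_symm_apply (he : IsCoordinates e) {p : X} (hp : p ∈ e.source) (v : Euc N) :
    (chartEquiv he hp).symm v = coordVector e p v := by
  have h : (mfderiv (𝓡 N) (𝓡 N) e p) =
      ((he.mdifferentiable.mfderiv hp : TangentSpace (𝓡 N) p ≃L[ℝ] TangentSpace (𝓡 N) (e p)) :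
      TangentSpace (𝓡 N) p →L[ℝ] TangentSpace (𝓡 N) (e p)) := rfl
  unfold coordVector
  rw [h]
  exact congrFun (congrArg DFunLike.coe (ContinuousLinearMap.inverse_equiv
    (he.mdifferentiable.mfderiv hp)).symm) v

theorem chartDeriv_coordVector (he : IsCoordinates e) {p : X} (hp : p ∈ e.source) (v : Euc N) :
    chartDeriv e p (coordVector e p v) = v := by
  rw [← chartEquiv_symm_apply he hp, ← chartEquiv_apply he hp]
  simp

theorem coordVector_chartDeriv (he : IsCoordinates e) {p : X} (hp : p ∈ e.source)
    (V : TangentSpace (𝓡 N) p) : coordVector e p (chartDeriv e p V) = V := by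
  rw [← chartEquiv_symm_apply he hp, ← chartEquiv_apply he hp]
  simp

theorem chartDeriv_injective (he : IsCoordinates e) {p : X} (hp : p ∈ e.source) :
    Function.Injective (chartDeriv e p) := fun V W h => by
  rw [← coordVector_chartDeriv he hp V, h, coordVector_chartDeriv he hp]

theorem coordVector_smul (he : IsCoordinates e) {p : X} (hp : p ∈ e.source) (c : ℝ) (v : Euc N) :
    coordVector e p (c • v) = c • coordVector e p v := by
  simp only [← chartEquiv_symm_apply he hp, map_smul]

theorem coordCovector_apply (e : OpenPartialHomeomorph X (Euc N)) (p : X) (i : Fin N)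
    (V : TangentSpace (𝓡 N) p) : coordCovector e p i V = chartDeriv e p V i := rfl

theorem coordVector_eq_sum (he : IsCoordinates e) {p : X} (hp : p ∈ e.source) (v : Euc N) :
    coordVector e p v = ∑ i, v i • coordFrame e p i := by
  have h : v = ∑ i, v i • (EuclideanSpace.single i (1 : ℝ) : Euc N) := by
    ext j
    simp [Finset.sum_apply, Pi.single_apply]
  conv_lhs => rw [h]
  simp only [coordFrame, ← chartEquiv_symm_apply he hp, map_sum, map_smul]

theorem covector_coordVector (he : IsCoordinates e) {p : X} (hp : p ∈ e.source)
    (θ : Module.Dual ℝ (TangentSpace (𝓡 N) p)) (v : Euc N) :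
    θ (coordVector e p v) = ∑ i, θ (coordFrame e p i) * v i := by
  rw [coordVector_eq_sum he hp, map_sum]
  exact Finset.sum_congr rfl fun i _ => by rw [map_smul, smul_eq_mul, mul_comm]

theorem covector_apply (he : IsCoordinates e) {p : X} (hp : p ∈ e.source)
    (θ : Module.Dual ℝ (TangentSpace (𝓡 N) p)) (V : TangentSpace (𝓡 N) p) :
    θ V = ∑ i, θ (coordFrame e p i) * chartDeriv e p V i := by
  rw [← covector_coordVector he hp, coordVector_chartDeriv he hp]

theorem covector_eq_sum (he : IsCoordinates e) {p : X} (hp : p ∈ e.source)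
    (θ : Module.Dual ℝ (TangentSpace (𝓡 N) p)) :
    θ = ∑ i, θ (coordFrame e p i) • coordCovector e p i := by
  ext V
  rw [covector_apply he hp]
  simp [coordCovector_apply]

theorem covector_ext (he : IsCoordinates e) {p : X} (hp : p ∈ e.source)
    {θ η : Module.Dual ℝ (TangentSpace (𝓡 N) p)}
    (h : ∀ i, θ (coordFrame e p i) = η (coordFrame e p i)) : θ = η := by
  rw [covector_eq_sum he hp θ, covector_eq_sum he hp η]
  simp only [h]

theorem chartDeriv_coordFrame (he : IsCoordinates e) {p : X} (hp : p ∈ e.source) (i j : Fin N) :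
    chartDeriv e p (coordFrame e p i) j = if j = i then 1 else 0 := by
  rw [coordFrame, chartDeriv_coordVector he hp]
  simp

theorem bivectorComp_chart {p : X} (hp : p ∈ e.source)
    (om : (p : X) → Module.Dual ℝ (TangentSpace (𝓡 N) p) →ₗ[ℝ] TangentSpace (𝓡 N) p)
    (i j : Fin N) :
    bivectorComp om e (e p) i j = coordCovector e p i (om p (coordCovector e p j)) := by
  unfold bivectorComp
  rw [e.left_inv hp]

theorem endoComp_chart {p : X} (hp : p ∈ e.source)
    (M : (p : X) → TangentSpace (𝓡 N) p → Module.End ℝ (TangentSpace (𝓡 N) p))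
    (v : Euc N) (i j : Fin N) : endoComp M e (e p) v i j =
      coordCovector e p i (M p (coordVector e p v) (coordFrame e p j)) := by
  unfold endoComp
  rw [e.left_inv hp]

theorem chartDeriv_bivector (he : IsCoordinates e) {p : X} (hp : p ∈ e.source)
    (om : (p : X) → Module.Dual ℝ (TangentSpace (𝓡 N) p) →ₗ[ℝ] TangentSpace (𝓡 N) p)
    (θ : Module.Dual ℝ (TangentSpace (𝓡 N) p)) (i : Fin N) :
    chartDeriv e p (om p θ) i = ∑ j, bivectorComp om e (e p) i j * θ (coordFrame e p j) := by
  conv_lhs => rw [covector_eq_sum he hp θ, ← coordCovector_apply, map_sum, map_sum]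
  refine Finset.sum_congr rfl fun j _ => ?_
  rw [bivectorComp_chart hp, map_smul, map_smul, smul_eq_mul, mul_comm]

theorem chartDeriv_endo (he : IsCoordinates e) {p : X} (hp : p ∈ e.source)
    (M : (p : X) → TangentSpace (𝓡 N) p → Module.End ℝ (TangentSpace (𝓡 N) p))
    (V W : TangentSpace (𝓡 N) p) (i : Fin N) :
    chartDeriv e p (M p V W) i =
      ∑ j, endoComp M e (e p) (chartDeriv e p V) i j * chartDeriv e p W j := by
  have h := covector_apply he hp (coordCovector e p i ∘ₗ M p V) W
  simpa only [endoComp_chart hp, coordVector_chartDeriv he hp, LinearMap.comp_apply,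
    coordCovector_apply] using h

/-- The set is the preimage of `D` under the tangent map of `e.symm`, which is continuous over
`e.target`. -/
theorem isOpen_coordDomain (he : IsCoordinates e) {D : Set (TangentBundle (𝓡 N) X)}
    (hD : IsOpen D) : IsOpen (coordDomain D e) := by
  have h1 : ContinuousOn (tangentMapWithin (𝓡 N) (𝓡 N) e.symm e.target)
      (Bundle.TotalSpace.proj ⁻¹' e.target) :=
    (contMDiffOn_symm_of_mem_maximalAtlas he).continuousOn_tangentMapWithin (by simp)
      e.open_target.uniqueMDiffOn
  have h2 : Continuous fun z : Euc N × Euc N => (⟨z.1, z.2⟩ : TangentBundle (𝓡 N) (Euc N)) :=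
    (tangentBundleModelSpaceHomeomorph (𝓡 N)).symm.continuous
  have h3 : ContinuousOn (fun z : Euc N × Euc N =>
      tangentMapWithin (𝓡 N) (𝓡 N) e.symm e.target
        (⟨z.1, z.2⟩ : TangentBundle (𝓡 N) (Euc N))) (e.target ×ˢ univ) :=
    h1.comp h2.continuousOn fun z hz => hz.1
  have h4 : coordDomain D e = (e.target ×ˢ univ) ∩ (fun z : Euc N × Euc N =>
      tangentMapWithin (𝓡 N) (𝓡 N) e.symm e.target
        (⟨z.1, z.2⟩ : TangentBundle (𝓡 N) (Euc N))) ⁻¹' D := by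
    ext z
    simp only [coordDomain, mem_ofPred_eq, mem_inter_iff, mem_prod, mem_univ, and_true,
      mem_preimage]
    refine and_congr_right fun hz => ?_
    have hs : e.symm z.1 ∈ e.source := e.map_target hz
    have : mfderivWithin (𝓡 N) (𝓡 N) e.symm e.target z.1 z.2 = coordVector e (e.symm z.1) z.2 := by
      rw [mfderivWithin_of_mem_nhds (e.open_target.mem_nhds hz)]
      apply chartDeriv_injective he hs
      rw [chartDeriv_coordVector he hs]
      have := he.mdifferentiable.comp_symm_deriv hz
      exact congrFun (congrArg DFunLike.coe this) z.2
    rw [tangentMapWithin, this]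
  rw [h4]
  exact h3.isOpen_inter_preimage (e.open_target.prod isOpen_univ) hD

theorem mem_coordDomain_iff {D : Set (TangentBundle (𝓡 N) X)} {p : X} (hp : p ∈ e.source)
    (v : Euc N) : (e p, v) ∈ coordDomain D e ↔
      (⟨p, coordVector e p v⟩ : TangentBundle (𝓡 N) X) ∈ D := by
  unfold coordDomain
  rw [mem_ofPred_eq, e.left_inv hp]
  simp [e.map_source hp]

theorem chartDeriv_mem_coordDomain_iff (he : IsCoordinates e) {D : Set (TangentBundle (𝓡 N) X)}
    {p : X} (hp : p ∈ e.source) (V : TangentSpace (𝓡 N) p) :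
    (e p, chartDeriv e p V) ∈ coordDomain D e ↔ (⟨p, V⟩ : TangentBundle (𝓡 N) X) ∈ D := by
  rw [mem_coordDomain_iff hp, coordVector_chartDeriv he hp]

/-- The chain rule for the coordinates of a map into a manifold. -/
theorem fderiv_chart_comp (he : IsCoordinates e) {P : Type*} [NormedAddCommGroup P]
    [NormedSpace ℝ P] {f : P → X} {q : P} (hf : MDifferentiableAt 𝓘(ℝ, P) (𝓡 N) f q)
    (hq : f q ∈ e.source) (a : P) :
    chartDeriv e (f q) (mfderiv 𝓘(ℝ, P) (𝓡 N) f q a) = fderiv ℝ (fun y => e (f y)) q a := by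
  have h := mfderiv_comp q (he.mdifferentiableAt hq) hf
  have h' : fderiv ℝ (fun y => e (f y)) q = mfderiv 𝓘(ℝ, P) (𝓡 N) (e ∘ f) q :=
    mfderiv_eq_fderiv.symm
  rw [h', h]
  rfl

theorem transition_contDiffOn (he : IsCoordinates e) (he' : IsCoordinates e') :
    ContDiffOn ℝ ∞ (e' ∘ e.symm) (e.target ∩ e.symm ⁻¹' e'.source) := by
  rw [← contMDiffOn_iff_contDiffOn]
  exact (contMDiffOn_of_mem_maximalAtlas he').comp
    ((contMDiffOn_symm_of_mem_maximalAtlas he).mono inter_subset_left) inter_subset_right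

theorem transition_hasFDerivAt (he : IsCoordinates e) (he' : IsCoordinates e') {p : X}
    (hp : p ∈ e.source) (hp' : p ∈ e'.source) :
    HasFDerivAt (e' ∘ e.symm)
      ((chartDeriv e' p).comp ((chartEquiv he hp).symm : Euc N →L[ℝ] TangentSpace (𝓡 N) p))
      (e p) := by
  have h1 : MDifferentiableAt (𝓡 N) (𝓡 N) e.symm (e p) :=
    he.mdifferentiable.mdifferentiableAt_symm (e.map_source hp)
  have h2 : e.symm (e p) ∈ e'.source := by rwa [e.left_inv hp]
  have h3 : DifferentiableAt ℝ (e' ∘ e.symm) (e p) :=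
    ((transition_contDiffOn he he').contDiffAt ((e.isOpen_inter_preimage_symm
      e'.open_source).mem_nhds ⟨e.map_source hp, h2⟩)).differentiableAt (by simp)
  convert h3.hasFDerivAt using 1
  ext1 v
  have h4 := fderiv_chart_comp he' h1 h2 v
  rw [show (e' ∘ e.symm) = fun y => e' (e.symm y) from rfl, ← h4]
  -- The two vectors are based at `e.symm (e p)` and at `p`, so they have different types and are
  -- compared through their coordinates.
  have h5 : ∀ q, q = p → ∀ V : TangentSpace (𝓡 N) q, ∀ V' : TangentSpace (𝓡 N) p,
      chartDeriv e q V = chartDeriv e p V' → chartDeriv e' q V = chartDeriv e' p V' := by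
    rintro q rfl V V' h
    rw [chartDeriv_injective he hp h]
  symm
  apply h5 _ (e.left_inv hp)
  have h6 : chartDeriv e p ((chartEquiv he hp).symm v) = v := by
    rw [chartEquiv_symm_apply, chartDeriv_coordVector he hp]
  have := he.mdifferentiable.comp_symm_deriv (e.map_source hp)
  exact (congrFun (congrArg DFunLike.coe this) v).trans h6.symm

/-- Whether a curve has a given velocity can be checked in any coordinates. -/
theorem hasDerivAt_chart_change (he : IsCoordinates e) (he' : IsCoordinates e') {f : ℝ → X}
    {t : ℝ} {p : X} (hfp : f t = p) (hp : p ∈ e.source) (hp' : p ∈ e'.source)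
    (hf : ContinuousAt f t) {V : TangentSpace (𝓡 N) p}
    (h : HasDerivAt (fun s => e (f s)) (chartDeriv e p V) t) :
    HasDerivAt (fun s => e' (f s)) (chartDeriv e' p V) t := by
  subst hfp
  have h1 := (transition_hasFDerivAt he he' hp hp').comp_hasDerivAt t h
  have h2 : (fun s => e' (f s)) =ᶠ[𝓝 t] (e' ∘ e.symm) ∘ fun s => e (f s) := by
    filter_upwards [hf (e.open_source.mem_nhds hp)] with s hs
    simp [e.left_inv hs]
  refine (h1.congr_of_eventuallyEq h2).congr_deriv ?_
  rw [ContinuousLinearMap.comp_apply, ← chartEquiv_apply he hp]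
  simp

end Charts

/-! ### Differentiation of integrals depending on parameters -/

section ParametricIntegral

open MeasureTheory

variable {P : Type*} [NormedAddCommGroup P] [NormedSpace ℝ P]

theorem contDiffAt_strip {F : Type*} [NormedAddCommGroup F] [NormedSpace ℝ F]
    {G : P × ℝ → F} {U : Set P} (hU : IsOpen U) (hG : ContDiffOn ℝ ∞ G (U ×ˢ univ)) {z : P × ℝ}
    (hz : z.1 ∈ U) : ContDiffAt ℝ ∞ G z :=
  hG.contDiffAt ((hU.prod isOpen_univ).mem_nhds ⟨hz, mem_univ _⟩)

/-- The time interval is compact, so a bound for the parameter derivative at `q` persists, slightly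
enlarged, for all nearby parameters and all times at once. Dominated differentiation then applies.
-/
theorem hasFDerivAt_integral_strip {G : P × ℝ → ℝ} {U : Set P} (hU : IsOpen U)
    (hG : ContDiffOn ℝ ∞ G (U ×ˢ univ)) {q : P} (hq : q ∈ U) :
    HasFDerivAt (fun q => ∫ x in (0 : ℝ)..1, G (q, x))
      (∫ x in (0 : ℝ)..1, (fderiv ℝ G (q, x)).comp (ContinuousLinearMap.inl ℝ P ℝ)) q := by
  have hS : IsOpen (U ×ˢ (univ : Set ℝ)) := hU.prod isOpen_univ
  have hd : ContinuousOn (fun z : P × ℝ =>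
      (fderiv ℝ G z).comp (ContinuousLinearMap.inl ℝ P ℝ)) (U ×ˢ univ) :=
    (hG.continuousOn_fderiv_of_isOpen hS (by simp)).clm_comp continuousOn_const
  have hline : ∀ q ∈ U, Continuous fun x : ℝ => ((q, x) : P × ℝ) := fun q _ => by fun_prop
  have hGc : ∀ q ∈ U, Continuous fun x : ℝ => G (q, x) := fun q hq =>
    hG.continuousOn.comp_continuous (hline q hq) fun x => ⟨hq, mem_univ _⟩
  have hdc : Continuous fun x : ℝ => (fderiv ℝ G (q, x)).comp (ContinuousLinearMap.inl ℝ P ℝ) :=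
    hd.comp_continuous (hline q hq) fun x => ⟨hq, mem_univ _⟩
  obtain ⟨C, hC⟩ := (isCompact_Icc (a := (0 : ℝ)) (b := 1)).exists_bound_of_continuousOn
    hdc.continuousOn
  have hev : ∀ᶠ q' in 𝓝 q, ∀ x ∈ Icc (0 : ℝ) 1,
      ‖(fderiv ℝ G (q', x)).comp (ContinuousLinearMap.inl ℝ P ℝ)‖ < C + 1 := by
    refine isCompact_Icc.eventually_forall_of_forall_eventually fun x hx => ?_
    have := (hd.continuousAt (hS.mem_nhds (x := (q, x)) ⟨hq, mem_univ x⟩)).norm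
    exact this.eventually (gt_mem_nhds (by linarith [hC x hx]))
  have hs := hev.and (hU.mem_nhds hq)
  refine intervalIntegral.hasFDerivAt_integral_of_dominated_of_fderiv_le
    (μ := volume) (bound := fun _ => C + 1)
    (F := fun q x => G (q, x)) (a := 0) (b := 1) (x₀ := q)
    (F' := fun q x => (fderiv ℝ G (q, x)).comp (ContinuousLinearMap.inl ℝ P ℝ)) hs ?_ ?_ ?_ ?_ ?_ ?_
  · filter_upwards [hU.mem_nhds hq] with q' hq'
    exact (hGc q' hq').aestronglyMeasurable
  · exact (hGc q hq).intervalIntegrable _ _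
  · exact hdc.aestronglyMeasurable
  · refine Eventually.of_forall fun x hx q' hq' => (hq'.1 x ?_).le
    rw [uIoc_of_le zero_le_one] at hx
    exact ⟨hx.1.le, hx.2⟩
  · exact intervalIntegrable_const
  · refine Eventually.of_forall fun x hx q' hq' => ?_
    have h1 := ((contDiffAt_strip hU hG (z := (q', x)) hq'.2).differentiableAt
      (by simp)).hasFDerivAt
    exact h1.comp q' (hasFDerivAt_prodMk_left q' x)

theorem integral_fderiv_strip_apply {G : P × ℝ → ℝ} {U : Set P} (hU : IsOpen U)
    (hG : ContDiffOn ℝ ∞ G (U ×ˢ univ)) {q : P} (hq : q ∈ U) (a : P) :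
    (∫ x in (0 : ℝ)..1, (fderiv ℝ G (q, x)).comp (ContinuousLinearMap.inl ℝ P ℝ)) a =
      ∫ x in (0 : ℝ)..1, fderiv ℝ G (q, x) (a, 0) := by
  have hd : ContinuousOn (fun z : P × ℝ =>
      (fderiv ℝ G z).comp (ContinuousLinearMap.inl ℝ P ℝ)) (U ×ˢ univ) :=
    (hG.continuousOn_fderiv_of_isOpen (hU.prod isOpen_univ) (by simp)).clm_comp continuousOn_const
  have hdc : Continuous fun x : ℝ => (fderiv ℝ G (q, x)).comp (ContinuousLinearMap.inl ℝ P ℝ) :=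
    hd.comp_continuous (by fun_prop) fun x => ⟨hq, mem_univ _⟩
  rw [ContinuousLinearMap.intervalIntegral_apply (hdc.intervalIntegrable _ _)]
  rfl

theorem hasLineDerivAt_integral_strip {G : P × ℝ → ℝ} {U : Set P} (hU : IsOpen U)
    (hG : ContDiffOn ℝ ∞ G (U ×ˢ univ)) {q : P} (hq : q ∈ U) (a : P) :
    HasLineDerivAt ℝ (fun q => ∫ x in (0 : ℝ)..1, G (q, x))
      (∫ x in (0 : ℝ)..1, fderiv ℝ G (q, x) (a, 0)) q a := by
  rw [← integral_fderiv_strip_apply hU hG hq]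
  exact (hasFDerivAt_integral_strip hU hG hq).hasLineDerivAt a

theorem hasDerivAt_along {f : P → ℝ} {f' : ℝ} {q q' a : P} {s : ℝ}
    (h : HasLineDerivAt ℝ f f' (q + s • a) a) (hq : ∀ t : ℝ, q' + t • a = q + t • a) :
    HasDerivAt (fun t => f (q' + t • a)) f' s := by
  have h1 : HasDerivAt (fun t => f ((q + s • a) + t • a)) f' (s - s) := by
    rw [sub_self]
    exact h
  have h2 := h1.comp_sub_const s s
  refine h2.congr_of_eventuallyEq (Eventually.of_forall fun t => ?_)
  simp only [hq]
  congr 1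
  rw [sub_smul]
  abel

/-- The mixed second derivatives of a function whose first derivatives are integrals. -/
theorem integral_mixed_symm {f : P → ℝ} {U : Set P} (hU : IsOpen U) {q : P} (hq : q ∈ U) {a b : P}
    {Ga Gb : P × ℝ → ℝ} (hGa : ContDiffOn ℝ ∞ Ga (U ×ˢ univ)) (hGb : ContDiffOn ℝ ∞ Gb (U ×ˢ univ))
    (hfa : ∀ q ∈ U, HasLineDerivAt ℝ f (∫ x in (0 : ℝ)..1, Ga (q, x)) q a)
    (hfb : ∀ q ∈ U, HasLineDerivAt ℝ f (∫ x in (0 : ℝ)..1, Gb (q, x)) q b) :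
    ∫ x in (0 : ℝ)..1, fderiv ℝ Ga (q, x) (b, 0) =
      ∫ x in (0 : ℝ)..1, fderiv ℝ Gb (q, x) (a, 0) := by
  -- Restriction to the plane through `q` spanned by `a` and `b`. The function `f` is not assumed
  -- differentiable, only to have line derivatives in these two directions.
  set φ : ℝ × ℝ →L[ℝ] P := ((ContinuousLinearMap.fst ℝ ℝ ℝ).smulRight a +
    (ContinuousLinearMap.snd ℝ ℝ ℝ).smulRight b) with hφ
  have hφa : ∀ s t : ℝ, φ (s, t) = s • a + t • b := fun s t => rfl
  set ψ : ℝ × ℝ → P := fun w => q + φ w with hψ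
  have hψ0 : ψ 0 = q := by simp [hψ]
  have hψd : ∀ w, HasFDerivAt ψ φ w := fun w => φ.hasFDerivAt.const_add q
  have hψU : ∀ᶠ w in 𝓝 (0 : ℝ × ℝ), ψ w ∈ U :=
    (hψd 0).continuousAt.eventually (hU.mem_nhds (by rwa [hψ0]))
  set Fa : P → ℝ := fun q => ∫ x in (0 : ℝ)..1, Ga (q, x)
  set Fb : P → ℝ := fun q => ∫ x in (0 : ℝ)..1, Gb (q, x)
  have hFa := fun q' (hq' : q' ∈ U) => hasFDerivAt_integral_strip hU hGa hq'
  have hFb := fun q' (hq' : q' ∈ U) => hasFDerivAt_integral_strip hU hGb hq'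
  have hone : ∀ c : ℝ, HasFDerivAt (fun w : ℝ × ℝ => c) (0 : ℝ × ℝ →L[ℝ] ℝ) 0 := fun c =>
    hasFDerivAt_const c 0
  set L : ℝ × ℝ → (ℝ × ℝ →L[ℝ] ℝ) := fun w =>
    Fa (ψ w) • ContinuousLinearMap.fst ℝ ℝ ℝ + Fb (ψ w) • ContinuousLinearMap.snd ℝ ℝ ℝ
  -- Both partial derivatives on the plane are parametric integrals, hence continuous, so `f ∘ ψ` is
  -- Fréchet differentiable near `0` with derivative `L`. Since `L` is itself differentiable at `0`,
  -- the second derivative is symmetric.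
  have hg : ∀ᶠ w in 𝓝 (0 : ℝ × ℝ), HasFDerivAt (fun w => f (ψ w)) (L w) w := by
    filter_upwards [hψU.eventually_nhds] with w hw
    have key := hasStrictFDerivAt_uncurry_coprod (𝕜 := ℝ) (u := w)
      (f := fun s t => f (ψ (s, t)))
      (f₁ := fun s t => (ContinuousLinearMap.id ℝ ℝ).smulRight (Fa (ψ (s, t))))
      (f₂ := fun s t => (ContinuousLinearMap.id ℝ ℝ).smulRight (Fb (ψ (s, t)))) ?_ ?_ ?_ ?_
    · refine key.hasFDerivAt.congr_fderiv ?_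
      ext <;> simp [L, Function.HasUncurry.uncurry]
    · filter_upwards [hw] with v hv
      have h1 : HasDerivAt (fun s => f ((q + v.2 • b) + s • a)) (Fa (ψ v)) v.1 :=
        hasDerivAt_along (q := q + v.2 • b) (by
          have : q + v.2 • b + v.1 • a = ψ v := by simp only [hψ, hφa]; abel
          rw [this]; exact hfa _ hv) fun _ => rfl
      have h2 : (fun s => f (ψ (s, v.2))) = fun s => f ((q + v.2 • b) + s • a) := by
        funext s; simp only [hψ, hφa]; congr 1; abel
      simp only [h2]
      exact h1.hasFDerivAt.congr_fderiv (by ext; simp [Function.HasUncurry.uncurry])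
    · filter_upwards [hw] with v hv
      have h1 : HasDerivAt (fun s => f ((q + v.1 • a) + s • b)) (Fb (ψ v)) v.2 :=
        hasDerivAt_along (q := q + v.1 • a) (by
          have : q + v.1 • a + v.2 • b = ψ v := by simp only [hψ, hφa]; abel
          rw [this]; exact hfb _ hv) fun _ => rfl
      have h2 : (fun s => f (ψ (v.1, s))) = fun s => f ((q + v.1 • a) + s • b) := by
        funext s; simp only [hψ, hφa]; congr 1; abel
      simp only [h2]
      exact h1.hasFDerivAt.congr_fderiv (by ext; simp [Function.HasUncurry.uncurry])
    · have := (hFa _ hw.self_of_nhds).continuousAt.comp (hψd w).continuousAt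
      exact ((ContinuousLinearMap.smulRightL ℝ ℝ ℝ
        (ContinuousLinearMap.id ℝ ℝ)).continuous.continuousAt).comp this
    · have := (hFb _ hw.self_of_nhds).continuousAt.comp (hψd w).continuousAt
      exact ((ContinuousLinearMap.smulRightL ℝ ℝ ℝ
        (ContinuousLinearMap.id ℝ ℝ)).continuous.continuousAt).comp this
  have ha : HasFDerivAt (fun w => Fa (ψ w)) _ 0 :=
    HasFDerivAt.comp (g := Fa) (0 : ℝ × ℝ) (hψ0 ▸ hFa q hq) (hψd 0)
  have hb : HasFDerivAt (fun w => Fb (ψ w)) _ 0 :=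
    HasFDerivAt.comp (g := Fb) (0 : ℝ × ℝ) (hψ0 ▸ hFb q hq) (hψd 0)
  have hL := (ha.smul_const (ContinuousLinearMap.fst ℝ ℝ ℝ)).add
    (hb.smul_const (ContinuousLinearMap.snd ℝ ℝ ℝ))
  have := second_derivative_symmetric_of_eventually hg hL (0, 1) (1, 0)
  simp only [add_apply, ContinuousLinearMap.smulRight_apply,
    ContinuousLinearMap.comp_apply, hφa, smul_apply] at this
  simp only [zero_smul, one_smul, zero_add, add_zero, ContinuousLinearMap.coe_fst',
    ContinuousLinearMap.coe_snd', smul_eq_mul, mul_one, mul_zero] at this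
  rwa [hψ0, integral_fderiv_strip_apply hU hGa hq, integral_fderiv_strip_apply hU hGb hq] at this

end ParametricIntegral

/-! ### Smooth families of loops and fields along them -/

section Families

variable {N : ℕ} {X : Type*} [TopologicalSpace X] [ChartedSpace (Euc N) X]
  {P : Type*} [NormedAddCommGroup P] [NormedSpace ℝ P]

/-- A smooth family of loops with parameters in an open subset of a normed space. -/
structure LoopFam (D : Set (TangentBundle (𝓡 N) X)) (U : Set P) (Γ : P → UnitAddCircle → X) :
    Prop where
  isOpen : IsOpen U
  smooth : ContMDiffOn 𝓘(ℝ, P × ℝ) (𝓡 N) ∞ (fun z : P × ℝ => Γ z.1 z.2) (U ×ˢ univ)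
  isLoop : ∀ q ∈ U, IsLoop D (Γ q)

/-- The parameters and times at which a family of loops lies in the domain of a chart. -/
def chartDomain (U : Set P) (Γ : P → UnitAddCircle → X) (e : OpenPartialHomeomorph X (Euc N)) :
    Set (P × ℝ) :=
  {z | z.1 ∈ U ∧ Γ z.1 z.2 ∈ e.source}

/-- A family of loops in coordinates. -/
def famCoord (e : OpenPartialHomeomorph X (Euc N)) (Γ : P → UnitAddCircle → X) (z : P × ℝ) :
    Euc N :=
  e (Γ z.1 z.2)

/-- The derivative of a family of loops in a parameter direction. -/
def paramVec (Γ : P → UnitAddCircle → X) (a : P) (q : P) (x : UnitAddCircle) :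
    TangentSpace (𝓡 N) (Γ q x) :=
  mfderiv 𝓘(ℝ, P) (𝓡 N) (fun q' => Γ q' x) q a

/-- A representative in `ℝ` of a point of the circle. -/
def circleRep (x : UnitAddCircle) : ℝ := Quotient.out x

theorem coe_circleRep (x : UnitAddCircle) : (circleRep x : UnitAddCircle) = x :=
  Quotient.out_eq x

/-- The velocity of a loop, as a field on the circle. -/
def circleVelocity (γ : UnitAddCircle → X) (x : UnitAddCircle) : TangentSpace (𝓡 N) (γ x) :=
  (velocity γ (circleRep x) : Euc N)

/-- Smoothness of a field of tangent vectors along a family of loops. -/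
def IsSmoothField (U : Set P) (Γ : P → UnitAddCircle → X)
    (Z : (q : P) → (x : UnitAddCircle) → TangentSpace (𝓡 N) (Γ q x)) : Prop :=
  ∀ e : OpenPartialHomeomorph X (Euc N), IsCoordinates e →
    ContDiffOn ℝ ∞ (fun z : P × ℝ => chartDeriv e (Γ z.1 z.2) (Z z.1 z.2)) (chartDomain U Γ e)

/-- Smoothness of a field of covectors along a family of loops. -/
def IsSmoothCofield (U : Set P) (Γ : P → UnitAddCircle → X)
    (θ : (q : P) → (x : UnitAddCircle) → Module.Dual ℝ (TangentSpace (𝓡 N) (Γ q x))) : Prop :=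
  ∀ e : OpenPartialHomeomorph X (Euc N), IsCoordinates e → ∀ i,
    ContDiffOn ℝ ∞ (fun z : P × ℝ => θ z.1 z.2 (coordFrame e (Γ z.1 z.2) i)) (chartDomain U Γ e)

variable [IsManifold (𝓡 N) ∞ X] {e : OpenPartialHomeomorph X (Euc N)}
  {D : Set (TangentBundle (𝓡 N) X)} {U : Set P} {Γ : P → UnitAddCircle → X}

theorem isOpen_chartDomain' (hU : IsOpen U)
    (hΓ : ContMDiffOn 𝓘(ℝ, P × ℝ) (𝓡 N) ∞ (fun z : P × ℝ => Γ z.1 z.2) (U ×ˢ univ))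
    (e : OpenPartialHomeomorph X (Euc N)) :
    IsOpen (chartDomain U Γ e) := by
  have h := hΓ.continuousOn.isOpen_inter_preimage (hU.prod isOpen_univ)
    e.open_source
  convert h using 1
  ext z
  simp [chartDomain]

theorem famCoord_contDiffOn' 
    (hΓ : ContMDiffOn 𝓘(ℝ, P × ℝ) (𝓡 N) ∞ (fun z : P × ℝ => Γ z.1 z.2) (U ×ˢ univ))
    (he : IsCoordinates e) :
    ContDiffOn ℝ ∞ (famCoord e Γ) (chartDomain U Γ e) := by
  rw [← contMDiffOn_iff_contDiffOn]
  exact (contMDiffOn_of_mem_maximalAtlas he).comp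
    (hΓ.mono fun z hz => ⟨hz.1, mem_univ _⟩) fun z hz => hz.2

theorem LoopFam.isOpen_chartDomain (hΓ : LoopFam D U Γ) (e : OpenPartialHomeomorph X (Euc N)) :
    IsOpen (chartDomain U Γ e) :=
  isOpen_chartDomain' hΓ.isOpen hΓ.smooth e

theorem LoopFam.famCoord_contDiffOn (hΓ : LoopFam D U Γ) (he : IsCoordinates e) :
    ContDiffOn ℝ ∞ (famCoord e Γ) (chartDomain U Γ e) :=
  famCoord_contDiffOn' hΓ.smooth he

theorem LoopFam.famCoord_contDiffAt (hΓ : LoopFam D U Γ) (he : IsCoordinates e) {z : P × ℝ}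
    (hz : z ∈ chartDomain U Γ e) : ContDiffAt ℝ ∞ (famCoord e Γ) z :=
  (hΓ.famCoord_contDiffOn he).contDiffAt ((hΓ.isOpen_chartDomain e).mem_nhds hz)

theorem chartDeriv_paramVec' (hU : IsOpen U)
    (hΓ : ContMDiffOn 𝓘(ℝ, P × ℝ) (𝓡 N) ∞ (fun z : P × ℝ => Γ z.1 z.2) (U ×ˢ univ))
    (he : IsCoordinates e) {z : P × ℝ}
    (hz : z ∈ chartDomain U Γ e) (a : P) :
    chartDeriv e (Γ z.1 z.2) (paramVec Γ a z.1 z.2) = fderiv ℝ (famCoord e Γ) z (a, 0) := by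
  have h1 : MDifferentiableAt 𝓘(ℝ, P) (𝓡 N) (fun q' => Γ q' z.2) z.1 := by
    have h2 : MDifferentiableAt 𝓘(ℝ, P × ℝ) (𝓡 N) (fun z : P × ℝ => Γ z.1 z.2) (z.1, z.2) :=
      (hΓ.contMDiffAt ((hU.prod isOpen_univ).mem_nhds
        ⟨hz.1, mem_univ _⟩)).mdifferentiableAt (by simp)
    exact MDifferentiableAt.comp (I' := 𝓘(ℝ, P × ℝ)) (g := fun z : P × ℝ => Γ z.1 z.2)
      (f := fun q' => (q', z.2)) z.1 h2
      (DifferentiableAt.mdifferentiableAt (by fun_prop))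
  have h3 := fderiv_chart_comp he h1 hz.2 a
  rw [paramVec, h3]
  have h4 := (((famCoord_contDiffOn' hΓ he).contDiffAt
    ((isOpen_chartDomain' hU hΓ e).mem_nhds hz)).differentiableAt (by simp)).hasFDerivAt
  have h5 := HasFDerivAt.comp (g := famCoord e Γ) (f := fun q' => (q', z.2)) z.1 h4
    (hasFDerivAt_prodMk_left z.1 z.2)
  exact congrFun (congrArg DFunLike.coe h5.fderiv) a

theorem LoopFam.chartDeriv_paramVec (hΓ : LoopFam D U Γ) (he : IsCoordinates e) {z : P × ℝ}
    (hz : z ∈ chartDomain U Γ e) (a : P) :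
    chartDeriv e (Γ z.1 z.2) (paramVec Γ a z.1 z.2) = fderiv ℝ (famCoord e Γ) z (a, 0) :=
  chartDeriv_paramVec' hΓ.isOpen hΓ.smooth he hz a

theorem IsLoop.chartDeriv_velocity {γ : UnitAddCircle → X} (hγ : IsLoop D γ)
    (he : IsCoordinates e) {x : ℝ} (hx : γ x ∈ e.source) :
    chartDeriv e (γ x) (velocity γ x) = deriv (fun y : ℝ => e (γ y)) x :=
  fderiv_chart_comp he (hγ.1.mdifferentiableAt (by simp)) hx 1

/-- The chosen representative of a point of the circle differs from `x` by an integer, and the lift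
of a loop to the line has period `1`. -/
theorem IsLoop.circleVelocity_coe {γ : UnitAddCircle → X} (hγ : IsLoop D γ) (x : ℝ) :
    circleVelocity (N := N) γ (x : UnitAddCircle) = velocity (N := N) γ x := by
  obtain ⟨n, hn⟩ : ∃ n : ℤ, circleRep x = x + n := by
    have := coe_circleRep (x : UnitAddCircle)
    rw [← sub_eq_zero, ← AddCircle.coe_sub, AddCircle.coe_eq_zero_iff] at this
    obtain ⟨n, hn⟩ := this
    exact ⟨n, by simp at hn; linarith⟩
  have hper : ∀ y : ℝ, γ (y + n : ℝ) = γ y := fun y => by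
    congr 1
    simp
  set e := chartAt (Euc N) (γ x)
  have he : IsCoordinates e := isCoordinates_chartAt (N := N) _
  have hx : γ x ∈ e.source := mem_chart_source _ _
  apply chartDeriv_injective he hx
  rw [hγ.chartDeriv_velocity he hx]
  unfold circleVelocity
  -- The velocity at `r` is a tangent vector over `γ r`, which equals `γ x` only propositionally.
  -- Hence the comparison of coordinate expressions.
  have key : ∀ r : ℝ, r = x + n → chartDeriv e (γ x) (velocity γ r : Euc N) =
      deriv (fun y : ℝ => e (γ y)) x := by
    rintro r rfl
    have h1 := hγ.chartDeriv_velocity he (x := x + n) (by rwa [hper])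
    rw [← deriv_comp_add_const] at h1
    simp only [hper] at h1
    rw [← h1]
    have h2 : ∀ p q : X, p = q → ∀ v : Euc N, chartDeriv e p v = chartDeriv e q v := by
      rintro p _ rfl v
      rfl
    exact h2 _ _ (hper x).symm _
  exact key _ hn

theorem LoopFam.chartDeriv_velocity (hΓ : LoopFam D U Γ) (he : IsCoordinates e) {z : P × ℝ}
    (hz : z ∈ chartDomain U Γ e) :
    chartDeriv e (Γ z.1 z.2) (velocity (Γ z.1) z.2) = fderiv ℝ (famCoord e Γ) z (0, 1) := by
  rw [(hΓ.isLoop z.1 hz.1).chartDeriv_velocity he hz.2]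
  have h4 := ((hΓ.famCoord_contDiffAt he hz).differentiableAt (by simp)).hasFDerivAt
  have h5 := HasFDerivAt.comp (g := famCoord e Γ) (f := fun y => (z.1, y)) z.2 h4
    (hasFDerivAt_prodMk_right z.1 z.2)
  exact h5.hasDerivAt.deriv

theorem LoopFam.mem_coordDomain (hΓ : LoopFam D U Γ) (he : IsCoordinates e) {z : P × ℝ}
    (hz : z ∈ chartDomain U Γ e) :
    (famCoord e Γ z, fderiv ℝ (famCoord e Γ) z (0, 1)) ∈ coordDomain D e := by
  rw [← hΓ.chartDeriv_velocity he hz]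
  exact (chartDeriv_mem_coordDomain_iff he hz.2 _).2 ((hΓ.isLoop z.1 hz.1).2 z.2)

theorem LoopFam.contDiffOn_deriv (hΓ : LoopFam D U Γ) (he : IsCoordinates e) (w : P × ℝ) :
    ContDiffOn ℝ ∞ (fun z => fderiv ℝ (famCoord e Γ) z w) (chartDomain U Γ e) :=
  ((hΓ.famCoord_contDiffOn he).fderiv_of_isOpen (hΓ.isOpen_chartDomain e) (by simp)).clm_apply
    contDiffOn_const

theorem LoopFam.isSmoothField_paramVec (hΓ : LoopFam D U Γ) (a : P) :
    IsSmoothField (N := N) U Γ (paramVec Γ a) := fun _ he =>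
  (hΓ.contDiffOn_deriv he (a, 0)).congr fun _ hz => hΓ.chartDeriv_paramVec he hz a

/-- A function on the parameters and times is smooth if it is smooth in each chart. -/
theorem LoopFam.contDiffOn_of_charts (hΓ : LoopFam D U Γ) {F : Type*} [NormedAddCommGroup F]
    [NormedSpace ℝ F] {G : P × ℝ → F}
    (h : ∀ e : OpenPartialHomeomorph X (Euc N), IsCoordinates e →
      ContDiffOn ℝ ∞ G (chartDomain U Γ e)) : ContDiffOn ℝ ∞ G (U ×ˢ univ) := fun z hz => by
  have he := isCoordinates_chartAt (N := N) (Γ z.1 z.2)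
  have hz' : z ∈ chartDomain U Γ (chartAt (Euc N) (Γ z.1 z.2)) :=
    ⟨hz.1, mem_chart_source _ _⟩
  exact ((h _ he).contDiffAt ((hΓ.isOpen_chartDomain _).mem_nhds hz')).contDiffWithinAt

theorem LoopFam.contDiffOn_pairing (hΓ : LoopFam D U Γ)
    {θ : (q : P) → (x : UnitAddCircle) → Module.Dual ℝ (TangentSpace (𝓡 N) (Γ q x))}
    {Z : (q : P) → (x : UnitAddCircle) → TangentSpace (𝓡 N) (Γ q x)}
    (hθ : IsSmoothCofield U Γ θ) (hZ : IsSmoothField U Γ Z) :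
    ContDiffOn ℝ ∞ (fun z : P × ℝ => θ z.1 z.2 (Z z.1 z.2)) (U ×ˢ univ) :=
  hΓ.contDiffOn_of_charts fun e he => by
    refine (ContDiffOn.sum (s := Finset.univ) fun i _ =>
      (hθ e he i).mul (contDiffOn_euclidean.1 (hZ e he) i)).congr fun z hz => ?_
    rw [covector_apply he hz.2]

theorem LoopFam.isLoopFamily {m : ℕ} {U : Set (EuclideanSpace ℝ (Fin m))}
    {Γ : EuclideanSpace ℝ (Fin m) → UnitAddCircle → X} (hΓ : LoopFam D U Γ) :
    IsLoopFamily D U Γ :=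
  ⟨hΓ.isOpen, hΓ.smooth, hΓ.isLoop⟩

theorem IsLoopFamily.loopFam {m : ℕ} {U : Set (EuclideanSpace ℝ (Fin m))}
    {Γ : EuclideanSpace ℝ (Fin m) → UnitAddCircle → X} (hΓ : IsLoopFamily D U Γ) :
    LoopFam D U Γ :=
  ⟨hΓ.isOpen, hΓ.smooth, hΓ.isLoop⟩

theorem LoopFam.comp {P' : Type*} [NormedAddCommGroup P'] [NormedSpace ℝ P']
    (hΓ : LoopFam D U Γ) {φ : P' → P} (hφ : ContDiff ℝ ∞ φ) :
    LoopFam D (φ ⁻¹' U) (fun q => Γ (φ q)) where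
  isOpen := hΓ.isOpen.preimage hφ.continuous
  smooth := by
    have h : ContMDiff 𝓘(ℝ, P' × ℝ) 𝓘(ℝ, P × ℝ) ∞ (fun z : P' × ℝ => (φ z.1, z.2)) :=
      ContDiff.contMDiff (by fun_prop)
    exact hΓ.smooth.comp h.contMDiffOn fun z hz => ⟨hz.1, mem_univ _⟩
  isLoop q hq := hΓ.isLoop _ hq

section VariationalDerivative

variable [FiniteDimensional ℝ P] {I : (UnitAddCircle → X) → ℝ} {ξ : CovectorField N X}

/-- The definition of a functional speaks of parameters in `EuclideanSpace ℝ (Fin m)`. A linear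
isomorphism carries it over to any finite-dimensional parameter space, so that parameters can be
added by passing from `P` to `P × ℝ`. -/
theorem HasVariationalDerivative.isSmoothCofield (hI : HasVariationalDerivative D I ξ)
    (hΓ : LoopFam D U Γ) : IsSmoothCofield U Γ fun q => ξ (Γ q) := fun e he i => by
  set L := toEuclidean (E := P)
  have h1 := hI.smooth _ _ _ (hΓ.comp L.symm.contDiff).isLoopFamily e he i
  have h2 : ContDiff ℝ ∞ fun z : P × ℝ => (L z.1, z.2) := by fun_prop
  refine (h1.comp h2.contDiffOn fun z hz => ?_).congr fun z hz => ?_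
  · have := hz.1
    have := hz.2
    constructor <;> simpa
  · simp only [Function.comp_apply]
    rw [L.symm_apply_apply]

/-- The same transport along a linear isomorphism, with the chain rule identifying the two parameter
derivatives. -/
theorem HasVariationalDerivative.hasLineDerivAt (hI : HasVariationalDerivative D I ξ)
    (hΓ : LoopFam D U Γ) {q : P} (hq : q ∈ U) (a : P) :
    HasLineDerivAt ℝ (fun q' => I (Γ q'))
      (∫ x in (0 : ℝ)..1, ξ (Γ q) x (paramVec Γ a q x)) q a := by
  set L := toEuclidean (E := P)
  have h1 := hI.variation _ _ _ (hΓ.comp L.symm.contDiff).isLoopFamily (L q) (by simpa) (L a)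
  have h2 : ∀ (x : ℝ) y b, y ∈ L.symm ⁻¹' U →
      mfderiv 𝓘(ℝ, EuclideanSpace ℝ (Fin _)) (𝓡 N) (fun q' => Γ (L.symm q') x) y b =
      paramVec Γ (L.symm b) (L.symm y) x := by
    intro x y b hy
    have he := isCoordinates_chartAt (N := N) (Γ (L.symm y) x)
    have hx := mem_chart_source (Euc N) (Γ (L.symm y) x)
    apply chartDeriv_injective he hx
    have h3 := (hΓ.comp L.symm.contDiff).chartDeriv_paramVec he (z := (y, x)) ⟨hy, hx⟩ b
    have h4 := hΓ.chartDeriv_paramVec he (z := (L.symm y, x)) ⟨hy, hx⟩ (L.symm b)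
    refine h3.trans (Eq.trans ?_ h4.symm)
    have h5 := ((hΓ.famCoord_contDiffAt he (z := (L.symm y, x)) ⟨hy, hx⟩).differentiableAt
      (by simp)).hasFDerivAt
    have h6 : HasFDerivAt (fun z : EuclideanSpace ℝ (Fin _) × ℝ => (L.symm z.1, z.2))
      ((L.symm : _ →L[ℝ] P).prodMap (ContinuousLinearMap.id ℝ ℝ)) (y, x) :=
      HasFDerivAt.prodMap (f := L.symm) (f₂ := id) (y, x) L.symm.hasFDerivAt (hasFDerivAt_id x)
    have h7 := HasFDerivAt.comp (g := famCoord (chartAt (Euc N) (Γ (L.symm y) x)) Γ)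
      (y, x) h5 h6
    have h8 := congrFun (congrArg DFunLike.coe h7.fderiv) (b, 0)
    exact h8
  have h3 : (∫ x in (0 : ℝ)..1, ξ (Γ (L.symm (L q))) x
      (mfderiv 𝓘(ℝ, EuclideanSpace ℝ (Fin _)) (𝓡 N) (fun q' => Γ (L.symm q') x) (L q) (L a))) =
      ∫ x in (0 : ℝ)..1, ξ (Γ q) x (paramVec Γ a q x) := by
    refine intervalIntegral.integral_congr fun x _ => ?_
    rw [h2 x (L q) (L a) (by simpa), L.symm_apply_apply, L.symm_apply_apply]
  rw [h3] at h1
  unfold HasLineDerivAt at h1 ⊢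
  simpa using h1

end VariationalDerivative

end Families

/-! ### A smooth map of a Euclidean space into a small ball -/

section Squash

variable {E : Type*} [NormedAddCommGroup E] [InnerProductSpace ℝ E]

/-- A smooth map from `E` to the ball of radius `δ` that is the identity to first order at `0`. -/
def squash (δ : ℝ) (y : E) : E := (δ * (√(δ ^ 2 + ‖y‖ ^ 2))⁻¹) • y

theorem squash_zero (δ : ℝ) : squash δ (0 : E) = 0 := smul_zero _

theorem squash_contDiff {δ : ℝ} (hδ : 0 < δ) : ContDiff ℝ ∞ (squash δ : E → E) := by
  have h : ContDiff ℝ ∞ fun y : E => δ ^ 2 + ‖y‖ ^ 2 := contDiff_const.add (contDiff_norm_sq ℝ)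
  have h0 : ∀ y : E, δ ^ 2 + ‖y‖ ^ 2 ≠ 0 := fun y => by positivity
  exact (contDiff_const.mul ((h.sqrt h0).inv fun y => (Real.sqrt_pos.2 (by positivity)).ne')).smul
    contDiff_id

theorem norm_squash_lt {δ : ℝ} (hδ : 0 < δ) (y : E) : ‖squash δ y‖ < δ := by
  have h : 0 < √(δ ^ 2 + ‖y‖ ^ 2) := Real.sqrt_pos.2 (by positivity)
  have h1 : ‖y‖ < √(δ ^ 2 + ‖y‖ ^ 2) := Real.lt_sqrt_of_sq_lt (by nlinarith)
  rw [squash, norm_smul, Real.norm_of_nonneg (by positivity), mul_assoc]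
  have h2 : (√(δ ^ 2 + ‖y‖ ^ 2))⁻¹ * ‖y‖ < 1 := by
    rw [inv_mul_lt_one₀ h]
    exact h1
  nlinarith

theorem squash_hasFDerivAt {δ : ℝ} (hδ : 0 < δ) :
    HasFDerivAt (squash δ : E → E) (ContinuousLinearMap.id ℝ E) 0 := by
  have h : ContDiff ℝ ∞ fun y : E => δ ^ 2 + ‖y‖ ^ 2 := contDiff_const.add (contDiff_norm_sq ℝ)
  have h0 : ∀ y : E, δ ^ 2 + ‖y‖ ^ 2 ≠ 0 := fun y => by positivity
  have h1 : ContDiff ℝ ∞ fun y : E => δ * (√(δ ^ 2 + ‖y‖ ^ 2))⁻¹ :=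
    contDiff_const.mul ((h.sqrt h0).inv fun y => (Real.sqrt_pos.2 (by positivity)).ne')
  have h2 := ((h1.differentiable (by simp)) 0).hasFDerivAt.smul (hasFDerivAt_id (0 : E))
  refine h2.congr_fderiv ?_
  ext y
  simp [Real.sqrt_sq hδ.le, hδ.ne']

end Squash

/-! ### Displacing points of the manifold inside one chart -/

section StepMap

variable {N : ℕ} {X : Type*} [TopologicalSpace X] [ChartedSpace (Euc N) X]

open scoped Classical in
/-- Displacement of a point in a chart, cut off by a bump function `χ`. -/
def stepMap (e : OpenPartialHomeomorph X (Euc N)) (χ : X → ℝ) (δ : ℝ) (p : X) (y : Euc N) : X :=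
  if p ∈ e.source then e.symm (e p + χ p • squash δ y) else p

/-- The conditions under which `stepMap` is smooth. -/
structure IsStep (e : OpenPartialHomeomorph X (Euc N)) (χ : X → ℝ) (δ : ℝ) : Prop where
  coord : IsCoordinates e
  smooth : ContMDiff (𝓡 N) 𝓘(ℝ, ℝ) ∞ χ
  mem_Icc : ∀ p, χ p ∈ Icc (0 : ℝ) 1
  tsupport_subset : tsupport χ ⊆ e.source
  pos : 0 < δ
  ball_subset : ∀ p ∈ tsupport χ, Metric.ball (e p) δ ⊆ e.target

variable [IsManifold (𝓡 N) ∞ X] {e e' : OpenPartialHomeomorph X (Euc N)} {χ : X → ℝ} {δ : ℝ}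

/-- A bump function at `c` has compact support inside the chart domain, and a compact subset of the
open set `e.target` has a uniform thickening that stays inside. The Hausdorff property makes the
bump function smooth on all of `X`. -/
theorem exists_isStep [T2Space X] (he : IsCoordinates e) {c : X} (hc : c ∈ e.source) :
    ∃ χ : X → ℝ, ∃ δ : ℝ, IsStep e χ δ ∧ χ =ᶠ[𝓝 c] 1 := by
  obtain ⟨f, -, hf⟩ := (SmoothBumpFunction.nhds_basis_tsupport (I := 𝓡 N) c).mem_iff.1
    (e.open_source.mem_nhds hc)
  have hK : IsCompact (e '' tsupport f) := f.hasCompactSupport.isCompact.image_of_continuousOn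
    (e.continuousOn.mono hf)
  have hKt : e '' tsupport f ⊆ e.target := by
    rintro _ ⟨p, hp, rfl⟩
    exact e.map_source (hf hp)
  obtain ⟨δ, hδ, hδt⟩ := hK.exists_thickening_subset_open e.open_target hKt
  refine ⟨f, δ, ⟨he, f.contMDiff, fun p => f.mem_Icc, hf, hδ, fun p hp => ?_⟩,
    f.eventuallyEq_one⟩
  exact (Metric.ball_subset_thickening (mem_image_of_mem e hp) δ).trans hδt

theorem stepMap_of_zero (p : X) {y : Euc N} (hp : χ p = 0) : stepMap e χ δ p y = p := by
  unfold stepMap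
  split_ifs with h
  · rw [hp, zero_smul, add_zero, e.left_inv h]
  · rfl

theorem stepMap_zero (p : X) : stepMap e χ δ p 0 = p := by
  unfold stepMap
  split_ifs with h
  · rw [squash_zero, smul_zero, add_zero, e.left_inv h]
  · rfl

theorem IsStep.eventually_eq_zero (h : IsStep e χ δ) {p : X} (hp : p ∉ e.source) :
    χ =ᶠ[𝓝 p] 0 :=
  notMem_tsupport_iff_eventuallyEq.1 fun hp' => hp (h.tsupport_subset hp')

theorem IsStep.eq_zero (h : IsStep e χ δ) {p : X} (hp : p ∉ e.source) : χ p = 0 :=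
  (h.eventually_eq_zero hp).self_of_nhds

/-- On the support of `χ` the displacement is shorter than `δ`; off the support it is zero. -/
theorem IsStep.mem_target (h : IsStep e χ δ) {p : X} (hp : p ∈ e.source) (y : Euc N) :
    e p + χ p • squash δ y ∈ e.target := by
  by_cases hχ : p ∈ tsupport χ
  · apply h.ball_subset p hχ
    rw [mem_ball_iff_norm', sub_add_cancel_left, norm_neg, norm_smul,
      Real.norm_of_nonneg (h.mem_Icc p).1]
    exact (mul_le_of_le_one_left (norm_nonneg _) (h.mem_Icc p).2).trans_lt (norm_squash_lt h.pos y)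
  · rw [image_eq_zero_of_notMem_tsupport hχ, zero_smul, add_zero]
    exact e.map_source hp

/-- Over the chart domain this is a composition of smooth maps. At the other points `χ` vanishes in
a neighbourhood and the map is locally the projection to `X`. -/
theorem IsStep.contMDiff_stepMap (h : IsStep e χ δ) :
    ContMDiff ((𝓡 N).prod 𝓘(ℝ, Euc N)) (𝓡 N) ∞
      (fun z : X × Euc N => stepMap e χ δ z.1 z.2) := by
  intro z
  by_cases hz : z.1 ∈ e.source
  · have hnhds : e.source ×ˢ (univ : Set (Euc N)) ∈ 𝓝 z :=
      (e.open_source.prod isOpen_univ).mem_nhds ⟨hz, mem_univ _⟩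
    have h1 : ContMDiffAt ((𝓡 N).prod 𝓘(ℝ, Euc N)) 𝓘(ℝ, Euc N) ∞
        (fun z : X × Euc N => e z.1 + χ z.1 • squash δ z.2) z := by
      have ha : ContMDiffAt ((𝓡 N).prod 𝓘(ℝ, Euc N)) 𝓘(ℝ, Euc N) ∞
          (fun z : X × Euc N => e z.1) z :=
        (contMDiffAt_of_mem_maximalAtlas h.coord hz).comp z contMDiffAt_fst
      have hb : ContMDiffAt ((𝓡 N).prod 𝓘(ℝ, Euc N)) 𝓘(ℝ, ℝ) ∞
          (fun z : X × Euc N => χ z.1) z := h.smooth.contMDiffAt.comp z contMDiffAt_fst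
      have hc : ContMDiffAt ((𝓡 N).prod 𝓘(ℝ, Euc N)) 𝓘(ℝ, Euc N) ∞
          (fun z : X × Euc N => squash δ z.2) z :=
        (squash_contDiff h.pos).contMDiff.contMDiffAt.comp z contMDiffAt_snd
      exact ha.add (hb.smul hc)
    have h2 : ContMDiffAt ((𝓡 N).prod 𝓘(ℝ, Euc N)) (𝓡 N) ∞
        (fun z : X × Euc N => e.symm (e z.1 + χ z.1 • squash δ z.2)) z :=
      (contMDiffAt_symm_of_mem_maximalAtlas h.coord (h.mem_target hz z.2)).comp z h1
    refine h2.congr_of_eventuallyEq ?_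
    filter_upwards [hnhds] with w hw
    simp only [stepMap, if_pos hw.1]
  · have h1 : ∀ᶠ w : X × Euc N in 𝓝 z, χ w.1 = 0 :=
      continuousAt_fst.eventually (h.eventually_eq_zero hz)
    refine contMDiffAt_fst.congr_of_eventuallyEq ?_
    filter_upwards [h1] with w hw
    exact stepMap_of_zero _ hw

/-- Point and displacement move together, and their velocities add: the derivative of `χ` drops out
because `squash` vanishes at `0`, where its derivative is the identity. This additivity lets steps
in several charts be composed. -/
theorem IsStep.hasDerivAt_stepMap (h : IsStep e χ δ) (he' : IsCoordinates e') {f : ℝ → X} {p : X}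
    (hfp : f 0 = p) (hp' : p ∈ e'.source) (hf : ContinuousAt f 0) {V : TangentSpace (𝓡 N) p}
    (hV : HasDerivAt (fun b => e' (f b)) (chartDeriv e' p V) 0)
    (hχf : DifferentiableAt ℝ (fun b => χ (f b)) 0) (y : Euc N) :
    HasDerivAt (fun b => e' (stepMap e χ δ (f b) (b • y)))
      (chartDeriv e' p (V + χ p • coordVector e p y)) 0 := by
  by_cases hp : p ∈ e.source
  · have h1 := hasDerivAt_chart_change he' h.coord hfp hp' hp hf hV
    have hsq : HasDerivAt (fun b : ℝ => squash δ (b • y)) y 0 := by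
      have := (squash_hasFDerivAt (E := Euc N) h.pos)
      rw [show (0 : Euc N) = (0 : ℝ) • y by simp] at this
      refine (this.comp_hasDerivAt (0 : ℝ) ((hasDerivAt_id (0 : ℝ)).smul_const y)).congr_deriv ?_
      simp
    have h2 : HasDerivAt (fun b => e (f b) + χ (f b) • squash δ (b • y))
        (chartDeriv e p (V + χ p • coordVector e p y)) 0 := by
      refine (h1.add (hχf.hasDerivAt.smul hsq)).congr_deriv ?_
      rw [map_add, map_smul, chartDeriv_coordVector h.coord hp]
      simp [hfp, squash_zero]
    have hev : ∀ᶠ b in 𝓝 (0 : ℝ), f b ∈ e.source :=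
      hf.eventually (e.open_source.mem_nhds (hfp ▸ hp))
    refine hasDerivAt_chart_change h.coord he' (by simp [hfp, stepMap_zero]) hp hp' ?_
      (h2.congr_of_eventuallyEq ?_)
    · have h3 : ContinuousAt (fun b : ℝ => ((f b, b • y) : X × Euc N)) 0 :=
        hf.prodMk (by fun_prop)
      exact h.contMDiff_stepMap.continuous.continuousAt.comp h3
    · filter_upwards [hev] with b hb
      simp only [stepMap, if_pos hb]
      rw [e.right_inv (h.mem_target hb _)]
  · rw [h.eq_zero hp, zero_smul, add_zero]
    refine hV.congr_of_eventuallyEq ?_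
    have := hf.eventually (hfp.symm ▸ h.eventually_eq_zero hp)
    filter_upwards [this] with b hb
    rw [stepMap_of_zero _ hb]

end StepMap

/-! ### Extending a family of loops in the direction of a given vector field -/

section Extension

variable {N : ℕ} {X : Type*} [TopologicalSpace X] [ChartedSpace (Euc N) X]
  {P : Type*} [NormedAddCommGroup P] [NormedSpace ℝ P]
  [IsManifold (𝓡 N) ∞ X] {e : OpenPartialHomeomorph X (Euc N)}
  {D : Set (TangentBundle (𝓡 N) X)} {U : Set P} {Γ : P → UnitAddCircle → X}

theorem exists_mem_Icc_coe_eq (x : UnitAddCircle) : ∃ y ∈ Icc (0 : ℝ) 1, (y : UnitAddCircle) = x := by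
  obtain ⟨y, rfl⟩ : ∃ y : ℝ, (y : UnitAddCircle) = x := ⟨circleRep x, coe_circleRep x⟩
  refine ⟨Int.fract y, ⟨Int.fract_nonneg y, (Int.fract_lt_one y).le⟩, ?_⟩
  rw [Int.fract]
  simp

theorem LoopFam.mono (hΓ : LoopFam D U Γ) {V : Set P} (hV : IsOpen V) (hVU : V ⊆ U) :
    LoopFam D V Γ :=
  ⟨hV, hΓ.smooth.mono (prod_mono_left hVU), fun q hq => hΓ.isLoop q (hVU hq)⟩

theorem loopFam_univ (hU : IsOpen U)
    (hΓ : ContMDiffOn 𝓘(ℝ, P × ℝ) (𝓡 N) ∞ (fun z : P × ℝ => Γ z.1 z.2) (U ×ˢ univ)) :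
    LoopFam (N := N) univ U Γ := by
  refine ⟨hU, hΓ, fun q hq => ⟨?_, fun _ => mem_univ _⟩⟩
  have h : ContMDiff 𝓘(ℝ, ℝ) 𝓘(ℝ, P × ℝ) ∞ fun x : ℝ => (q, x) :=
    ContDiff.contMDiff (by fun_prop)
  exact hΓ.comp_contMDiff h fun x => ⟨hq, mem_univ _⟩

theorem LoopFam.toUniv (hΓ : LoopFam D U Γ) : LoopFam (N := N) univ U Γ :=
  loopFam_univ hΓ.isOpen hΓ.smooth

theorem IsLoop.velocity_mem_of_Icc {γ : UnitAddCircle → X} (hγ : IsLoop (N := N) univ γ)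
    (h : ∀ x ∈ Icc (0 : ℝ) 1, (⟨γ x, velocity γ x⟩ : TangentBundle (𝓡 N) X) ∈ D) : IsLoop D γ := by
  refine ⟨hγ.1, fun x => ?_⟩
  obtain ⟨y, hy, hxy⟩ := exists_mem_Icc_coe_eq x
  have := h y hy
  rw [← hγ.circleVelocity_coe] at this ⊢
  rwa [← hxy]

/-- Loops near a loop in an open set `D` lie in `D`. -/
theorem LoopFam.exists_nhds (hΓ : LoopFam (N := N) univ U Γ) (hD : IsOpen D) {q : P} (hq : q ∈ U)
    (hl : IsLoop D (Γ q)) : ∃ V ⊆ U, q ∈ V ∧ LoopFam D V Γ := by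
  have key : ∀ᶠ q' in 𝓝 q, ∀ x ∈ Icc (0 : ℝ) 1,
      (⟨Γ q' x, velocity (Γ q') x⟩ : TangentBundle (𝓡 N) X) ∈ D := by
    refine isCompact_Icc.eventually_forall_of_forall_eventually fun x _ => ?_
    set e := chartAt (Euc N) (Γ q x)
    have he : IsCoordinates (N := N) e := isCoordinates_chartAt _
    have hz : (q, x) ∈ chartDomain U Γ e := ⟨hq, mem_chart_source _ _⟩
    have hc1 := (hΓ.famCoord_contDiffAt he hz).continuousAt
    have hc2 := ((hΓ.contDiffOn_deriv he (0, 1)).contDiffAt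
      ((hΓ.isOpen_chartDomain e).mem_nhds hz)).continuousAt
    have hmem : (famCoord e Γ (q, x), fderiv ℝ (famCoord e Γ) (q, x) (0, 1)) ∈ coordDomain D e := by
      rw [← hΓ.chartDeriv_velocity he hz]
      exact (chartDeriv_mem_coordDomain_iff he hz.2 _).2 (hl.2 x)
    have := (hc1.prodMk hc2).eventually ((isOpen_coordDomain he hD).mem_nhds hmem)
    filter_upwards [this, (hΓ.isOpen_chartDomain e).mem_nhds hz] with w hw hwz
    rw [← hΓ.chartDeriv_velocity he hwz] at hw
    exact (chartDeriv_mem_coordDomain_iff he hwz.2 _).1 hw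
  obtain ⟨V, hV, hVo, hqV⟩ := eventually_nhds_iff.1 (key.and (hΓ.isOpen.mem_nhds hq))
  refine ⟨V, fun y hy => (hV y hy).2, hqV, hVo,
    hΓ.smooth.mono (prod_mono_left fun y hy => (hV y hy).2), fun y hy => ?_⟩
  exact (hΓ.isLoop y (hV y hy).2).velocity_mem_of_Icc (hV y hy).1

theorem LoopFam.contDiffOn_comp_fun (hΓ : LoopFam D U Γ) {χ : X → ℝ}
    (hχ : ContMDiff (𝓡 N) 𝓘(ℝ, ℝ) ∞ χ) :
    ContDiffOn ℝ ∞ (fun z : P × ℝ => χ (Γ z.1 z.2)) (U ×ˢ univ) := by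
  rw [← contMDiffOn_iff_contDiffOn]
  exact hχ.comp_contMDiffOn hΓ.smooth

/-- Where the loop leaves the chart domain the factor `χ` is locally zero, so the product is smooth
there whatever `g` is. -/
theorem LoopFam.contDiffOn_bump_smul (hΓ : LoopFam D U Γ) {χ : X → ℝ} {δ : ℝ} (h : IsStep e χ δ)
    {F : Type*} [NormedAddCommGroup F] [NormedSpace ℝ F] {g : P × ℝ → F}
    (hg : ContDiffOn ℝ ∞ g (chartDomain U Γ e)) :
    ContDiffOn ℝ ∞ (fun z : P × ℝ => χ (Γ z.1 z.2) • g z) (U ×ˢ univ) := fun z hz => by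
  have hS : IsOpen (U ×ˢ (univ : Set ℝ)) := hΓ.isOpen.prod isOpen_univ
  by_cases hze : Γ z.1 z.2 ∈ e.source
  · have hz' : z ∈ chartDomain U Γ e := ⟨hz.1, hze⟩
    exact (((hΓ.contDiffOn_comp_fun h.smooth).contDiffAt (hS.mem_nhds hz)).smul
      (hg.contDiffAt ((hΓ.isOpen_chartDomain e).mem_nhds hz'))).contDiffWithinAt
  · have h1 : ContinuousAt (fun z : P × ℝ => Γ z.1 z.2) z :=
      (hΓ.smooth.contMDiffAt (hS.mem_nhds hz)).continuousAt
    have h2 := h1.eventually (h.eventually_eq_zero hze)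
    refine (contDiffAt_const (c := (0 : F))).congr_of_eventuallyEq ?_ |>.contDiffWithinAt
    filter_upwards [h2] with w hw
    simp [hw]

/-- Displacement of a family of loops by a step map. -/
theorem contMDiffOn_stepMap_comp (hΓ : ContMDiffOn 𝓘(ℝ, P × ℝ) (𝓡 N) ∞
      (fun z : P × ℝ => Γ z.1 z.2) (U ×ˢ univ)) {χ : X → ℝ} {δ : ℝ} (h : IsStep e χ δ)
    {Y : P → UnitAddCircle → Euc N}
    (hY : ContDiffOn ℝ ∞ (fun z : P × ℝ => Y z.1 z.2) (U ×ˢ univ)) :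
    ContMDiffOn 𝓘(ℝ, P × ℝ) (𝓡 N) ∞ (fun z : P × ℝ => stepMap e χ δ (Γ z.1 z.2) (Y z.1 z.2))
      (U ×ˢ univ) :=
  h.contMDiff_stepMap.comp_contMDiffOn (hΓ.prodMk hY.contMDiffOn)

theorem LoopFam.continuousAt_param (hΓ : LoopFam D U Γ) {q : P} (hq : q ∈ U) (a : P)
    (x : ℝ) : ContinuousAt (fun b : ℝ => Γ (q + b • a) x) 0 := by
  have h : ContinuousAt (fun z : P × ℝ => Γ z.1 z.2) (q + (0 : ℝ) • a, x) :=
    (hΓ.smooth.contMDiffAt ((hΓ.isOpen.prod isOpen_univ).mem_nhds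
      (by simpa using hq))).continuousAt
  exact ContinuousAt.comp (g := fun z : P × ℝ => Γ z.1 z.2) (f := fun b : ℝ => (q + b • a, x))
    h (by fun_prop)

theorem hasDerivAt_line {F : Type*} [NormedAddCommGroup F] [NormedSpace ℝ F]
    {g : P × ℝ → F} {q : P} {x : ℝ} (hg : DifferentiableAt ℝ g (q, x)) (a : P) :
    HasDerivAt (fun b : ℝ => g (q + b • a, x)) (fderiv ℝ g (q, x) (a, 0)) 0 := by
  have h1 : HasDerivAt (fun b : ℝ => (q + b • a, x)) (a, (0 : ℝ)) 0 := by
    have := ((hasDerivAt_id (0 : ℝ)).smul_const a).const_add q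
    exact (this.congr_deriv (by simp)).prodMk (hasDerivAt_const _ _)
  have h2 : HasFDerivAt g (fderiv ℝ g (q, x)) (q + (0 : ℝ) • a, x) := by
    simpa using hg.hasFDerivAt
  exact h2.comp_hasDerivAt 0 h1

theorem hasDerivAt_snd_line {F : Type*} [NormedAddCommGroup F] [NormedSpace ℝ F]
    {g : (P × ℝ) × ℝ → F} {q : P} {x : ℝ} (hg : DifferentiableAt ℝ g ((q, 0), x)) :
    HasDerivAt (fun b : ℝ => g ((q, b), x)) (fderiv ℝ g ((q, 0), x) ((0, 1), 0)) 0 := by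
  have h := hasDerivAt_line hg ((0 : P), (1 : ℝ))
  simpa using h

/-- The steps in the charts `ec c` are applied one after another, with velocities adding up. No flow
of a vector field on `X` is needed, only the first order in the new parameter. -/
theorem LoopFam.exists_extension_finset (hΓ : LoopFam D U Γ)
    {Z : (q : P) → (x : UnitAddCircle) → TangentSpace (𝓡 N) (Γ q x)} (hZ : IsSmoothField U Γ Z)
    {ι : Type*} (ec : ι → OpenPartialHomeomorph X (Euc N)) (χ : ι → X → ℝ) (δ : ι → ℝ)
    (hstep : ∀ c, IsStep (ec c) (χ c) (δ c)) (s : Finset ι) :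
    ∃ Γ' : P × ℝ → UnitAddCircle → X,
      LoopFam (N := N) univ (U ×ˢ univ) Γ' ∧ (∀ q, Γ' (q, 0) = Γ q) ∧
      ∀ q ∈ U, ∀ x : ℝ, ∀ e : OpenPartialHomeomorph X (Euc N), IsCoordinates e →
        Γ q x ∈ e.source →
        HasDerivAt (fun b => e (Γ' (q, b) x))
          (chartDeriv e (Γ q x) ((∑ c ∈ s, χ c (Γ q x) ^ 2) • Z q x)) 0 := by
  classical
  have hopen : IsOpen (U ×ˢ (univ : Set ℝ)) := hΓ.isOpen.prod isOpen_univ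
  induction s using Finset.induction_on with
  | empty =>
    refine ⟨fun r => Γ r.1, ((hΓ.comp (φ := Prod.fst) contDiff_fst).mono hopen
      fun r hr => hr.1).toUniv, fun q => rfl, fun q _ x e _ _ => ?_⟩
    simpa using hasDerivAt_const (0 : ℝ) (e (Γ q x))
  | insert c s hc ih =>
    obtain ⟨Γ₁, hΓ₁, h0, hd⟩ := ih
    -- One factor `χ c` makes the coordinates of `Z` smooth on the whole circle. The step map
    -- contributes a second one, which is why the velocity carries the weight `χ c ^ 2`.
    set Y : P × ℝ → UnitAddCircle → Euc N := fun r x =>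
      r.2 • (χ c (Γ r.1 x) • chartDeriv (ec c) (Γ r.1 x) (Z r.1 x)) with hY
    have hYs : ContDiffOn ℝ ∞ (fun z : (P × ℝ) × ℝ => Y z.1 z.2) ((U ×ˢ univ) ×ˢ univ) := by
      have h1 := hΓ.contDiffOn_bump_smul (hstep c) (hZ _ (hstep c).coord)
      have h2 : ContDiff ℝ ∞ fun z : (P × ℝ) × ℝ => (z.1.1, z.2) := by fun_prop
      have h3 : ContDiff ℝ ∞ fun z : (P × ℝ) × ℝ => z.1.2 := by fun_prop
      exact h3.contDiffOn.smul (h1.comp h2.contDiffOn fun z hz => ⟨hz.1.1, mem_univ _⟩)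
    refine ⟨fun r x => stepMap (ec c) (χ c) (δ c) (Γ₁ r x) (Y r x),
      loopFam_univ hopen (contMDiffOn_stepMap_comp hΓ₁.smooth (hstep c) hYs), fun q => ?_,
      fun q hq x e he hx => ?_⟩
    · funext x
      simp only [hY, zero_smul, stepMap_zero, h0]
    · have hcont : ContinuousAt (fun b : ℝ => Γ₁ (q, b) x) 0 := by
        simpa using hΓ₁.continuousAt_param (q := (q, 0)) ⟨hq, mem_univ _⟩ (0, 1) x
      have hχd : DifferentiableAt ℝ (fun b => χ c (Γ₁ (q, b) x)) 0 := by
        have h1 := (hΓ₁.contDiffOn_comp_fun (hstep c).smooth).contDiffAt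
          ((hopen.prod isOpen_univ).mem_nhds (x := ((q, 0), x)) ⟨⟨hq, mem_univ _⟩, mem_univ _⟩)
        exact (hasDerivAt_snd_line (h1.differentiableAt (by simp))).differentiableAt
      have h2 := (hstep c).hasDerivAt_stepMap he (f := fun b => Γ₁ (q, b) x)
        (congrFun (h0 q) x) hx hcont (hd q hq x e he hx) hχd
        (χ c (Γ q x) • chartDeriv (ec c) (Γ q x) (Z q x))
      refine h2.congr_deriv ?_
      congr 1
      rw [Finset.sum_insert hc, add_comm, add_smul]
      congr 1
      by_cases hxc : Γ q x ∈ (ec c).source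
      · rw [coordVector_smul (hstep c).coord hxc, coordVector_chartDeriv (hstep c).coord hxc,
          smul_smul, sq]
      · rw [(hstep c).eq_zero hxc]
        simp

/-- A family of loops can be extended in the direction of a vector field along it. -/
theorem LoopFam.exists_extension [T2Space X] (hD : IsOpen D) (hΓ : LoopFam D U Γ)
    {Z : (q : P) → (x : UnitAddCircle) → TangentSpace (𝓡 N) (Γ q x)} (hZ : IsSmoothField U Γ Z)
    {q₀ : P} (hq₀ : q₀ ∈ U) :
    ∃ Γ' : P × ℝ → UnitAddCircle → X, ∃ W : Set (P × ℝ),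
      (q₀, 0) ∈ W ∧ LoopFam D W Γ' ∧ (∀ q, Γ' (q, 0) = Γ q) ∧ (∀ r ∈ W, r.1 ∈ U) ∧
      ∀ q, (q, 0) ∈ W → ∀ x : ℝ, ∀ e : OpenPartialHomeomorph X (Euc N), IsCoordinates e →
        Γ q x ∈ e.source →
        fderiv ℝ (famCoord e Γ') ((q, 0), x) ((0, 1), 0) = chartDeriv e (Γ q x) (Z q x) := by
  choose χ δ hstep hχ1 using fun c : X =>
    exists_isStep (isCoordinates_chartAt (N := N) c) (mem_chart_source (Euc N) c)
  have hpos : ∀ c, {p | 0 < χ c p} ∈ 𝓝 c := fun c => by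
    filter_upwards [hχ1 c] with p hp
    simp [hp]
  have hK : IsCompact ((fun x : ℝ => Γ q₀ x) '' Icc (0 : ℝ) 1) :=
    isCompact_Icc.image (hΓ.isLoop q₀ hq₀).1.continuous
  obtain ⟨s, -, hs⟩ := hK.elim_nhds_subcover (fun c => {p | 0 < χ c p}) fun c _ => hpos c
  -- The total weight of the steps. It is positive along the loop `Γ q₀`, which the finitely many
  -- charts cover, and by compactness along the nearby loops.
  set σ : P × ℝ → ℝ := fun z => ∑ c ∈ s, χ c (Γ z.1 z.2) ^ 2 with hσ
  have hσs : ContDiffOn ℝ ∞ σ (U ×ˢ univ) := ContDiffOn.sum fun c _ =>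
    (hΓ.contDiffOn_comp_fun (hstep c).smooth).pow 2
  have hσ0 : ∀ x ∈ Icc (0 : ℝ) 1, 0 < σ (q₀, x) := fun x hx => by
    obtain ⟨c, hc, hcx⟩ := mem_iUnion₂.1 (hs (mem_image_of_mem _ hx))
    exact Finset.sum_pos' (fun _ _ => sq_nonneg _) ⟨c, hc, pow_pos hcx 2⟩
  have hev : ∀ᶠ q in 𝓝 q₀, ∀ x ∈ Icc (0 : ℝ) 1, 0 < σ (q, x) := by
    refine isCompact_Icc.eventually_forall_of_forall_eventually fun x hx => ?_
    exact (hσs.continuousOn.continuousAt ((hΓ.isOpen.prod isOpen_univ).mem_nhds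
      (x := (q₀, x)) ⟨hq₀, mem_univ _⟩)).eventually (lt_mem_nhds (hσ0 x hx))
  obtain ⟨V, hV, hVo, hqV⟩ := eventually_nhds_iff.1 (hev.and (hΓ.isOpen.mem_nhds hq₀))
  have hVU : V ⊆ U := fun y hy => (hV y hy).2
  have hσV : ∀ q ∈ V, ∀ x : UnitAddCircle, 0 < ∑ c ∈ s, χ c (Γ q x) ^ 2 := fun q hq x => by
    obtain ⟨y, hy, rfl⟩ := exists_mem_Icc_coe_eq x
    exact (hV q hq).1 y hy
  have hΓV := hΓ.mono hVo hVU
  -- Dividing the field by the total weight makes the resulting velocity exactly `Z`.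
  have hZV : IsSmoothField V Γ fun q x => (∑ c ∈ s, χ c (Γ q x) ^ 2)⁻¹ • Z q x := fun e he => by
    have hsub : chartDomain V Γ e ⊆ chartDomain U Γ e := fun z hz => ⟨hVU hz.1, hz.2⟩
    have h1 : ContDiffOn ℝ ∞ (fun z => (σ z)⁻¹) (chartDomain V Γ e) :=
      (hσs.mono fun z hz => ⟨hVU hz.1, mem_univ _⟩).inv fun z hz => (hσV z.1 hz.1 z.2).ne'
    refine (h1.smul ((hZ e he).mono hsub)).congr fun z _ => ?_
    rw [map_smul]
    rfl
  obtain ⟨Γ', hΓ', h0, hd⟩ := hΓV.exists_extension_finset hZV (chartAt (Euc N)) χ δ hstep s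
  obtain ⟨W, hWV, hqW, hW⟩ := hΓ'.exists_nhds hD (q := (q₀, 0)) ⟨hqV, mem_univ _⟩
    (by rw [h0]; exact hΓ.isLoop q₀ hq₀)
  refine ⟨Γ', W, hqW, hW, h0, fun r hr => hVU (hWV hr).1, fun q hq x e he hx => ?_⟩
  have hqV' : q ∈ V := (hWV hq).1
  have h1 := hd q hqV' x e he hx
  rw [smul_smul, mul_inv_cancel₀ (hσV q hqV' x).ne', one_smul] at h1
  have h2 := hasDerivAt_snd_line (((hW.famCoord_contDiffAt he (z := ((q, 0), x))
    ⟨hq, by simpa [h0] using hx⟩).differentiableAt (by simp)))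
  exact h2.unique h1

end Extension

/-! ### Variational derivatives are closed 1-forms on the loop space -/

section Curl

variable {N : ℕ} {X : Type*} [TopologicalSpace X] [ChartedSpace (Euc N) X]
  {P : Type*} [NormedAddCommGroup P] [NormedSpace ℝ P]

/-- The components of a covector field in a chart, along a family of loops. -/
def cofieldCoord (e : OpenPartialHomeomorph X (Euc N)) (ξ : CovectorField N X)
    (Γ : P → UnitAddCircle → X) (i : Fin N) (z : P × ℝ) : ℝ :=
  ξ (Γ z.1) z.2 (coordFrame e (Γ z.1 z.2) i)

/-- The exterior derivative of a covector field on the loop space, along a family of loops. -/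
def curl (ξ : CovectorField N X) (Γ : P → UnitAddCircle → X) (a b : P) (z : P × ℝ) : ℝ :=
  fderiv ℝ (fun z : P × ℝ => ξ (Γ z.1) z.2 (paramVec Γ a z.1 z.2)) z (b, 0) -
    fderiv ℝ (fun z : P × ℝ => ξ (Γ z.1) z.2 (paramVec Γ b z.1 z.2)) z (a, 0)

variable [IsManifold (𝓡 N) ∞ X] {e : OpenPartialHomeomorph X (Euc N)}
  {D : Set (TangentBundle (𝓡 N) X)} {U : Set P} {Γ : P → UnitAddCircle → X}
  {I : (UnitAddCircle → X) → ℝ} {ξ : CovectorField N X}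

theorem circleRep_coe (x : ℝ) : ∃ n : ℤ, circleRep (x : UnitAddCircle) = x + n := by
  have := coe_circleRep (x : UnitAddCircle)
  rw [← sub_eq_zero, ← AddCircle.coe_sub, AddCircle.coe_eq_zero_iff] at this
  obtain ⟨n, hn⟩ := this
  exact ⟨n, by simp at hn; linarith⟩

theorem fderiv_circleRep {F : Type*} [NormedAddCommGroup F] [NormedSpace ℝ F]
    (G : P → UnitAddCircle → F) (q : P) (x : ℝ) :
    fderiv ℝ (fun z : P × ℝ => G z.1 z.2) (q, circleRep (x : UnitAddCircle)) =
      fderiv ℝ (fun z : P × ℝ => G z.1 z.2) (q, x) := by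
  obtain ⟨n, hn⟩ := circleRep_coe x
  have h := fderiv_comp_add_right (𝕜 := ℝ) (f := fun z : P × ℝ => G z.1 z.2) (x := (q, x))
    ((0 : P), (n : ℝ))
  have h2 : (fun z : P × ℝ => G (z + ((0 : P), (n : ℝ))).1 (z + ((0 : P), (n : ℝ))).2) =
      fun z : P × ℝ => G z.1 z.2 := by
    funext z
    simp
  rw [h2] at h
  rw [hn, h]
  simp

theorem cofieldCoord_contDiffOn [FiniteDimensional ℝ P] (hI : HasVariationalDerivative D I ξ)
    (hΓ : LoopFam D U Γ) (he : IsCoordinates e) (i : Fin N) :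
    ContDiffOn ℝ ∞ (cofieldCoord e ξ Γ i) (chartDomain U Γ e) :=
  hI.isSmoothCofield hΓ e he i

theorem cofieldCoord_contDiffAt [FiniteDimensional ℝ P] (hI : HasVariationalDerivative D I ξ)
    (hΓ : LoopFam D U Γ) (he : IsCoordinates e) (i : Fin N) {z : P × ℝ}
    (hz : z ∈ chartDomain U Γ e) : ContDiffAt ℝ ∞ (cofieldCoord e ξ Γ i) z :=
  (cofieldCoord_contDiffOn hI hΓ he i).contDiffAt ((hΓ.isOpen_chartDomain e).mem_nhds hz)

theorem contDiffOn_pairing_paramVec [FiniteDimensional ℝ P] (hI : HasVariationalDerivative D I ξ)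
    (hΓ : LoopFam D U Γ) (a : P) :
    ContDiffOn ℝ ∞ (fun z : P × ℝ => ξ (Γ z.1) z.2 (paramVec Γ a z.1 z.2)) (U ×ˢ univ) :=
  hΓ.contDiffOn_pairing (hI.isSmoothCofield hΓ) (hΓ.isSmoothField_paramVec a)

theorem continuous_fderiv_strip {F : Type*} [NormedAddCommGroup F] [NormedSpace ℝ F]
    {G : P × ℝ → F} (hU : IsOpen U) (hG : ContDiffOn ℝ ∞ G (U ×ˢ univ)) {q : P} (hq : q ∈ U)
    (w : P × ℝ) : Continuous fun x : ℝ => fderiv ℝ G (q, x) w :=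
  ((hG.continuousOn_fderiv_of_isOpen (hU.prod isOpen_univ) (by simp)).clm_apply
    continuousOn_const).comp_continuous (by fun_prop) fun x => ⟨hq, mem_univ _⟩

theorem continuous_curl [FiniteDimensional ℝ P] (hI : HasVariationalDerivative D I ξ)
    (hΓ : LoopFam D U Γ) {q : P} (hq : q ∈ U) (a b : P) :
    Continuous fun x : ℝ => curl ξ Γ a b (q, x) :=
  (continuous_fderiv_strip hΓ.isOpen (contDiffOn_pairing_paramVec hI hΓ a) hq _).sub
    (continuous_fderiv_strip hΓ.isOpen (contDiffOn_pairing_paramVec hI hΓ b) hq _)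

/-- A variational derivative is a closed 1-form on the loop space. -/
theorem integral_curl_eq_zero [FiniteDimensional ℝ P] (hI : HasVariationalDerivative D I ξ)
    (hΓ : LoopFam D U Γ) {q : P} (hq : q ∈ U) (a b : P) :
    ∫ x in (0 : ℝ)..1, curl ξ Γ a b (q, x) = 0 := by
  have h := integral_mixed_symm hΓ.isOpen hq (contDiffOn_pairing_paramVec hI hΓ a)
    (contDiffOn_pairing_paramVec hI hΓ b) (fun q hq => hI.hasLineDerivAt hΓ hq a)
    (fun q hq => hI.hasLineDerivAt hΓ hq b)
  unfold curl
  rw [intervalIntegral.integral_sub, h, sub_self]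
  · exact (continuous_fderiv_strip hΓ.isOpen
      (contDiffOn_pairing_paramVec hI hΓ a) hq _).intervalIntegrable _ _
  · exact (continuous_fderiv_strip hΓ.isOpen
      (contDiffOn_pairing_paramVec hI hΓ b) hq _).intervalIntegrable _ _

theorem fderiv_pairing_paramVec [FiniteDimensional ℝ P] (hI : HasVariationalDerivative D I ξ)
    (hΓ : LoopFam D U Γ) (he : IsCoordinates e) {z : P × ℝ} (hz : z ∈ chartDomain U Γ e)
    (a : P) (w : P × ℝ) :
    fderiv ℝ (fun z : P × ℝ => ξ (Γ z.1) z.2 (paramVec Γ a z.1 z.2)) z w =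
      ∑ i, (fderiv ℝ (cofieldCoord e ξ Γ i) z w * fderiv ℝ (famCoord e Γ) z (a, 0) i +
        cofieldCoord e ξ Γ i z * fderiv ℝ (fderiv ℝ (famCoord e Γ)) z w (a, 0) i) := by
  have h1 : (fun z : P × ℝ => ξ (Γ z.1) z.2 (paramVec Γ a z.1 z.2)) =ᶠ[𝓝 z]
      fun z => ∑ i, cofieldCoord e ξ Γ i z * fderiv ℝ (famCoord e Γ) z (a, 0) i := by
    filter_upwards [(hΓ.isOpen_chartDomain e).mem_nhds hz] with y hy
    rw [covector_apply he hy.2]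
    refine Finset.sum_congr rfl fun i _ => ?_
    rw [hΓ.chartDeriv_paramVec he hy]
    rfl
  have h2 : HasFDerivAt (fderiv ℝ (famCoord e Γ)) (fderiv ℝ (fderiv ℝ (famCoord e Γ)) z) z :=
    (((hΓ.famCoord_contDiffAt he hz).fderiv_right (m := ∞) (by simp)).differentiableAt
      (by simp)).hasFDerivAt
  have h3 : ∀ i, HasFDerivAt (fun z => fderiv ℝ (famCoord e Γ) z (a, 0) i) _ z := fun i =>
    (EuclideanSpace.proj (𝕜 := ℝ) i).hasFDerivAt.comp z (h2.clm_apply (hasFDerivAt_const (a, 0) z))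
  have h4 : ∀ i, HasFDerivAt (cofieldCoord e ξ Γ i) _ z := fun i =>
    ((cofieldCoord_contDiffAt hI hΓ he i hz).differentiableAt (by simp)).hasFDerivAt
  have h5 := HasFDerivAt.fun_sum (u := Finset.univ) fun i _ => (h4 i).mul (h3 i)
  rw [h1.fderiv_eq]
  refine (congrFun (congrArg DFunLike.coe h5.fderiv) w).trans ?_
  simp only [sum_apply, add_apply, smul_apply, smul_eq_mul]
  refine Finset.sum_congr rfl fun i _ => ?_
  simp [add_comm, mul_comm]

/-- The terms with second derivatives of the family cancel by their symmetry, so the curl involves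
only first derivatives of the family and of the components of `ξ`. -/
theorem curl_chart [FiniteDimensional ℝ P] (hI : HasVariationalDerivative D I ξ)
    (hΓ : LoopFam D U Γ) (he : IsCoordinates e) {z : P × ℝ} (hz : z ∈ chartDomain U Γ e)
    (a b : P) : curl ξ Γ a b z = 
      ∑ i, (fderiv ℝ (cofieldCoord e ξ Γ i) z (b, 0) * fderiv ℝ (famCoord e Γ) z (a, 0) i -
        fderiv ℝ (cofieldCoord e ξ Γ i) z (a, 0) * fderiv ℝ (famCoord e Γ) z (b, 0) i) := by
  have h : fderiv ℝ (fderiv ℝ (famCoord e Γ)) z (b, 0) (a, 0) =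
      fderiv ℝ (fderiv ℝ (famCoord e Γ)) z (a, 0) (b, 0) :=
    ((hΓ.famCoord_contDiffAt he hz).isSymmSndFDerivAt
      (by rw [minSmoothness_of_isRCLikeNormedField]; exact ENat.LEInfty.out)) _ _
  rw [curl, fderiv_pairing_paramVec hI hΓ he hz, fderiv_pairing_paramVec hI hΓ he hz, h,
    ← Finset.sum_sub_distrib]
  exact Finset.sum_congr rfl fun i _ => by ring

end Curl

/-! ### The derivative of a variational derivative depends only on the tangent vector -/

section Independence

variable {N : ℕ} {X : Type*} [TopologicalSpace X] [ChartedSpace (Euc N) X]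
  {P P' : Type*} [NormedAddCommGroup P] [NormedSpace ℝ P] [FiniteDimensional ℝ P]
  [NormedAddCommGroup P'] [NormedSpace ℝ P'] [FiniteDimensional ℝ P']
  [IsManifold (𝓡 N) ∞ X] {e : OpenPartialHomeomorph X (Euc N)}
  {D : Set (TangentBundle (𝓡 N) X)} {U : Set P} {Γ : P → UnitAddCircle → X}
  {U' : Set P'} {Γ' : P' → UnitAddCircle → X}
  {I : (UnitAddCircle → X) → ℝ} {ξ : CovectorField N X}

/-- The displacement of the loops of a family in a chart. -/
def stepFam (e : OpenPartialHomeomorph X (Euc N)) (χ : X → ℝ) (δ : ℝ) (Γ : P → UnitAddCircle → X)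
    (Y : UnitAddCircle → Euc N) (r : P × ℝ) (x : UnitAddCircle) : X :=
  stepMap e χ δ (Γ r.1 x) (r.2 • Y x)

theorem stepFam_zero {χ : X → ℝ} {δ : ℝ} (Y : UnitAddCircle → Euc N) (q : P) :
    stepFam e χ δ Γ Y (q, 0) = Γ q := by
  funext x
  simp only [stepFam, zero_smul, stepMap_zero]

theorem LoopFam.exists_stepFam (hD : IsOpen D) (hΓ : LoopFam D U Γ) {χ : X → ℝ} {δ : ℝ}
    (h : IsStep e χ δ) {Y : UnitAddCircle → Euc N} (hY : ContDiff ℝ ∞ fun x : ℝ => Y x)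
    {q : P} (hq : q ∈ U) : ∃ W : Set (P × ℝ), (q, 0) ∈ W ∧ LoopFam D W (stepFam e χ δ Γ Y) ∧
      ∀ r ∈ W, r.1 ∈ U := by
  have hopen : IsOpen (U ×ˢ (univ : Set ℝ)) := hΓ.isOpen.prod isOpen_univ
  have h1 : LoopFam D (U ×ˢ (univ : Set ℝ)) fun r : P × ℝ => Γ r.1 :=
    (hΓ.comp (φ := Prod.fst) contDiff_fst).mono hopen fun r hr => hr.1
  have h2 : ContDiff ℝ ∞ fun z : (P × ℝ) × ℝ => z.1.2 • Y z.2 :=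
    (contDiff_snd.comp contDiff_fst).smul (hY.comp contDiff_snd)
  have h3 : LoopFam (N := N) univ (U ×ˢ (univ : Set ℝ)) (stepFam e χ δ Γ Y) :=
    loopFam_univ hopen (contMDiffOn_stepMap_comp (Γ := fun r : P × ℝ => Γ r.1) h1.smooth h
      (Y := fun (r : P × ℝ) x => r.2 • Y x) h2.contDiffOn)
  obtain ⟨W, hWU, hqW, hW⟩ := h3.exists_nhds hD (q := (q, 0)) ⟨hq, mem_univ _⟩
    (by rw [stepFam_zero]; exact hΓ.isLoop q hq)
  exact ⟨W, hqW, hW, fun r hr => (hWU hr).1⟩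

theorem fderiv_stepFam_snd {χ : X → ℝ} {δ : ℝ} (h : IsStep e χ δ) {Y : UnitAddCircle → Euc N}
    {W : Set (P × ℝ)} (hW : LoopFam D W (stepFam e χ δ Γ Y)) {q : P} (hq : (q, 0) ∈ W)
    {e' : OpenPartialHomeomorph X (Euc N)} (he' : IsCoordinates e') {x : ℝ}
    (hx : Γ q x ∈ e'.source) :
    fderiv ℝ (famCoord e' (stepFam e χ δ Γ Y)) ((q, 0), x) ((0, 1), 0) =
      chartDeriv e' (Γ q x) (χ (Γ q x) • coordVector e (Γ q x) (Y x)) := by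
  have h1 := hasDerivAt_snd_line ((hW.famCoord_contDiffAt he' (z := ((q, 0), x))
    ⟨hq, by rwa [stepFam_zero]⟩).differentiableAt (by simp))
  have h2 := h.hasDerivAt_stepMap he' (f := fun _ => Γ q x) (p := Γ q x) rfl hx
    continuousAt_const (V := 0) (by simpa using hasDerivAt_const (0 : ℝ) (e' (Γ q x)))
    (differentiableAt_const _) (Y x)
  rw [zero_add] at h2
  exact h1.unique h2

theorem fderiv_fst_line {F : Type*} [NormedAddCommGroup F] [NormedSpace ℝ F]
    {g : (P × ℝ) × ℝ → F} {g' : P × ℝ → F} (h : ∀ q x, g ((q, 0), x) = g' (q, x)) {q : P} {x : ℝ}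
    (hg : DifferentiableAt ℝ g ((q, 0), x)) (hg' : DifferentiableAt ℝ g' (q, x)) (a : P) :
    fderiv ℝ g ((q, 0), x) ((a, 0), 0) = fderiv ℝ g' (q, x) (a, 0) := by
  have h1 := hasDerivAt_line hg (a, 0)
  have h2 := hasDerivAt_line hg' a
  simp only [Prod.smul_mk, smul_zero, Prod.mk_add_mk, add_zero, h] at h1
  exact h1.unique h2

theorem eq_zero_of_integral_sq {h : ℝ → ℝ} (hc : Continuous h) (h0 : ∀ x, 0 ≤ h x)
    (hi : ∫ x in (0 : ℝ)..1, h x = 0) {x : ℝ} (hx : x ∈ Icc (0 : ℝ) 1) : h x = 0 := by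
  by_contra hne
  have := intervalIntegral.integral_pos one_pos hc.continuousOn (fun x _ => h0 x)
    ⟨x, hx, lt_of_le_of_ne (h0 x) (Ne.symm hne)⟩
  exact this.ne' hi

/-- The components of the derivative of a covector field in a direction. -/
def cofieldDeriv (e : OpenPartialHomeomorph X (Euc N)) (ξ : CovectorField N X)
    (Γ : P → UnitAddCircle → X) (a : P) (z : P × ℝ) : Euc N :=
  WithLp.toLp 2 fun i => fderiv ℝ (cofieldCoord e ξ Γ i) z (a, 0)

theorem cofieldDeriv_contDiffOn (hI : HasVariationalDerivative D I ξ) (hΓ : LoopFam D U Γ)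
    (he : IsCoordinates e) (a : P) :
    ContDiffOn ℝ ∞ (cofieldDeriv e ξ Γ a) (chartDomain U Γ e) :=
  contDiffOn_euclidean.2 fun i => ((cofieldCoord_contDiffOn hI hΓ he i).fderiv_of_isOpen
    (hΓ.isOpen_chartDomain e) (by simp)).clm_apply contDiffOn_const

theorem cofieldDeriv_circleRep (q a : P) (x : ℝ) :
    cofieldDeriv e ξ Γ a (q, circleRep (x : UnitAddCircle)) = cofieldDeriv e ξ Γ a (q, x) := by
  ext i
  exact congrFun (congrArg DFunLike.coe (fderiv_circleRep
    (fun q x => ξ (Γ q) x (coordFrame e (Γ q x) i)) q x)) (a, 0)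

/-- The derivative of `ξ` in the displacement direction is written through the constant family at `Γ
q`, which shows that it depends only on the loop and on `Y`. For two families through one loop with
equal tangent vectors, the difference of curls therefore contains only the difference of the
derivatives of `ξ` along the families. -/
theorem curl_stepFam (hI : HasVariationalDerivative D I ξ) (hΓ : LoopFam D U Γ) {χ : X → ℝ}
    {δ : ℝ} (h : IsStep e χ δ) {Y : UnitAddCircle → Euc N}
    {W : Set (P × ℝ)} (hW : LoopFam D W (stepFam e χ δ Γ Y)) {q : P} (hq : (q, 0) ∈ W)
    (hqU : q ∈ U) (a : P) {e' : OpenPartialHomeomorph X (Euc N)} (he' : IsCoordinates e') {x : ℝ}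
    (hx : Γ q x ∈ e'.source) :
    curl ξ (stepFam e χ δ Γ Y) (a, 0) (0, 1) ((q, 0), x) =
      ∑ i, (deriv (fun b => ξ (stepFam e χ δ (fun _ => Γ q) Y ((0 : ℝ), b)) x (coordFrame e'
          (stepFam e χ δ (fun _ => Γ q) Y ((0 : ℝ), b) x) i)) 0 *
          fderiv ℝ (famCoord e' Γ) (q, x) (a, 0) i -
        cofieldDeriv e' ξ Γ a (q, x) i *
          chartDeriv e' (Γ q x) (χ (Γ q x) • coordVector e (Γ q x) (Y x)) i) := by
  have hz : ((q, 0), x) ∈ chartDomain W (stepFam e χ δ Γ Y) e' :=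
    ⟨hq, by rwa [stepFam_zero]⟩
  have hz' : (q, x) ∈ chartDomain U Γ e' := ⟨hqU, hx⟩
  rw [curl_chart hI hW he' hz]
  refine Finset.sum_congr rfl fun i _ => ?_
  have h1 := fderiv_fst_line (g := famCoord e' (stepFam e χ δ Γ Y)) (g' := famCoord e' Γ)
    (fun q x => by simp only [famCoord, stepFam_zero])
    ((hW.famCoord_contDiffAt he' hz).differentiableAt (by simp))
    ((hΓ.famCoord_contDiffAt he' hz').differentiableAt (by simp)) a
  have h2 := fderiv_fst_line (g := cofieldCoord e' ξ (stepFam e χ δ Γ Y) i)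
    (g' := cofieldCoord e' ξ Γ i)
    (fun q x => by simp only [cofieldCoord]; rw [stepFam_zero])
    ((cofieldCoord_contDiffAt hI hW he' i hz).differentiableAt (by simp))
    ((cofieldCoord_contDiffAt hI hΓ he' i hz').differentiableAt (by simp)) a
  have h3 := (hasDerivAt_snd_line ((cofieldCoord_contDiffAt hI hW he' i hz).differentiableAt
    (by simp))).deriv
  rw [h1, h2, fderiv_stepFam_snd h hW hq he' hx, ← h3]
  rfl

/-- The derivative of a variational derivative depends only on the tangent vector. -/
theorem cofieldDeriv_eq_of_tangent [T2Space X] (hD : IsOpen D)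
    (hI : HasVariationalDerivative D I ξ)
    (hΓ : LoopFam D U Γ) (hΓ' : LoopFam D U' Γ') {q : P} (hq : q ∈ U) {q' : P'} (hq' : q' ∈ U')
    (hqq : Γ q = Γ' q') {a : P} {a' : P'}
    (ht : ∀ x : ℝ, ∀ e : OpenPartialHomeomorph X (Euc N), IsCoordinates e → Γ q x ∈ e.source →
      fderiv ℝ (famCoord e Γ) (q, x) (a, 0) = fderiv ℝ (famCoord e Γ') (q', x) (a', 0))
    (he : IsCoordinates e) {x : ℝ} (hx : Γ q x ∈ e.source) :
    cofieldDeriv e ξ Γ a (q, x) = cofieldDeriv e ξ Γ' a' (q', x) := by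
  obtain ⟨χ, δ, hs, hχ⟩ := exists_isStep he hx
  set d : UnitAddCircle → Euc N := fun y => cofieldDeriv e ξ Γ a (q, circleRep y) -
    cofieldDeriv e ξ Γ' a' (q', circleRep y) with hd
  have hdc : ∀ y : ℝ, d y = cofieldDeriv e ξ Γ a (q, y) - cofieldDeriv e ξ Γ' a' (q', y) :=
    fun y => by simp only [hd, cofieldDeriv_circleRep]
  set Y : UnitAddCircle → Euc N := fun y => χ (Γ q y) • d y with hY
  have hYs : ContDiff ℝ ∞ fun y : ℝ => Y y := by
    have h1 := hΓ.contDiffOn_bump_smul hs (cofieldDeriv_contDiffOn hI hΓ he a)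
    have h2 := hΓ'.contDiffOn_bump_smul hs (cofieldDeriv_contDiffOn hI hΓ' he a')
    have h3 : ContDiff ℝ ∞ fun y : ℝ => (q, y) := by fun_prop
    have h4 : ContDiff ℝ ∞ fun y : ℝ => (q', y) := by fun_prop
    have h5 := h1.comp_contDiff h3 fun y => ⟨hq, mem_univ _⟩
    have h6 := h2.comp_contDiff h4 fun y => ⟨hq', mem_univ _⟩
    have h7 : (fun y : ℝ => Y y) = fun y : ℝ => χ (Γ q y) • cofieldDeriv e ξ Γ a (q, y) -
        χ (Γ' q' y) • cofieldDeriv e ξ Γ' a' (q', y) := by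
      funext y
      simp only [hY, hdc, smul_sub, hqq]
    rw [h7]
    exact h5.sub h6
  obtain ⟨W, hqW, hW, -⟩ := hΓ.exists_stepFam hD hs hYs hq
  obtain ⟨W', hqW', hW', -⟩ := hΓ'.exists_stepFam hD hs hYs hq'
  set h : UnitAddCircle → ℝ := fun y => χ (Γ q y) ^ 2 * ∑ i, d y i ^ 2
  have key : ∀ y : ℝ, curl ξ (stepFam e χ δ Γ' Y) (a', 0) (0, 1) ((q', 0), y) -
      curl ξ (stepFam e χ δ Γ Y) (a, 0) (0, 1) ((q, 0), y) = h y := by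
    intro y
    by_cases hy : Γ q y ∈ e.source
    · rw [curl_stepFam hI hΓ hs hW hqW hq a he hy,
        curl_stepFam hI hΓ' hs hW' hqW' hq' a' he (by rwa [← hqq]), ← Finset.sum_sub_distrib,
        ht y e he hy, ← hqq]
      simp only [h]
      rw [Finset.mul_sum]
      refine Finset.sum_congr rfl fun i _ => ?_
      rw [map_smul, chartDeriv_coordVector he hy, hY]
      simp only [hdc, PiLp.smul_apply, PiLp.sub_apply, smul_eq_mul]
      ring
    · have he' := isCoordinates_chartAt (N := N) (Γ q y)
      have hy' := mem_chart_source (Euc N) (Γ q y)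
      simp only [h]
      rw [curl_stepFam hI hΓ hs hW hqW hq a he' hy',
        curl_stepFam hI hΓ' hs hW' hqW' hq' a' he' (by rw [← hqq]; exact hy'),
        ← Finset.sum_sub_distrib, ht y _ he' hy', ← hqq, hs.eq_zero hy]
      simp
  have hc : Continuous fun y : ℝ => h y := by
    simp only [← key]
    exact (continuous_curl hI hW' hqW' _ _).sub (continuous_curl hI hW hqW _ _)
  have hinteg : ∫ y in (0 : ℝ)..1, h y = 0 := by
    simp only [← key]
    rw [intervalIntegral.integral_sub ((continuous_curl hI hW' hqW' _ _).intervalIntegrable _ _)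
      ((continuous_curl hI hW hqW _ _).intervalIntegrable _ _), integral_curl_eq_zero hI hW' hqW',
      integral_curl_eq_zero hI hW hqW, sub_zero]
  obtain ⟨y, hy, hyx⟩ := exists_mem_Icc_coe_eq (x : UnitAddCircle)
  have h0 := eq_zero_of_integral_sq hc (fun y => by positivity) hinteg hy
  rw [hyx] at h0
  simp only [h, hχ.self_of_nhds, Pi.one_apply, one_pow, one_mul] at h0
  rw [← sub_eq_zero, ← hdc]
  ext i
  have := (Finset.sum_eq_zero_iff_of_nonneg (fun i _ => sq_nonneg _)).1 h0 i (Finset.mem_univ i)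
  simpa using this

end Independence

/-! ### The variation of a bracket -/

section Operators

variable {N : ℕ} {X : Type*} [TopologicalSpace X] [ChartedSpace (Euc N) X]

/-- The components `A^{ij}(u, u_x)`. -/
def opComp (A : (p : X) → TangentSpace (𝓡 N) p →
      Module.Dual ℝ (TangentSpace (𝓡 N) p) →ₗ[ℝ] TangentSpace (𝓡 N) p)
    (e : OpenPartialHomeomorph X (Euc N)) (i j : Fin N) (z : Euc N × Euc N) : ℝ :=
  coordCovector e (e.symm z.1) i
    (A (e.symm z.1) (coordVector e (e.symm z.1) z.2) (coordCovector e (e.symm z.1) j))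

/-- Smoothness and skew-symmetry of a matrix operator. -/
structure IsSkewOperator (D : Set (TangentBundle (𝓡 N) X)) (A : (p : X) → TangentSpace (𝓡 N) p →
      Module.Dual ℝ (TangentSpace (𝓡 N) p) →ₗ[ℝ] TangentSpace (𝓡 N) p) : Prop where
  smooth : ∀ e : OpenPartialHomeomorph X (Euc N), IsCoordinates e →
    ∀ i j, ContDiffOn ℝ ∞ (opComp A e i j) (coordDomain D e)
  skew : ∀ (p : X) (v : TangentSpace (𝓡 N) p), (⟨p, v⟩ : TangentBundle (𝓡 N) X) ∈ D →
    ∀ θ η : Module.Dual ℝ (TangentSpace (𝓡 N) p), θ (A p v η) = -η (A p v θ)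

/-- The vector field `A^{ij} ξ_j` along a loop. -/
def hamField (A : (p : X) → TangentSpace (𝓡 N) p →
      Module.Dual ℝ (TangentSpace (𝓡 N) p) →ₗ[ℝ] TangentSpace (𝓡 N) p)
    (ξ : CovectorField N X) (γ : UnitAddCircle → X) (x : UnitAddCircle) :
    TangentSpace (𝓡 N) (γ x) :=
  A (γ x) (circleVelocity γ x) (ξ γ x)

variable {P : Type*} [NormedAddCommGroup P] [NormedSpace ℝ P]
  [IsManifold (𝓡 N) ∞ X] {e : OpenPartialHomeomorph X (Euc N)}
  {D : Set (TangentBundle (𝓡 N) X)} {U : Set P} {Γ : P → UnitAddCircle → X}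
  {I J : (UnitAddCircle → X) → ℝ} {ξ η : CovectorField N X}
  {A : (p : X) → TangentSpace (𝓡 N) p →
      Module.Dual ℝ (TangentSpace (𝓡 N) p) →ₗ[ℝ] TangentSpace (𝓡 N) p}

theorem opComp_chart (he : IsCoordinates e) {p : X} (hp : p ∈ e.source)
    (V : TangentSpace (𝓡 N) p) (i j : Fin N) : opComp A e i j (e p, chartDeriv e p V) =
      coordCovector e p i (A p V (coordCovector e p j)) := by
  unfold opComp
  simp only
  rw [e.left_inv hp, coordVector_chartDeriv he hp]

theorem chartDeriv_op (he : IsCoordinates e) {p : X} (hp : p ∈ e.source)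
    (V : TangentSpace (𝓡 N) p) (θ : Module.Dual ℝ (TangentSpace (𝓡 N) p)) (i : Fin N) :
    chartDeriv e p (A p V θ) i =
      ∑ j, opComp A e i j (e p, chartDeriv e p V) * θ (coordFrame e p j) := by
  conv_lhs => rw [covector_eq_sum he hp θ, ← coordCovector_apply, map_sum, map_sum]
  refine Finset.sum_congr rfl fun j _ => ?_
  rw [opComp_chart he hp, map_smul, map_smul, smul_eq_mul, mul_comm]

theorem IsSkewOperator.opComp_skew (hA : IsSkewOperator D A) {z : Euc N × Euc N}
    (hz : z ∈ coordDomain D e) (i j : Fin N) :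
    opComp A e j i z = -opComp A e i j z :=
  hA.skew _ _ hz.2 _ _

theorem IsSkewOperator.contDiffAt (hD : IsOpen D) (hA : IsSkewOperator D A)
    (he : IsCoordinates e) {z : Euc N × Euc N}
    (hz : z ∈ coordDomain D e) (i j : Fin N) : ContDiffAt ℝ ∞ (opComp A e i j) z :=
  (hA.smooth e he i j).contDiffAt ((isOpen_coordDomain he hD).mem_nhds hz)

/-- The pair `(u, u_x)` along a family of loops. -/
def jetCoord (e : OpenPartialHomeomorph X (Euc N)) (Γ : P → UnitAddCircle → X) (z : P × ℝ) :
    Euc N × Euc N :=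
  (famCoord e Γ z, fderiv ℝ (famCoord e Γ) z (0, 1))

theorem LoopFam.chartDeriv_circleVelocity (hΓ : LoopFam D U Γ) (he : IsCoordinates e) {z : P × ℝ}
    (hz : z ∈ chartDomain U Γ e) :
    chartDeriv e (Γ z.1 z.2) (circleVelocity (Γ z.1) z.2) = fderiv ℝ (famCoord e Γ) z (0, 1) := by
  rw [(hΓ.isLoop z.1 hz.1).circleVelocity_coe, hΓ.chartDeriv_velocity he hz]

theorem LoopFam.jetCoord_eq (hΓ : LoopFam D U Γ) (he : IsCoordinates e) {z : P × ℝ}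
    (hz : z ∈ chartDomain U Γ e) : jetCoord e Γ z =
      (e (Γ z.1 z.2), chartDeriv e (Γ z.1 z.2) (circleVelocity (Γ z.1) z.2)) := by
  rw [hΓ.chartDeriv_circleVelocity he hz]
  rfl

theorem LoopFam.jetCoord_mem (hΓ : LoopFam D U Γ) (he : IsCoordinates e) {z : P × ℝ}
    (hz : z ∈ chartDomain U Γ e) : jetCoord e Γ z ∈ coordDomain D e :=
  hΓ.mem_coordDomain he hz

theorem LoopFam.jetCoord_contDiffOn (hΓ : LoopFam D U Γ) (he : IsCoordinates e) :
    ContDiffOn ℝ ∞ (jetCoord e Γ) (chartDomain U Γ e) :=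
  (hΓ.famCoord_contDiffOn he).prodMk (hΓ.contDiffOn_deriv he _)

theorem LoopFam.jetCoord_hasFDerivAt (hΓ : LoopFam D U Γ) (he : IsCoordinates e) {z : P × ℝ}
    (hz : z ∈ chartDomain U Γ e) : HasFDerivAt (jetCoord e Γ)
      ((fderiv ℝ (famCoord e Γ) z).prod
        ((fderiv ℝ (fderiv ℝ (famCoord e Γ)) z).flip (0, 1))) z := by
  have h1 := ((hΓ.famCoord_contDiffAt he hz).differentiableAt (by simp)).hasFDerivAt
  have h2 : HasFDerivAt (fderiv ℝ (famCoord e Γ)) (fderiv ℝ (fderiv ℝ (famCoord e Γ)) z) z :=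
    (((hΓ.famCoord_contDiffAt he hz).fderiv_right (m := ∞) (by simp)).differentiableAt
      (by simp)).hasFDerivAt
  refine h1.prodMk ((h2.clm_apply (hasFDerivAt_const (0, 1) z)).congr_fderiv ?_)
  ext <;> simp

theorem LoopFam.snd_symm (hΓ : LoopFam D U Γ) (he : IsCoordinates e) {z : P × ℝ}
    (hz : z ∈ chartDomain U Γ e) (w w' : P × ℝ) :
    fderiv ℝ (fderiv ℝ (famCoord e Γ)) z w w' = fderiv ℝ (fderiv ℝ (famCoord e Γ)) z w' w :=
  ((hΓ.famCoord_contDiffAt he hz).isSymmSndFDerivAt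
    (by rw [minSmoothness_of_isRCLikeNormedField]; exact ENat.LEInfty.out)) _ _

theorem LoopFam.opComp_contDiffOn (hA : IsSkewOperator D A) (hΓ : LoopFam D U Γ)
    (he : IsCoordinates e) (i j : Fin N) :
    ContDiffOn ℝ ∞ (fun z => opComp A e i j (jetCoord e Γ z)) (chartDomain U Γ e) :=
  (hA.smooth e he i j).comp (hΓ.jetCoord_contDiffOn he) fun _ hz => hΓ.jetCoord_mem he hz

theorem LoopFam.opComp_fderiv_contDiffOn (hD : IsOpen D) (hA : IsSkewOperator D A)
    (hΓ : LoopFam D U Γ) (he : IsCoordinates e) (i j : Fin N) (w : Euc N × Euc N) :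
    ContDiffOn ℝ ∞ (fun z => fderiv ℝ (opComp A e i j) (jetCoord e Γ z) w)
      (chartDomain U Γ e) :=
  (((hA.smooth e he i j).fderiv_of_isOpen (isOpen_coordDomain he hD) (by simp)).comp
    (hΓ.jetCoord_contDiffOn he) fun _ hz => hΓ.jetCoord_mem he hz).clm_apply contDiffOn_const

variable [FiniteDimensional ℝ P]

theorem chartDeriv_hamField (hΓ : LoopFam D U Γ) (he : IsCoordinates e) {z : P × ℝ}
    (hz : z ∈ chartDomain U Γ e) (i : Fin N) :
    chartDeriv e (Γ z.1 z.2) (hamField A ξ (Γ z.1) z.2) i =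
      ∑ j, opComp A e i j (jetCoord e Γ z) * cofieldCoord e ξ Γ j z := by
  rw [hΓ.jetCoord_eq he hz, hamField, chartDeriv_op he hz.2]
  rfl

theorem isSmoothField_hamField (hA : IsSkewOperator D A)
    (hI : HasVariationalDerivative D I ξ) (hΓ : LoopFam D U Γ) :
    IsSmoothField U Γ fun q => hamField A ξ (Γ q) := fun e he => by
  refine contDiffOn_euclidean.2 fun i => ?_
  refine (ContDiffOn.sum (s := Finset.univ) fun j _ => (hΓ.opComp_contDiffOn hA he i j).mul
    (cofieldCoord_contDiffOn hI hΓ he j)).congr fun z hz => ?_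
  rw [chartDeriv_hamField hΓ he hz]

/-- The integrand of the bracket. -/
def bracketDensity (A : (p : X) → TangentSpace (𝓡 N) p →
      Module.Dual ℝ (TangentSpace (𝓡 N) p) →ₗ[ℝ] TangentSpace (𝓡 N) p)
    (ξ η : CovectorField N X) (Γ : P → UnitAddCircle → X) (z : P × ℝ) : ℝ :=
  ξ (Γ z.1) z.2 (hamField A η (Γ z.1) z.2)

theorem loopBracket_eq (A : (p : X) → TangentSpace (𝓡 N) p →
      Module.Dual ℝ (TangentSpace (𝓡 N) p) →ₗ[ℝ] TangentSpace (𝓡 N) p)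
    (ξ η : CovectorField N X) {γ : UnitAddCircle → X} (hγ : IsLoop D γ) :
    loopBracket A ξ η γ = ∫ x in (0 : ℝ)..1, ξ γ x (hamField A η γ x) := by
  unfold loopBracket hamField
  simp only [hγ.circleVelocity_coe]

theorem bracketDensity_contDiffOn (hA : IsSkewOperator D A)
    (hI : HasVariationalDerivative D I ξ) (hJ : HasVariationalDerivative D J η)
    (hΓ : LoopFam D U Γ) : ContDiffOn ℝ ∞ (bracketDensity A ξ η Γ) (U ×ˢ univ) :=
  hΓ.contDiffOn_pairing (hI.isSmoothCofield hΓ) (isSmoothField_hamField hA hJ hΓ)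

theorem hasLineDerivAt_loopBracket (hA : IsSkewOperator D A)
    (hI : HasVariationalDerivative D I ξ) (hJ : HasVariationalDerivative D J η)
    (hΓ : LoopFam D U Γ) {q : P} (hq : q ∈ U) (a : P) :
    HasLineDerivAt ℝ (fun q => loopBracket A ξ η (Γ q))
      (∫ x in (0 : ℝ)..1, fderiv ℝ (bracketDensity A ξ η Γ) (q, x) (a, 0)) q a := by
  have h := hasLineDerivAt_integral_strip hΓ.isOpen
    (bracketDensity_contDiffOn hA hI hJ hΓ) hq a
  refine HasDerivAt.congr_of_eventuallyEq h ?_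
  have hc : ContinuousAt (fun t : ℝ => q + t • a) 0 := by fun_prop
  have := hc.eventually (hΓ.isOpen.mem_nhds (by simpa using hq))
  filter_upwards [this] with t ht
  exact loopBracket_eq A ξ η (hΓ.isLoop _ ht)

theorem bracketDensity_chart (hΓ : LoopFam D U Γ) (he : IsCoordinates e) {z : P × ℝ}
    (hz : z ∈ chartDomain U Γ e) : bracketDensity A ξ η Γ z = ∑ i, ∑ j,
      cofieldCoord e ξ Γ i z * opComp A e i j (jetCoord e Γ z) * cofieldCoord e η Γ j z := by
  rw [bracketDensity, covector_apply he hz.2]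
  refine Finset.sum_congr rfl fun i _ => ?_
  rw [chartDeriv_hamField hΓ he hz, Finset.mul_sum]
  exact Finset.sum_congr rfl fun j _ => by rw [mul_assoc]; rfl

/-- An extension of a family of loops in the direction of the field `A^{ij} η_j`. -/
structure HamExt (D : Set (TangentBundle (𝓡 N) X)) (A : (p : X) → TangentSpace (𝓡 N) p →
      Module.Dual ℝ (TangentSpace (𝓡 N) p) →ₗ[ℝ] TangentSpace (𝓡 N) p)
    (η : CovectorField N X) (Γ : P → UnitAddCircle → X) (W : Set (P × ℝ))
    (Γ' : P × ℝ → UnitAddCircle → X) : Prop where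
  fam : LoopFam D W Γ'
  zero : ∀ q, Γ' (q, 0) = Γ q
  tangent : ∀ q, (q, 0) ∈ W → ∀ x : ℝ, ∀ e : OpenPartialHomeomorph X (Euc N), IsCoordinates e →
    Γ q x ∈ e.source → fderiv ℝ (famCoord e Γ') ((q, 0), x) ((0, 1), 0) =
      chartDeriv e (Γ q x) (hamField A η (Γ q) x)

theorem exists_hamExt [T2Space X] (hD : IsOpen D) (hA : IsSkewOperator D A)
    (hJ : HasVariationalDerivative D J η) (hΓ : LoopFam D U Γ) {q : P} (hq : q ∈ U) :
    ∃ W Γ', HamExt D A η Γ W Γ' ∧ (q, 0) ∈ W ∧ ∀ r ∈ W, r.1 ∈ U := by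
  obtain ⟨Γ', W, hqW, hW, h0, hWU, ht⟩ :=
    hΓ.exists_extension hD (isSmoothField_hamField hA hJ hΓ) hq
  exact ⟨W, Γ', ⟨hW, h0, ht⟩, hqW, hWU⟩

open scoped Classical in
/-- The derivative of `ξ` along a loop in the direction of the field `A^{ij} η_j`. -/
def hamDeriv (D : Set (TangentBundle (𝓡 N) X)) (A : (p : X) → TangentSpace (𝓡 N) p →
      Module.Dual ℝ (TangentSpace (𝓡 N) p) →ₗ[ℝ] TangentSpace (𝓡 N) p)
    (e : OpenPartialHomeomorph X (Euc N)) (ξ η : CovectorField N X) (γ : UnitAddCircle → X)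
    (x : ℝ) : Euc N :=
  if h : ∃ Γ' : ℝ × ℝ → UnitAddCircle → X, ∃ W, HamExt D A η (fun _ : ℝ => γ) W Γ' ∧ (0, 0) ∈ W
  then cofieldDeriv e ξ h.choose (0, 1) ((0, 0), x) else 0

theorem loopFam_const {γ : UnitAddCircle → X} (hγ : IsLoop D γ) :
    LoopFam D univ fun _ : P => γ where
  isOpen := isOpen_univ
  smooth := by
    have h : ContMDiff 𝓘(ℝ, P × ℝ) 𝓘(ℝ, ℝ) ∞ (Prod.snd : P × ℝ → ℝ) :=
      ContDiff.contMDiff (by fun_prop)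
    exact (hγ.1.comp h).contMDiffOn
  isLoop _ _ := hγ

/-- The chosen extension in `hamDeriv` and the given one have the same tangent vector along the
loop, so `cofieldDeriv_eq_of_tangent` applies. The value can thus be computed in an extension of a
whole family, which gives its smooth dependence on parameters. -/
theorem hamDeriv_eq [T2Space X] (hD : IsOpen D) (hA : IsSkewOperator D A)
    (hI : HasVariationalDerivative D I ξ) (hJ : HasVariationalDerivative D J η)
    {W : Set (P × ℝ)} {Γ' : P × ℝ → UnitAddCircle → X} (h : HamExt D A η Γ W Γ') {q : P}
    (hq : (q, 0) ∈ W) (he : IsCoordinates e) {x : ℝ} (hx : Γ q x ∈ e.source) :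
    hamDeriv D A e ξ η (Γ q) x = cofieldDeriv e ξ Γ' (0, 1) ((q, 0), x) := by
  have hl : IsLoop D (Γ q) := by
    rw [← h.zero]
    exact h.fam.isLoop _ hq
  have hex : ∃ Γ' : ℝ × ℝ → UnitAddCircle → X, ∃ W, HamExt D A η (fun _ : ℝ => Γ q) W Γ' ∧
      (0, 0) ∈ W := by
    obtain ⟨W', Γ₁, h1, h2, -⟩ := exists_hamExt (q := (0 : ℝ)) hD hA hJ (loopFam_const hl)
      (mem_univ _)
    exact ⟨Γ₁, W', h1, h2⟩
  rw [hamDeriv, dif_pos hex]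
  obtain ⟨W', h1, h2⟩ := hex.choose_spec
  refine cofieldDeriv_eq_of_tangent hD hI h1.fam h.fam h2 hq (by rw [h1.zero, h.zero]) ?_ he
    (by rwa [h1.zero])
  intro y e' he' hy
  rw [h1.zero] at hy
  rw [h1.tangent _ h2 y e' he' hy, h.tangent _ hq y e' he' hy]

/-- `ξ_i η_j ∂A^{ij}/∂(u, u_x)` along a loop, in a given direction. -/
def opDerivSum (A : (p : X) → TangentSpace (𝓡 N) p →
      Module.Dual ℝ (TangentSpace (𝓡 N) p) →ₗ[ℝ] TangentSpace (𝓡 N) p)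
    (e : OpenPartialHomeomorph X (Euc N)) (ξ η : CovectorField N X) (w : Euc N × Euc N)
    (γ : UnitAddCircle → X) (x : UnitAddCircle) : ℝ :=
  ∑ i, ∑ j, ξ γ x (coordFrame e (γ x) i) * η γ x (coordFrame e (γ x) j) *
    fderiv ℝ (opComp A e i j) (e (γ x), chartDeriv e (γ x) (circleVelocity γ x)) w

/-- The components of the variational derivative of a bracket. -/
def bracketCoord (D : Set (TangentBundle (𝓡 N) X)) (A : (p : X) → TangentSpace (𝓡 N) p →
      Module.Dual ℝ (TangentSpace (𝓡 N) p) →ₗ[ℝ] TangentSpace (𝓡 N) p)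
    (e : OpenPartialHomeomorph X (Euc N)) (ξ η : CovectorField N X) (γ : UnitAddCircle → X)
    (k : Fin N) (x : ℝ) : ℝ :=
  hamDeriv D A e ξ η γ x k - hamDeriv D A e η ξ γ x k +
    opDerivSum A e ξ η (EuclideanSpace.single k 1, 0) γ x -
    deriv (fun y : ℝ => opDerivSum A e ξ η (0, EuclideanSpace.single k 1) γ y) x

theorem opDerivSum_eq (hΓ : LoopFam D U Γ) (he : IsCoordinates e) {z : P × ℝ}
    (hz : z ∈ chartDomain U Γ e) (w : Euc N × Euc N) : opDerivSum A e ξ η w (Γ z.1) z.2 =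
      ∑ i, ∑ j, cofieldCoord e ξ Γ i z * cofieldCoord e η Γ j z *
        fderiv ℝ (opComp A e i j) (jetCoord e Γ z) w := by
  rw [hΓ.jetCoord_eq he hz]
  rfl

theorem opDerivSum_contDiffOn (hD : IsOpen D) (hA : IsSkewOperator D A)
    (hI : HasVariationalDerivative D I ξ) (hJ : HasVariationalDerivative D J η)
    (hΓ : LoopFam D U Γ) (he : IsCoordinates e) (w : Euc N × Euc N) :
    ContDiffOn ℝ ∞ (fun z : P × ℝ => opDerivSum A e ξ η w (Γ z.1) z.2) (chartDomain U Γ e) := by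
  refine (ContDiffOn.sum (s := Finset.univ) fun i _ => ContDiffOn.sum (s := Finset.univ) fun j _ =>
    ((cofieldCoord_contDiffOn hI hΓ he i).mul (cofieldCoord_contDiffOn hJ hΓ he j)).mul
    (hΓ.opComp_fderiv_contDiffOn hD hA he i j w)).congr fun z hz => ?_
  rw [opDerivSum_eq hΓ he hz]

theorem deriv_opDerivSum (hD : IsOpen D) (hA : IsSkewOperator D A)
    (hI : HasVariationalDerivative D I ξ) (hJ : HasVariationalDerivative D J η)
    (hΓ : LoopFam D U Γ) (he : IsCoordinates e) (w : Euc N × Euc N) {z : P × ℝ}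
    (hz : z ∈ chartDomain U Γ e) :
    deriv (fun y : ℝ => opDerivSum A e ξ η w (Γ z.1) y) z.2 =
      fderiv ℝ (fun z : P × ℝ => opDerivSum A e ξ η w (Γ z.1) z.2) z (0, 1) := by
  have h1 := (((opDerivSum_contDiffOn hD hA hI hJ hΓ he w).contDiffAt
    ((hΓ.isOpen_chartDomain e).mem_nhds hz)).differentiableAt (by simp)).hasFDerivAt
  exact (HasFDerivAt.comp (g := fun z : P × ℝ => opDerivSum A e ξ η w (Γ z.1) z.2)
    (f := fun y => (z.1, y)) z.2 h1 (hasFDerivAt_prodMk_right z.1 z.2)).hasDerivAt.deriv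

/-- The boundary term in the variation of a bracket, in the direction of a parameter. -/
def boundaryTerm (A : (p : X) → TangentSpace (𝓡 N) p →
      Module.Dual ℝ (TangentSpace (𝓡 N) p) →ₗ[ℝ] TangentSpace (𝓡 N) p)
    (ξ η : CovectorField N X) (Γ : P → UnitAddCircle → X) (a : P) (q : P)
    (x : UnitAddCircle) : ℝ :=
  deriv (fun ε : ℝ => ξ (Γ q) x (A (Γ q x)
    (circleVelocity (Γ q) x + ε • paramVec Γ a q x) (η (Γ q) x))) 0

theorem euc_eq_sum (v : Euc N) : v = ∑ i, v i • (EuclideanSpace.single i (1 : ℝ) : Euc N) := by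
  ext j
  simp [Pi.single_apply]

theorem clm_fst_eq_sum (L : Euc N × Euc N →L[ℝ] ℝ) (v : Euc N) :
    L (v, 0) = ∑ k, L (EuclideanSpace.single k 1, 0) * v k := by
  have : L (v, 0) = (L.comp (ContinuousLinearMap.inl ℝ (Euc N) (Euc N))) v := rfl
  rw [this]
  conv_lhs => rw [euc_eq_sum v, map_sum]
  exact Finset.sum_congr rfl fun k _ => by rw [map_smul, smul_eq_mul, mul_comm]; rfl

theorem clm_snd_eq_sum (L : Euc N × Euc N →L[ℝ] ℝ) (w : Euc N) :
    L (0, w) = ∑ k, L (0, EuclideanSpace.single k 1) * w k := by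
  have : L (0, w) = (L.comp (ContinuousLinearMap.inr ℝ (Euc N) (Euc N))) w := rfl
  rw [this]
  conv_lhs => rw [euc_eq_sum w, map_sum]
  exact Finset.sum_congr rfl fun k _ => by rw [map_smul, smul_eq_mul, mul_comm]; rfl

theorem sum_comm_three {F : Fin N → Fin N → Fin N → ℝ} :
    ∑ k, ∑ i, ∑ j, F k i j = ∑ i, ∑ j, ∑ k, F k i j := by
  rw [Finset.sum_comm]
  exact Finset.sum_congr rfl fun i _ => Finset.sum_comm

/-- The term `ξ_i η_j (∂A^{ij}/∂u_x^k) ∂_a u^k` of the integration by parts. Its coordinate-free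
definition makes it a function on the whole circle, so that its `x`-derivative integrates to zero.
-/
theorem boundaryTerm_chart (hD : IsOpen D) (hA : IsSkewOperator D A)
    (hΓ : LoopFam D U Γ) (he : IsCoordinates e) {z : P × ℝ}
    (hz : z ∈ chartDomain U Γ e) (a : P) :
    boundaryTerm A ξ η Γ a z.1 z.2 = ∑ k,
      opDerivSum A e ξ η (0, EuclideanSpace.single k 1) (Γ z.1) z.2 *
        fderiv ℝ (famCoord e Γ) z (a, 0) k := by
  have h1 : ∀ ε : ℝ, ξ (Γ z.1) z.2 (A (Γ z.1 z.2)
      (circleVelocity (Γ z.1) z.2 + ε • paramVec Γ a z.1 z.2) (η (Γ z.1) z.2)) =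
      ∑ i, ∑ j, cofieldCoord e ξ Γ i z * cofieldCoord e η Γ j z * opComp A e i j
        (jetCoord e Γ z + ε • (0, fderiv ℝ (famCoord e Γ) z (a, 0))) := fun ε => by
    rw [covector_apply he hz.2]
    refine Finset.sum_congr rfl fun i _ => ?_
    rw [chartDeriv_op he hz.2, Finset.mul_sum]
    refine Finset.sum_congr rfl fun j _ => ?_
    rw [map_add, map_smul, hΓ.chartDeriv_paramVec he hz, hΓ.chartDeriv_circleVelocity he hz]
    simp only [cofieldCoord, jetCoord, famCoord, Prod.smul_mk, smul_zero, Prod.mk_add_mk, add_zero]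
    ring
  have h2 : ∀ i j, HasDerivAt (fun ε : ℝ => opComp A e i j
      (jetCoord e Γ z + ε • (0, fderiv ℝ (famCoord e Γ) z (a, 0))))
      (fderiv ℝ (opComp A e i j) (jetCoord e Γ z) (0, fderiv ℝ (famCoord e Γ) z (a, 0))) 0 :=
    fun i j => ((hA.contDiffAt hD he (hΓ.jetCoord_mem he hz) i j).differentiableAt
      (by simp)).hasFDerivAt.hasLineDerivAt _
  unfold boundaryTerm
  simp only [h1]
  rw [(HasDerivAt.fun_sum (u := Finset.univ) fun i _ => HasDerivAt.fun_sum (u := Finset.univ)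
    fun j _ => (h2 i j).const_mul (cofieldCoord e ξ Γ i z * cofieldCoord e η Γ j z)).deriv]
  simp only [opDerivSum_eq hΓ he hz, Finset.sum_mul]
  rw [sum_comm_three]
  refine Finset.sum_congr rfl fun i _ => Finset.sum_congr rfl fun j _ => ?_
  rw [clm_snd_eq_sum, Finset.mul_sum]
  exact Finset.sum_congr rfl fun k _ => by ring

theorem boundaryTerm_contDiffOn (hD : IsOpen D) (hA : IsSkewOperator D A)
    (hI : HasVariationalDerivative D I ξ) (hJ : HasVariationalDerivative D J η)
    (hΓ : LoopFam D U Γ) (a : P) :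
    ContDiffOn ℝ ∞ (fun z : P × ℝ => boundaryTerm A ξ η Γ a z.1 z.2) (U ×ˢ univ) :=
  hΓ.contDiffOn_of_charts fun e he => by
    refine (ContDiffOn.sum (s := Finset.univ) fun k _ =>
      (opDerivSum_contDiffOn hD hA hI hJ hΓ he (0, EuclideanSpace.single k 1)).mul
      (contDiffOn_euclidean.1 (hΓ.contDiffOn_deriv he (a, 0)) k)).congr fun z hz => ?_
    rw [boundaryTerm_chart hD hA hΓ he hz]

theorem fderiv_boundaryTerm (hD : IsOpen D) (hA : IsSkewOperator D A)
    (hI : HasVariationalDerivative D I ξ) (hJ : HasVariationalDerivative D J η)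
    (hΓ : LoopFam D U Γ) (he : IsCoordinates e) {z : P × ℝ} (hz : z ∈ chartDomain U Γ e) (a : P) :
    fderiv ℝ (fun z : P × ℝ => boundaryTerm A ξ η Γ a z.1 z.2) z (0, 1) =
      ∑ k, (deriv (fun y : ℝ => opDerivSum A e ξ η (0, EuclideanSpace.single k 1) (Γ z.1) y) z.2 *
          fderiv ℝ (famCoord e Γ) z (a, 0) k +
        opDerivSum A e ξ η (0, EuclideanSpace.single k 1) (Γ z.1) z.2 *
          fderiv ℝ (fderiv ℝ (famCoord e Γ)) z (a, 0) (0, 1) k) := by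
  have h1 : (fun z : P × ℝ => boundaryTerm A ξ η Γ a z.1 z.2) =ᶠ[𝓝 z] fun z => ∑ k,
      opDerivSum A e ξ η (0, EuclideanSpace.single k 1) (Γ z.1) z.2 *
        fderiv ℝ (famCoord e Γ) z (a, 0) k := by
    filter_upwards [(hΓ.isOpen_chartDomain e).mem_nhds hz] with y hy
    rw [boundaryTerm_chart hD hA hΓ he hy]
  have h2 : HasFDerivAt (fderiv ℝ (famCoord e Γ)) (fderiv ℝ (fderiv ℝ (famCoord e Γ)) z) z :=
    (((hΓ.famCoord_contDiffAt he hz).fderiv_right (m := ∞) (by simp)).differentiableAt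
      (by simp)).hasFDerivAt
  have h3 : ∀ i, HasFDerivAt (fun z => fderiv ℝ (famCoord e Γ) z (a, 0) i) _ z := fun i =>
    (EuclideanSpace.proj (𝕜 := ℝ) i).hasFDerivAt.comp z (h2.clm_apply (hasFDerivAt_const (a, 0) z))
  have h4 : ∀ k : Fin N, HasFDerivAt (fun z : P × ℝ =>
      opDerivSum A e ξ η (0, EuclideanSpace.single k 1) (Γ z.1) z.2) _ z := fun k =>
    (((opDerivSum_contDiffOn hD hA hI hJ hΓ he (0, EuclideanSpace.single k 1)).contDiffAt
    ((hΓ.isOpen_chartDomain e).mem_nhds hz)).differentiableAt (by simp)).hasFDerivAt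
  have h5 := HasFDerivAt.fun_sum (u := Finset.univ) fun i _ => (h4 i).mul (h3 i)
  rw [h1.fderiv_eq]
  refine (congrFun (congrArg DFunLike.coe h5.fderiv) (0, 1)).trans ?_
  simp only [sum_apply, add_apply, smul_apply, smul_eq_mul]
  refine Finset.sum_congr rfl fun i _ => ?_
  rw [deriv_opDerivSum hD hA hI hJ hΓ he _ hz, hΓ.snd_symm he hz (a, 0) (0, 1)]
  simp [add_comm, mul_comm]

/-- The product rule. Skew-symmetry of `A` turns `ξ A ∂_a η` into `-(∂_a η)(Aξ)`, and the last sum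
is the chain rule for `A^{ij}(u, u_x)`. -/
theorem fderiv_bracketDensity (hD : IsOpen D) (hA : IsSkewOperator D A)
    (hI : HasVariationalDerivative D I ξ) (hJ : HasVariationalDerivative D J η)
    (hΓ : LoopFam D U Γ) (he : IsCoordinates e) {z : P × ℝ} (hz : z ∈ chartDomain U Γ e) (a : P) :
    fderiv ℝ (bracketDensity A ξ η Γ) z (a, 0) =
      ∑ i, fderiv ℝ (cofieldCoord e ξ Γ i) z (a, 0) *
          chartDeriv e (Γ z.1 z.2) (hamField A η (Γ z.1) z.2) i -
        ∑ i, fderiv ℝ (cofieldCoord e η Γ i) z (a, 0) *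
          chartDeriv e (Γ z.1 z.2) (hamField A ξ (Γ z.1) z.2) i +
        ∑ k, (opDerivSum A e ξ η (EuclideanSpace.single k 1, 0) (Γ z.1) z.2 *
          fderiv ℝ (famCoord e Γ) z (a, 0) k +
          opDerivSum A e ξ η (0, EuclideanSpace.single k 1) (Γ z.1) z.2 *
          fderiv ℝ (fderiv ℝ (famCoord e Γ)) z (a, 0) (0, 1) k) := by
  have h1 : bracketDensity A ξ η Γ =ᶠ[𝓝 z] fun z => ∑ i, ∑ j,
      cofieldCoord e ξ Γ i z * opComp A e i j (jetCoord e Γ z) * cofieldCoord e η Γ j z := by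
    filter_upwards [(hΓ.isOpen_chartDomain e).mem_nhds hz] with y hy
    rw [bracketDensity_chart hΓ he hy]
  have h2 : ∀ i, HasFDerivAt (cofieldCoord e ξ Γ i) _ z := fun i =>
    ((cofieldCoord_contDiffAt hI hΓ he i hz).differentiableAt (by simp)).hasFDerivAt
  have h3 : ∀ i, HasFDerivAt (cofieldCoord e η Γ i) _ z := fun i =>
    ((cofieldCoord_contDiffAt hJ hΓ he i hz).differentiableAt (by simp)).hasFDerivAt
  have h4 : ∀ i j, HasFDerivAt (fun z => opComp A e i j (jetCoord e Γ z)) _ z := fun i j =>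
    HasFDerivAt.comp z (((hA.contDiffAt hD he (hΓ.jetCoord_mem he hz) i j).differentiableAt
      (by simp)).hasFDerivAt) (hΓ.jetCoord_hasFDerivAt he hz)
  have h5 := HasFDerivAt.fun_sum (u := Finset.univ) fun i _ =>
    HasFDerivAt.fun_sum (u := Finset.univ) fun j _ => ((h2 i).mul (h4 i j)).mul (h3 j)
  rw [h1.fderiv_eq]
  refine (congrFun (congrArg DFunLike.coe h5.fderiv) (a, 0)).trans ?_
  simp only [sum_apply, add_apply, smul_apply, smul_eq_mul, ContinuousLinearMap.comp_apply,
    ContinuousLinearMap.prod_apply, ContinuousLinearMap.flip_apply, Pi.mul_apply]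
  have h6 : ∀ L : Euc N × Euc N →L[ℝ] ℝ, ∀ v w, L (v, w) =
      ∑ k, (L (EuclideanSpace.single k 1, 0) * v k + L (0, EuclideanSpace.single k 1) * w k) := by
    intro L v w
    rw [Finset.sum_add_distrib, ← clm_fst_eq_sum, ← clm_snd_eq_sum, ← map_add]
    simp
  simp only [chartDeriv_hamField hΓ he hz, opDerivSum_eq hΓ he hz, Finset.sum_mul,
    ← Finset.sum_add_distrib]
  rw [sum_comm_three]
  rw [show ∑ i, fderiv ℝ (cofieldCoord e η Γ i) z (a, 0) *
      ∑ j, opComp A e i j (jetCoord e Γ z) * cofieldCoord e ξ Γ j z =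
      -∑ i, ∑ j, cofieldCoord e ξ Γ i z * opComp A e i j (jetCoord e Γ z) *
        fderiv ℝ (cofieldCoord e η Γ j) z (a, 0) from ?_]
  · simp only [Finset.mul_sum, sub_neg_eq_add, ← Finset.sum_add_distrib]
    refine Finset.sum_congr rfl fun i _ => Finset.sum_congr rfl fun j _ => ?_
    rw [h6, mul_comm (cofieldCoord e η Γ j z), add_mul, mul_assoc _ (∑ _, _), Finset.sum_mul,
      Finset.mul_sum]
    rw [show ∑ k, (cofieldCoord e ξ Γ i z * cofieldCoord e η Γ j z *
          fderiv ℝ (opComp A e i j) (jetCoord e Γ z) (EuclideanSpace.single k 1, 0) *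
          fderiv ℝ (famCoord e Γ) z (a, 0) k + cofieldCoord e ξ Γ i z * cofieldCoord e η Γ j z *
          fderiv ℝ (opComp A e i j) (jetCoord e Γ z) (0, EuclideanSpace.single k 1) *
          fderiv ℝ (fderiv ℝ (famCoord e Γ)) z (a, 0) (0, 1) k) = ∑ k, cofieldCoord e ξ Γ i z *
        ((fderiv ℝ (opComp A e i j) (jetCoord e Γ z) (EuclideanSpace.single k 1, 0) *
          fderiv ℝ (famCoord e Γ) z (a, 0) k +
          fderiv ℝ (opComp A e i j) (jetCoord e Γ z) (0, EuclideanSpace.single k 1) *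
          fderiv ℝ (fderiv ℝ (famCoord e Γ)) z (a, 0) (0, 1) k) * cofieldCoord e η Γ j z) from
        Finset.sum_congr rfl fun k _ => by ring]
    ring
  · rw [← Finset.sum_neg_distrib]
    simp only [← Finset.sum_neg_distrib]
    rw [Finset.sum_comm]
    refine Finset.sum_congr rfl fun i _ => ?_
    rw [Finset.mul_sum]
    refine Finset.sum_congr rfl fun j _ => ?_
    rw [hA.opComp_skew (hΓ.jetCoord_mem he hz) i j]
    ring

/-- The variation of the density of a bracket. -/
theorem bracketDensity_variation [T2Space X] (hD : IsOpen D) (hA : IsSkewOperator D A)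
    (hI : HasVariationalDerivative D I ξ) (hJ : HasVariationalDerivative D J η)
    (hΓ : LoopFam D U Γ) {W W' : Set (P × ℝ)} {Γη Γξ : P × ℝ → UnitAddCircle → X}
    (hη : HamExt D A η Γ W Γη) (hξ : HamExt D A ξ Γ W' Γξ) {q : P} (hqU : q ∈ U)
    (hq : (q, 0) ∈ W) (hq' : (q, 0) ∈ W') (he : IsCoordinates e) {x : ℝ} (hx : Γ q x ∈ e.source)
    (a : P) :
    fderiv ℝ (bracketDensity A ξ η Γ) (q, x) (a, 0) + curl ξ Γη (a, 0) (0, 1) ((q, 0), x) -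
        curl η Γξ (a, 0) (0, 1) ((q, 0), x) =
      ∑ k, bracketCoord D A e ξ η (Γ q) k x * fderiv ℝ (famCoord e Γ) (q, x) (a, 0) k +
        fderiv ℝ (fun z : P × ℝ => boundaryTerm A ξ η Γ a z.1 z.2) (q, x) (0, 1) := by
  have hz : (q, x) ∈ chartDomain U Γ e := ⟨hqU, hx⟩
  -- The curl taken between `a` and the direction `Aθ` is the derivative of `ζ` along `Aθ` paired
  -- with `∂_a u`, minus `∂_a ζ` paired with `Aθ`. Adding such curls removes the `a`-derivatives of
  -- `ξ` and `η` from the variation.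
  have hcurl : ∀ {K : (UnitAddCircle → X) → ℝ} {ζ θ : CovectorField N X} {V : Set (P × ℝ)}
      {Δ : P × ℝ → UnitAddCircle → X}, HasVariationalDerivative D K ζ → HamExt D A θ Γ V Δ →
      (q, 0) ∈ V → curl ζ Δ (a, 0) (0, 1) ((q, 0), x) =
      ∑ i, cofieldDeriv e ζ Δ (0, 1) ((q, 0), x) i * fderiv ℝ (famCoord e Γ) (q, x) (a, 0) i -
      ∑ i, fderiv ℝ (cofieldCoord e ζ Γ i) (q, x) (a, 0) *
        chartDeriv e (Γ q x) (hamField A θ (Γ q) x) i := by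
    intro K ζ θ V Δ hK hV hqV
    have hzV : ((q, 0), x) ∈ chartDomain V Δ e := ⟨hqV, by rwa [hV.zero]⟩
    rw [curl_chart hK hV.fam he hzV, ← Finset.sum_sub_distrib]
    refine Finset.sum_congr rfl fun i _ => ?_
    rw [hV.tangent q hqV x e he hx,
      fderiv_fst_line (g := famCoord e Δ) (g' := famCoord e Γ)
      (fun q x => by simp only [famCoord, hV.zero])
      ((hV.fam.famCoord_contDiffAt he hzV).differentiableAt (by simp))
      ((hΓ.famCoord_contDiffAt he hz).differentiableAt (by simp)) a,
      fderiv_fst_line (g := cofieldCoord e ζ Δ i) (g' := cofieldCoord e ζ Γ i)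
      (fun q x => by simp only [cofieldCoord]; rw [hV.zero])
      ((cofieldCoord_contDiffAt hK hV.fam he i hzV).differentiableAt (by simp))
      ((cofieldCoord_contDiffAt hK hΓ he i hz).differentiableAt (by simp)) a]
    rfl
  rw [hcurl hI hη hq, hcurl hJ hξ hq', fderiv_bracketDensity hD hA hI hJ hΓ he hz,
    fderiv_boundaryTerm hD hA hI hJ hΓ he hz]
  simp only [bracketCoord, hamDeriv_eq hD hA hI hJ hη hq he hx,
    hamDeriv_eq hD hA hJ hI hξ hq' he hx, sub_mul, add_mul, Finset.sum_sub_distrib,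
    Finset.sum_add_distrib]
  ring

end Operators

/-! ### The bracket of two functionals is a functional -/

section Closure

variable {N : ℕ} {X : Type*} [TopologicalSpace X] [ChartedSpace (Euc N) X]

/-- The variational derivative of a bracket. -/
def dBracket (D : Set (TangentBundle (𝓡 N) X)) (A : (p : X) → TangentSpace (𝓡 N) p →
      Module.Dual ℝ (TangentSpace (𝓡 N) p) →ₗ[ℝ] TangentSpace (𝓡 N) p)
    (ξ η : CovectorField N X) : CovectorField N X := fun γ x =>
  ∑ k, bracketCoord D A (chartAt (Euc N) (γ x)) ξ η γ k (circleRep x) •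
    coordCovector (chartAt (Euc N) (γ x)) (γ x) k

variable {P : Type*} [NormedAddCommGroup P] [NormedSpace ℝ P] [FiniteDimensional ℝ P]
  [IsManifold (𝓡 N) ∞ X] {e e' : OpenPartialHomeomorph X (Euc N)}
  {D : Set (TangentBundle (𝓡 N) X)} {U : Set P} {Γ : P → UnitAddCircle → X}
  {I J : (UnitAddCircle → X) → ℝ} {ξ η : CovectorField N X}
  {A : (p : X) → TangentSpace (𝓡 N) p →
      Module.Dual ℝ (TangentSpace (𝓡 N) p) →ₗ[ℝ] TangentSpace (𝓡 N) p}

theorem deriv_circleRep (G : UnitAddCircle → ℝ) (x : ℝ) :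
    deriv (fun y : ℝ => G y) (circleRep (x : UnitAddCircle)) = deriv (fun y : ℝ => G y) x := by
  obtain ⟨n, hn⟩ := circleRep_coe x
  rw [hn, ← deriv_comp_add_const]
  simp

theorem bracketCoord_circleRep (γ : UnitAddCircle → X) (k : Fin N) (x : ℝ) :
    bracketCoord D A e ξ η γ k (circleRep (x : UnitAddCircle)) =
      bracketCoord D A e ξ η γ k x := by
  unfold bracketCoord hamDeriv
  simp only [deriv_circleRep (fun y => opDerivSum A e ξ η (0, EuclideanSpace.single k 1) γ y),
    coe_circleRep]
  split_ifs <;> simp only [cofieldDeriv_circleRep]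

/-- No transformation law is computed. In `bracketDensity_variation` every term except the sum with
`bracketCoord` is independent of the chart. A step displacement gives a family whose parameter
derivative at `x` is the prescribed vector `w`. -/
theorem bracketCoord_covariant [T2Space X] (hD : IsOpen D) (hA : IsSkewOperator D A)
    (hI : HasVariationalDerivative D I ξ) (hJ : HasVariationalDerivative D J η)
    {γ : UnitAddCircle → X} (hγ : IsLoop D γ) (he : IsCoordinates e) (he' : IsCoordinates e')
    {x : ℝ} (hx : γ x ∈ e.source) (hx' : γ x ∈ e'.source) (w : TangentSpace (𝓡 N) (γ x)) :
    ∑ k, bracketCoord D A e ξ η γ k x * chartDeriv e (γ x) w k =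
      ∑ k, bracketCoord D A e' ξ η γ k x * chartDeriv e' (γ x) w k := by
  obtain ⟨χ, δ, hs, hχ⟩ := exists_isStep he hx
  set Y : UnitAddCircle → Euc N := fun _ => chartDeriv e (γ x) w with hY
  have hc : LoopFam D univ fun _ : ℝ => γ := loopFam_const hγ
  obtain ⟨V, hqV, hV, -⟩ := hc.exists_stepFam hD hs (Y := Y) contDiff_const (mem_univ 0)
  have hΔ : stepFam e χ δ (fun _ : ℝ => γ) Y (0, 0) = γ := stepFam_zero Y 0
  have ht : ∀ {e'' : OpenPartialHomeomorph X (Euc N)}, IsCoordinates e'' → γ x ∈ e''.source →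
      fderiv ℝ (famCoord e'' (stepFam e χ δ (fun _ : ℝ => γ) Y)) ((0, 0), x) ((0, 1), 0) =
        chartDeriv e'' (γ x) w := fun he'' hx'' => by
    rw [fderiv_stepFam_snd hs hV hqV he'' hx'', hχ.self_of_nhds, Pi.one_apply, one_smul, hY]
    simp only
    rw [coordVector_chartDeriv he hx]
  obtain ⟨W, Γη, hη, hqη, -⟩ := exists_hamExt hD hA hJ hV hqV
  obtain ⟨W', Γξ, hξ, hqξ, -⟩ := exists_hamExt hD hA hI hV hqV
  have h1 := bracketDensity_variation hD hA hI hJ hV hη hξ hqV hqη hqξ he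
    (x := x) (by rwa [hΔ]) (0, 1)
  have h2 := bracketDensity_variation hD hA hI hJ hV hη hξ hqV hqη hqξ he'
    (x := x) (by rwa [hΔ]) (0, 1)
  rw [hΔ, ht he hx] at h1
  rw [hΔ, ht he' hx'] at h2
  linarith

theorem dBracket_coordFrame [T2Space X] (hD : IsOpen D) (hA : IsSkewOperator D A)
    (hI : HasVariationalDerivative D I ξ) (hJ : HasVariationalDerivative D J η)
    {γ : UnitAddCircle → X} (hγ : IsLoop D γ) (he : IsCoordinates e)
    {x : ℝ} (hx : γ x ∈ e.source) (k : Fin N) :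
    dBracket D A ξ η γ x (coordFrame e (γ x) k) = bracketCoord D A e ξ η γ k x := by
  have h := bracketCoord_covariant hD hA hI hJ hγ (isCoordinates_chartAt (N := N) (γ x)) he
    (mem_chart_source (Euc N) (γ x)) hx (coordFrame e (γ x) k)
  simp only [chartDeriv_coordFrame he hx, mul_ite, mul_one, mul_zero, Finset.sum_ite_eq',
    Finset.mem_univ, if_true] at h
  rw [← h]
  simp [dBracket, bracketCoord_circleRep, coordCovector_apply]

theorem dBracket_apply [T2Space X] (hD : IsOpen D) (hA : IsSkewOperator D A)
    (hI : HasVariationalDerivative D I ξ) (hJ : HasVariationalDerivative D J η)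
    {γ : UnitAddCircle → X} (hγ : IsLoop D γ) (he : IsCoordinates e)
    {x : ℝ} (hx : γ x ∈ e.source) (w : TangentSpace (𝓡 N) (γ x)) :
    dBracket D A ξ η γ x w = ∑ k, bracketCoord D A e ξ η γ k x * chartDeriv e (γ x) w k := by
  rw [covector_apply he hx]
  simp only [dBracket_coordFrame hD hA hI hJ hγ he hx]

/-- `hamDeriv` is defined by a choice for each loop separately. Near a given parameter it agrees
with the derivative computed in one extended family at extension parameter `0`, and that expression
is smooth. -/
theorem isSmoothCofield_dBracket [T2Space X] (hD : IsOpen D) (hA : IsSkewOperator D A)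
    (hI : HasVariationalDerivative D I ξ) (hJ : HasVariationalDerivative D J η)
    (hΓ : LoopFam D U Γ) : IsSmoothCofield U Γ fun q => dBracket D A ξ η (Γ q) := by
  intro e he k z hz
  refine ContDiffAt.contDiffWithinAt ?_
  obtain ⟨W, Γη, hη, hqη, -⟩ := exists_hamExt hD hA hJ hΓ hz.1
  obtain ⟨W', Γξ, hξ, hqξ, -⟩ := exists_hamExt hD hA hI hΓ hz.1
  have hnhds := (hΓ.isOpen_chartDomain e).mem_nhds hz
  have hmap : ContDiff ℝ ∞ fun z : P × ℝ => ((z.1, (0 : ℝ)), z.2) := by fun_prop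
  have h1 : (fun z : P × ℝ => dBracket D A ξ η (Γ z.1) z.2 (coordFrame e (Γ z.1 z.2) k)) =ᶠ[𝓝 z]
      fun z => cofieldDeriv e ξ Γη (0, 1) ((z.1, 0), z.2) k -
        cofieldDeriv e η Γξ (0, 1) ((z.1, 0), z.2) k +
        opDerivSum A e ξ η (EuclideanSpace.single k 1, 0) (Γ z.1) z.2 -
        fderiv ℝ (fun z : P × ℝ =>
          opDerivSum A e ξ η (0, EuclideanSpace.single k 1) (Γ z.1) z.2) z (0, 1) := by
    have hc : ContinuousAt (fun z : P × ℝ => (z.1, (0 : ℝ))) z := by fun_prop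
    filter_upwards [hnhds, hc.eventually (hη.fam.isOpen.mem_nhds hqη),
      hc.eventually (hξ.fam.isOpen.mem_nhds hqξ)] with y hy hyη hyξ
    rw [dBracket_coordFrame hD hA hI hJ (hΓ.isLoop _ hy.1) he hy.2, bracketCoord,
      hamDeriv_eq hD hA hI hJ hη hyη he hy.2, hamDeriv_eq hD hA hJ hI hξ hyξ he hy.2,
      deriv_opDerivSum hD hA hI hJ hΓ he _ hy]
  refine ContDiffAt.congr_of_eventuallyEq ?_ h1
  have h2 : ∀ {K : (UnitAddCircle → X) → ℝ} {ζ θ : CovectorField N X} {V : Set (P × ℝ)}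
      {Δ : P × ℝ → UnitAddCircle → X}, HasVariationalDerivative D K ζ → HamExt D A θ Γ V Δ →
      (z.1, 0) ∈ V →
      ContDiffAt ℝ ∞ (fun z : P × ℝ => cofieldDeriv e ζ Δ (0, 1) ((z.1, 0), z.2) k) z := by
    intro K ζ θ V Δ hK hV hqV
    have hzV : ((z.1, 0), z.2) ∈ chartDomain V Δ e := ⟨hqV, by
      simp only; rw [hV.zero]; exact hz.2⟩
    have h3 := (contDiffOn_euclidean.1 (cofieldDeriv_contDiffOn hK hV.fam he (0, 1)) k).contDiffAt
      ((hV.fam.isOpen_chartDomain e).mem_nhds hzV)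
    exact ContDiffAt.comp z h3 hmap.contDiffAt
  refine (((h2 hI hη hqη).sub (h2 hJ hξ hqξ)).add
    ((opDerivSum_contDiffOn hD hA hI hJ hΓ he _).contDiffAt hnhds)).sub ?_
  exact (((opDerivSum_contDiffOn hD hA hI hJ hΓ he _).fderiv_of_isOpen
    (hΓ.isOpen_chartDomain e) (by simp)).contDiffAt hnhds).clm_apply contDiffAt_const

theorem integral_fderiv_snd_eq_zero {G : P → UnitAddCircle → ℝ} (hU : IsOpen U)
    (hG : ContDiffOn ℝ ∞ (fun z : P × ℝ => G z.1 z.2) (U ×ˢ univ)) {q : P} (hq : q ∈ U) :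
    ∫ x in (0 : ℝ)..1, fderiv ℝ (fun z : P × ℝ => G z.1 z.2) (q, x) (0, 1) = 0 := by
  have h1 : ∀ x : ℝ, HasDerivAt (fun y : ℝ => G q y)
      (fderiv ℝ (fun z : P × ℝ => G z.1 z.2) (q, x) (0, 1)) x := fun x => by
    have h2 := ((contDiffAt_strip hU hG (z := (q, x)) hq).differentiableAt (by simp)).hasFDerivAt
    exact (HasFDerivAt.comp (g := fun z : P × ℝ => G z.1 z.2)
      (f := fun y => (q, y)) x h2 (hasFDerivAt_prodMk_right q x)).hasDerivAt
  rw [intervalIntegral.integral_eq_sub_of_hasDerivAt (fun x _ => h1 x)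
    ((continuous_fderiv_strip hU hG hq _).intervalIntegrable _ _)]
  have h3 : ((1 : ℝ) : UnitAddCircle) = ((0 : ℝ) : UnitAddCircle) := by
    simp
  rw [h3, sub_self]

theorem integral_add_sub_sub {f g h k : ℝ → ℝ} (hf : Continuous f) (hg : Continuous g)
    (hh : Continuous h) (hk : Continuous k) :
    ∫ x in (0 : ℝ)..1, (f x + g x - h x - k x) = (∫ x in (0 : ℝ)..1, f x) +
      (∫ x in (0 : ℝ)..1, g x) - (∫ x in (0 : ℝ)..1, h x) - ∫ x in (0 : ℝ)..1, k x := by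
  have hfg : Continuous fun x => f x + g x := hf.add hg
  have hfgh : Continuous fun x => f x + g x - h x := hfg.sub hh
  rw [intervalIntegral.integral_sub (hfgh.intervalIntegrable _ _) (hk.intervalIntegrable _ _),
    intervalIntegral.integral_sub (hfg.intervalIntegrable _ _) (hh.intervalIntegrable _ _),
    intervalIntegral.integral_add (hf.intervalIntegrable _ _) (hg.intervalIntegrable _ _)]

/-- The integrated form of `bracketDensity_variation`: both curls integrate to zero by closedness,
and the derivative of the boundary term by periodicity. -/
theorem hasLineDerivAt_dBracket [T2Space X] (hD : IsOpen D) (hA : IsSkewOperator D A)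
    (hI : HasVariationalDerivative D I ξ) (hJ : HasVariationalDerivative D J η)
    (hΓ : LoopFam D U Γ) {q : P} (hq : q ∈ U) (a : P) :
    HasLineDerivAt ℝ (fun q => loopBracket A ξ η (Γ q))
      (∫ x in (0 : ℝ)..1, dBracket D A ξ η (Γ q) x (paramVec Γ a q x)) q a := by
  refine (hasLineDerivAt_loopBracket hA hI hJ hΓ hq a).congr_deriv ?_
  obtain ⟨W, Γη, hη, hqη, -⟩ := exists_hamExt hD hA hJ hΓ hq
  obtain ⟨W', Γξ, hξ, hqξ, -⟩ := exists_hamExt hD hA hI hΓ hq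
  have h1 : ∀ x : ℝ, dBracket D A ξ η (Γ q) x (paramVec Γ a q x) =
      fderiv ℝ (bracketDensity A ξ η Γ) (q, x) (a, 0) + curl ξ Γη (a, 0) (0, 1) ((q, 0), x) -
        curl η Γξ (a, 0) (0, 1) ((q, 0), x) -
        fderiv ℝ (fun z : P × ℝ => boundaryTerm A ξ η Γ a z.1 z.2) (q, x) (0, 1) := fun x => by
    have he := isCoordinates_chartAt (N := N) (Γ q x)
    have hx := mem_chart_source (Euc N) (Γ q x)
    rw [bracketDensity_variation hD hA hI hJ hΓ hη hξ hq hqη hqξ he hx,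
      dBracket_apply hD hA hI hJ (hΓ.isLoop q hq) he hx,
      hΓ.chartDeriv_paramVec he (z := (q, x)) ⟨hq, hx⟩]
    simp
  have c1 := continuous_fderiv_strip hΓ.isOpen
    (bracketDensity_contDiffOn hA hI hJ hΓ) hq (a, 0)
  have c2 := continuous_curl hI hη.fam hqη (a, 0) (0, 1)
  have c3 := continuous_curl hJ hξ.fam hqξ (a, 0) (0, 1)
  have c4 := continuous_fderiv_strip hΓ.isOpen
    (boundaryTerm_contDiffOn hD hA hI hJ hΓ a) hq (0, 1)
  simp only [h1]
  rw [integral_add_sub_sub c1 c2 c3 c4, integral_curl_eq_zero hI hη.fam hqη,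
    integral_curl_eq_zero hJ hξ.fam hqξ,
    integral_fderiv_snd_eq_zero hΓ.isOpen (boundaryTerm_contDiffOn hD hA hI hJ hΓ a) hq]
  simp

/-- The bracket of two functionals is a functional. -/
theorem hasVariationalDerivative_dBracket [T2Space X] (hD : IsOpen D) (hA : IsSkewOperator D A)
    (hI : HasVariationalDerivative D I ξ) (hJ : HasVariationalDerivative D J η) :
    HasVariationalDerivative D (loopBracket A ξ η) (dBracket D A ξ η) where
  smooth _ _ _ hΓ e he i := isSmoothCofield_dBracket hD hA hI hJ hΓ.loopFam e he i
  variation _ _ _ hΓ _ hq a := hasLineDerivAt_dBracket hD hA hI hJ hΓ.loopFam hq a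

theorem loopBracket_skew (hA : IsSkewOperator D A) (ξ η : CovectorField N X)
    {γ : UnitAddCircle → X} (hγ : IsLoop D γ) :
    loopBracket A ξ η γ = -loopBracket A η ξ γ := by
  unfold loopBracket
  rw [← intervalIntegral.integral_neg]
  exact intervalIntegral.integral_congr fun x _ => hA.skew _ _ (hγ.2 x) _ _

end Closure

/-! ### Algebra of the two relations -/

section Relations

variable {N : ℕ}

/-- The tensor `ω^{kc} ω^{ia} ∂M^b_i/∂u_x^k`. -/
def boundaryTensor (om : Euc N → Fin N → Fin N → ℝ) (M : Euc N → Euc N → Fin N → Fin N → ℝ)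
    (z : Euc N × Euc N) (b a c : Fin N) : ℝ :=
  ∑ k, ∑ i, om z.1 k c * (pderiv k (fun y => M z.1 y b i) z.2 * om z.1 i a)

/-- The total derivative of `boundaryTensor`. -/
def boundaryTensorDeriv (om : Euc N → Fin N → Fin N → ℝ)
    (M : Euc N → Euc N → Fin N → Fin N → ℝ) (u v w : Euc N) (b a c : Fin N) : ℝ :=
  ∑ k, ∑ i, (totalDeriv (fun y _ => om y k c) u v w *
      (pderiv k (fun y => M u y b i) v * om u i a) +
    om u k c * totalDeriv (fun y z => pderiv k (fun z' => M y z' b i) z * om y i a) u v w)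

/-- The left hand side of the second relation. -/
def secondRelation (om : Euc N → Fin N → Fin N → ℝ)
    (M : Euc N → Euc N → Fin N → Fin N → ℝ) (u v w : Euc N) (j p s : Fin N) : ℝ :=
  ∑ i, ∑ r,
    (om u i j * om u r p * pderiv i (fun y => M y v s r) u
      - om u i j * totalDeriv (fun y z => pderiv i (fun z' => M y z' s r) z * om y r p) u v w
      + pderiv r (fun y => om y i j) u * om u r p * M u v s i
      + om u i s * om u r j * pderiv i (fun y => M y v p r) u
      + totalDeriv (fun y _ => om y i s) u v w * pderiv i (fun z => M u z p r) v * om u r j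
      + pderiv r (fun y => om y i s) u * om u r j * M u v p i
      + om u i p * om u r s * pderiv i (fun y => M y v j r) u
      + totalDeriv (fun y _ => om y i p) u v w * pderiv i (fun z => M u z j r) v * om u r s
      + pderiv r (fun y => om y i p) u * om u r s * M u v j i)

/-- The coefficient of `α_a β_b κ_c` in a term of the Jacobi identity. -/
def jacobiCoeff (om : Euc N → Fin N → Fin N → ℝ)
    (M : Euc N → Euc N → Fin N → Fin N → ℝ) (u v w : Euc N) (a b c : Fin N) : ℝ :=
  ∑ i, ∑ r, (om u r c * pderiv r (fun y => om y i b) u * M u v a i +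
    om u i a * om u r c * pderiv r (fun y => M y v b i) u +
    om u i a * totalDeriv (fun y _ => om y r c) u v w * pderiv r (fun z => M u z b i) v)

/-- The form `α_s β_b (M^s_i dω^{ib} + ω^{is} dM^b_i)` in the direction `(du, du_x)`. -/
def momentumForm (om : Euc N → Fin N → Fin N → ℝ) (M : Euc N → Euc N → Fin N → Fin N → ℝ)
    (u v : Euc N) (α β : Fin N → ℝ) (du dv : Fin N → ℝ) : ℝ :=
  ∑ s, ∑ b, α s * β b * ∑ i, (M u v s i * ∑ r, du r * pderiv r (fun y => om y i b) u +
    om u i s * ∑ r, (du r * pderiv r (fun y => M y v b i) u +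
      dv r * pderiv r (fun z => M u z b i) v))

variable {om : Euc N → Fin N → Fin N → ℝ} {M : Euc N → Euc N → Fin N → Fin N → ℝ}

theorem relation2_iff {u v w : Euc N} :
    Relation2 om M u v w ↔ ∀ j p s, secondRelation om M u v w j p s = 0 := Iff.rfl

/-- In this form (r1) is the invariance of `boundaryTensor` under cyclic permutations of its three
indices. -/
theorem relation1_iff {u v : Euc N} :
    Relation1 om M u v ↔
      ∀ j p s, boundaryTensor om M (u, v) s p j = boundaryTensor om M (u, v) p j s := by
  have h : ∀ b a c, boundaryTensor om M (u, v) b a c =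
      ∑ i, ∑ r, om u i c * om u r a * pderiv i (fun y => M u y b r) v := fun b a c => by
    unfold boundaryTensor
    exact Finset.sum_congr rfl fun i _ => Finset.sum_congr rfl fun r _ => by ring
  simp only [Relation1, h]

/-- The nine terms of (r2) are a cyclic sum of coefficients of the Jacobi density, corrected by the
total derivative that an integration by parts produces. -/
theorem secondRelation_eq (u v w : Euc N) (a b c : Fin N) :
    secondRelation om M u v w c a b = jacobiCoeff om M u v w a b c +
      jacobiCoeff om M u v w b c a + jacobiCoeff om M u v w c a b -
      boundaryTensorDeriv om M u v w b a c := by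
  have h : ∀ a b c, jacobiCoeff om M u v w a b c =
      ∑ i, ∑ r, pderiv r (fun y => om y i b) u * om u r c * M u v a i +
      ∑ i, ∑ r, (om u i c * om u r a * pderiv i (fun y => M y v b r) u +
        totalDeriv (fun y _ => om y i c) u v w * pderiv i (fun z => M u z b r) v * om u r a) := by
    intro a b c
    rw [Finset.sum_comm (f := fun i r => om u i c * om u r a * pderiv i (fun y => M y v b r) u +
        totalDeriv (fun y _ => om y i c) u v w * pderiv i (fun z => M u z b r) v * om u r a)]
    simp only [jacobiCoeff, ← Finset.sum_add_distrib]
    exact Finset.sum_congr rfl fun i _ => Finset.sum_congr rfl fun r _ => by ring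
  simp only [h, secondRelation, boundaryTensorDeriv, ← Finset.sum_add_distrib,
    ← Finset.sum_sub_distrib]
  exact Finset.sum_congr rfl fun i _ => Finset.sum_congr rfl fun r _ => by ring

/-- The direction is the field `ωκ` together with its `x`-derivative. The derivative of `κ` enters
only through the dependence of `M` on `u_x`, hence with coefficient `boundaryTensor`. -/
theorem momentumForm_expand (u v w : Euc N) (α β κ κ' : Fin N → ℝ) :
    momentumForm om M u v α β (fun k => ∑ c, om u k c * κ c)
      (fun k => ∑ c, (totalDeriv (fun y _ => om y k c) u v w * κ c + om u k c * κ' c)) =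
      ∑ a, ∑ b, ∑ c, (α a * β b * κ c * jacobiCoeff om M u v w a b c +
        α a * β b * κ' c * boundaryTensor om M (u, v) b a c) := by
  unfold momentumForm
  refine Finset.sum_congr rfl fun a _ => Finset.sum_congr rfl fun b _ => ?_
  have h1 : ∀ c, boundaryTensor om M (u, v) b a c =
      ∑ i, ∑ r, om u r c * (pderiv r (fun y => M u y b i) v * om u i a) := fun c => by
    unfold boundaryTensor
    exact Finset.sum_comm
  simp only [h1, jacobiCoeff, Finset.mul_sum, ← Finset.sum_add_distrib]
  rw [sum_comm_three]
  refine Finset.sum_congr rfl fun i _ => Finset.sum_congr rfl fun r _ => ?_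
  simp only [Finset.sum_mul, Finset.mul_sum, ← Finset.sum_add_distrib]
  exact Finset.sum_congr rfl fun c _ => by ring

theorem momentumForm_cyclic (u v w : Euc N) (α β κ α' β' κ' : Fin N → ℝ) :
    momentumForm om M u v α β (fun k => ∑ c, om u k c * κ c)
        (fun k => ∑ c, (totalDeriv (fun y _ => om y k c) u v w * κ c + om u k c * κ' c)) +
      momentumForm om M u v β κ (fun k => ∑ c, om u k c * α c)
        (fun k => ∑ c, (totalDeriv (fun y _ => om y k c) u v w * α c + om u k c * α' c)) +
      momentumForm om M u v κ α (fun k => ∑ c, om u k c * β c)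
        (fun k => ∑ c, (totalDeriv (fun y _ => om y k c) u v w * β c + om u k c * β' c)) =
    ∑ a, ∑ b, ∑ c, (α a * β b * κ' c * boundaryTensor om M (u, v) b a c +
      α' a * β b * κ c * boundaryTensor om M (u, v) c b a +
      α a * β' b * κ c * boundaryTensor om M (u, v) a c b +
      α a * β b * κ c * (secondRelation om M u v w c a b +
        boundaryTensorDeriv om M u v w b a c)) := by
  simp only [momentumForm_expand, secondRelation_eq]
  -- Cyclic renaming of summation indices, used once on the second form and twice on the third, so
  -- that all three carry the monomial `α_a β_b κ_c`.
  have cyc : ∀ F : Fin N → Fin N → Fin N → ℝ,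
      ∑ a, ∑ b, ∑ c, F a b c = ∑ a, ∑ b, ∑ c, F b c a := fun F =>
    (sum_comm_three (F := fun k i j => F i j k)).symm
  rw [cyc (fun a b c => β a * κ b * α c * jacobiCoeff om M u v w a b c + _),
    cyc (fun a b c => κ a * α b * β c * jacobiCoeff om M u v w a b c + _)]
  rw [cyc (fun a b c => κ b * α c * β a * jacobiCoeff om M u v w b c a + _)]
  simp only [← Finset.sum_add_distrib]
  exact Finset.sum_congr rfl fun a _ => Finset.sum_congr rfl fun b _ =>
    Finset.sum_congr rfl fun c _ => by ring

theorem pderiv_fst_eq {F : Euc N → Euc N → ℝ} {u v : Euc N}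
    (hF : DifferentiableAt ℝ (fun z : Euc N × Euc N => F z.1 z.2) (u, v)) (k : Fin N) :
    pderiv k (fun y => F y v) u =
      fderiv ℝ (fun z : Euc N × Euc N => F z.1 z.2) (u, v) (EuclideanSpace.single k 1, 0) := by
  have h := HasFDerivAt.comp (g := fun z : Euc N × Euc N => F z.1 z.2) (f := fun y => (y, v)) u
    hF.hasFDerivAt (hasFDerivAt_prodMk_left u v)
  exact congrFun (congrArg DFunLike.coe h.fderiv) _

theorem pderiv_snd_eq {F : Euc N → Euc N → ℝ} {u v : Euc N}
    (hF : DifferentiableAt ℝ (fun z : Euc N × Euc N => F z.1 z.2) (u, v)) (k : Fin N) :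
    pderiv k (fun y => F u y) v =
      fderiv ℝ (fun z : Euc N × Euc N => F z.1 z.2) (u, v) (0, EuclideanSpace.single k 1) := by
  have h := HasFDerivAt.comp (g := fun z : Euc N × Euc N => F z.1 z.2) (f := fun y => (u, y)) v
    hF.hasFDerivAt (hasFDerivAt_prodMk_right u v)
  exact congrFun (congrArg DFunLike.coe h.fderiv) _

theorem fderiv_eq_sum_pderiv {F : Euc N → Euc N → ℝ} {u v : Euc N}
    (hF : DifferentiableAt ℝ (fun z : Euc N × Euc N => F z.1 z.2) (u, v)) (du dv : Euc N) :
    fderiv ℝ (fun z : Euc N × Euc N => F z.1 z.2) (u, v) (du, dv) =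
      ∑ k, (du k * pderiv k (fun y => F y v) u + dv k * pderiv k (fun y => F u y) v) := by
  simp only [pderiv_fst_eq hF, pderiv_snd_eq hF, Finset.sum_add_distrib]
  rw [show (du, dv) = (du, 0) + (0, dv) by simp, map_add, clm_fst_eq_sum, clm_snd_eq_sum]
  congr 1 <;> exact Finset.sum_congr rfl fun k _ => mul_comm _ _

theorem hasDerivAt_totalDeriv {F : Euc N → Euc N → ℝ} {u v : ℝ → Euc N} {w : Euc N} {x : ℝ}
    (hF : DifferentiableAt ℝ (fun z : Euc N × Euc N => F z.1 z.2) (u x, v x))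
    (hu : HasDerivAt u (v x) x) (hv : HasDerivAt v w x) :
    HasDerivAt (fun y => F (u y) (v y)) (totalDeriv F (u x) (v x) w) x := by
  have h := HasFDerivAt.comp_hasDerivAt (l := fun z : Euc N × Euc N => F z.1 z.2)
    (f := fun y => (u y, v y)) x hF.hasFDerivAt (hu.prodMk hv)
  exact h.congr_deriv (fderiv_eq_sum_pderiv hF _ _)

theorem hasDerivAt_boundaryTensor {S : Set (Euc N × Euc N)} (hS : IsOpen S)
    (hO : ∀ i j, ContDiffOn ℝ ∞ (fun z : Euc N × Euc N => om z.1 i j) S)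
    (hM : ∀ i j, ContDiffOn ℝ ∞ (fun z : Euc N × Euc N => M z.1 z.2 i j) S)
    {u v : ℝ → Euc N} {w : Euc N} {x : ℝ} (hx : (u x, v x) ∈ S)
    (hu : HasDerivAt u (v x) x) (hv : HasDerivAt v w x) (b a c : Fin N) :
    HasDerivAt (fun y => boundaryTensor om M (u y, v y) b a c)
      (boundaryTensorDeriv om M (u x) (v x) w b a c) x := by
  have hO' : ∀ i j, DifferentiableAt ℝ (fun z : Euc N × Euc N => om z.1 i j) (u x, v x) :=
    fun i j => ((hO i j).contDiffAt (hS.mem_nhds hx)).differentiableAt (by simp)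
  have hP : ∀ k i, DifferentiableAt ℝ
      (fun z : Euc N × Euc N => pderiv k (fun z' => M z.1 z' b i) z.2) (u x, v x) := by
    intro k i
    have h1 : (fun z : Euc N × Euc N => pderiv k (fun z' => M z.1 z' b i) z.2) =ᶠ[𝓝 (u x, v x)]
        fun z => fderiv ℝ (fun z : Euc N × Euc N => M z.1 z.2 b i) z
          (0, EuclideanSpace.single k 1) := by
      filter_upwards [hS.mem_nhds hx] with z hz
      exact pderiv_snd_eq (F := fun y z' => M y z' b i) (u := z.1) (v := z.2) (((hM b i).contDiffAt (hS.mem_nhds hz)).differentiableAt (by simp)) k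
    refine DifferentiableAt.congr_of_eventuallyEq ?_ h1
    exact (((((hM b i).fderiv_of_isOpen (m := ∞) hS (by simp)).contDiffAt
      (hS.mem_nhds hx)).clm_apply contDiffAt_const).differentiableAt (by simp))
  unfold boundaryTensor boundaryTensorDeriv
  refine HasDerivAt.fun_sum fun k _ => HasDerivAt.fun_sum fun i _ => ?_
  exact (hasDerivAt_totalDeriv (F := fun y _ => om y k c) (hO' k c) hu hv).mul
    (hasDerivAt_totalDeriv (F := fun y z => pderiv k (fun z' => M y z' b i) z * om y i a)
      ((hP k i).mul (hO' i a)) hu hv)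

/-- Under the relations, the density of the Jacobi identity is a total derivative. -/
theorem hasDerivAt_boundary_sum {S : Set (Euc N × Euc N)} (hS : IsOpen S)
    (hO : ∀ i j, ContDiffOn ℝ ∞ (fun z : Euc N × Euc N => om z.1 i j) S)
    (hM : ∀ i j, ContDiffOn ℝ ∞ (fun z : Euc N × Euc N => M z.1 z.2 i j) S)
    {u v : ℝ → Euc N} {w : Euc N} {x : ℝ} (hx : (u x, v x) ∈ S)
    (hu : HasDerivAt u (v x) x) (hv : HasDerivAt v w x)
    {α β κ : ℝ → Fin N → ℝ} {α' β' κ' : Fin N → ℝ}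
    (hα : ∀ a, HasDerivAt (fun y => α y a) (α' a) x)
    (hβ : ∀ a, HasDerivAt (fun y => β y a) (β' a) x)
    (hκ : ∀ a, HasDerivAt (fun y => κ y a) (κ' a) x)
    (h1 : Relation1 om M (u x) (v x)) (h2 : Relation2 om M (u x) (v x) w) :
    HasDerivAt (fun y => ∑ a, ∑ b, ∑ c, α y a * β y b * κ y c *
        boundaryTensor om M (u y, v y) b a c)
      (momentumForm om M (u x) (v x) (α x) (β x) (fun k => ∑ c, om (u x) k c * κ x c)
        (fun k => ∑ c, (totalDeriv (fun y _ => om y k c) (u x) (v x) w * κ x c +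
          om (u x) k c * κ' c)) +
      momentumForm om M (u x) (v x) (β x) (κ x) (fun k => ∑ c, om (u x) k c * α x c)
        (fun k => ∑ c, (totalDeriv (fun y _ => om y k c) (u x) (v x) w * α x c +
          om (u x) k c * α' c)) +
      momentumForm om M (u x) (v x) (κ x) (α x) (fun k => ∑ c, om (u x) k c * β x c)
        (fun k => ∑ c, (totalDeriv (fun y _ => om y k c) (u x) (v x) w * β x c +
          om (u x) k c * β' c))) x := by
  rw [momentumForm_cyclic]
  refine HasDerivAt.fun_sum fun a _ => HasDerivAt.fun_sum fun b _ => HasDerivAt.fun_sum fun c _ => ?_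
  refine ((((hα a).mul (hβ b)).mul (hκ c)).mul
    (hasDerivAt_boundaryTensor hS hO hM hx hu hv b a c)).congr_deriv ?_
  -- By (r1) the three derivative terms carry the same tensor `P^{bac}`, and by (r2) the remaining
  -- coefficient is its total derivative. This is the Leibniz rule for `α_a β_b κ_c P^{bac}`.
  have e1 := relation1_iff.1 h1
  rw [relation2_iff.1 h2 c a b, e1 a b c, ← e1 c a b]
  simp only [Pi.mul_apply]
  ring

end Relations

/-! ### The Jacobi identity as the vanishing of an integral -/

section Jacobi

variable {N : ℕ} {X : Type*} [TopologicalSpace X] [ChartedSpace (Euc N) X]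

/-- A term of the density of the Jacobi identity: the derivative of `ξ_i A^{ij} η_j` along the
field `A^{ij} ζ_j`, with `ξ` and `η` kept constant. -/
def jacobiTerm (A : (p : X) → TangentSpace (𝓡 N) p →
      Module.Dual ℝ (TangentSpace (𝓡 N) p) →ₗ[ℝ] TangentSpace (𝓡 N) p)
    (e : OpenPartialHomeomorph X (Euc N)) (ξ η ζ : CovectorField N X) (γ : UnitAddCircle → X)
    (x : ℝ) : ℝ :=
  ∑ k, (opDerivSum A e ξ η (EuclideanSpace.single k 1, 0) γ x *
      chartDeriv e (γ x) (hamField A ζ γ x) k +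
    opDerivSum A e ξ η (0, EuclideanSpace.single k 1) γ x *
      deriv (fun y : ℝ => chartDeriv e (γ y) (hamField A ζ γ y)) x k)

variable [IsManifold (𝓡 N) ∞ X] {e : OpenPartialHomeomorph X (Euc N)}
  {D : Set (TangentBundle (𝓡 N) X)} {I J K : (UnitAddCircle → X) → ℝ} {ξ η ζ : CovectorField N X}
  {A : (p : X) → TangentSpace (𝓡 N) p →
      Module.Dual ℝ (TangentSpace (𝓡 N) p) →ₗ[ℝ] TangentSpace (𝓡 N) p}

/-- The family `Γ` moves in the direction of the field `A^{ij} ξ_j` at the parameter `q`. -/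
def IsHamDirection {P : Type*} [NormedAddCommGroup P] [NormedSpace ℝ P]
    (A : (p : X) → TangentSpace (𝓡 N) p →
      Module.Dual ℝ (TangentSpace (𝓡 N) p) →ₗ[ℝ] TangentSpace (𝓡 N) p)
    (ξ : CovectorField N X) (Γ : P → UnitAddCircle → X) (q a : P) : Prop :=
  ∀ x : ℝ, ∀ e : OpenPartialHomeomorph X (Euc N), IsCoordinates e → Γ q x ∈ e.source →
    fderiv ℝ (famCoord e Γ) (q, x) (a, 0) = chartDeriv e (Γ q x) (hamField A ξ (Γ q) x)

theorem integral_add_three_sub {f g h f' g' h' : ℝ → ℝ} (hf : Continuous f) (hg : Continuous g)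
    (hh : Continuous h) (hf' : Continuous f') (hg' : Continuous g') (hh' : Continuous h') :
    ∫ x in (0 : ℝ)..1, ((f x - f' x) + (g x - g' x) + (h x - h' x)) =
      ((∫ x in (0 : ℝ)..1, f x) - ∫ x in (0 : ℝ)..1, f' x) +
      ((∫ x in (0 : ℝ)..1, g x) - ∫ x in (0 : ℝ)..1, g' x) +
      ((∫ x in (0 : ℝ)..1, h x) - ∫ x in (0 : ℝ)..1, h' x) := by
  have k1 : Continuous fun x => f x - f' x := hf.sub hf'
  have k2 : Continuous fun x => g x - g' x := hg.sub hg'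
  have k3 : Continuous fun x => h x - h' x := hh.sub hh'
  have k12 : Continuous fun x => (f x - f' x) + (g x - g' x) := k1.add k2
  rw [intervalIntegral.integral_add (k12.intervalIntegrable _ _) (k3.intervalIntegrable _ _),
    intervalIntegral.integral_add (k1.intervalIntegrable _ _) (k2.intervalIntegrable _ _),
    intervalIntegral.integral_sub (hf.intervalIntegrable _ _) (hf'.intervalIntegrable _ _),
    intervalIntegral.integral_sub (hg.intervalIntegrable _ _) (hg'.intervalIntegrable _ _),
    intervalIntegral.integral_sub (hh.intervalIntegrable _ _) (hh'.intervalIntegrable _ _)]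

section HamDirection

variable {P : Type*} [NormedAddCommGroup P] [NormedSpace ℝ P] [FiniteDimensional ℝ P] {U : Set P}
  {Γ : P → UnitAddCircle → X} {q a b c : P}

theorem HamExt.isHamDirection_snd {W : Set (P × ℝ)} {Γ' : P × ℝ → UnitAddCircle → X}
    (h : HamExt D A η Γ W Γ') (hq : (q, 0) ∈ W) : IsHamDirection A η Γ' (q, 0) (0, 1) :=
  fun x e he hx => by
    rw [h.zero] at hx ⊢
    exact h.tangent q hq x e he hx

theorem HamExt.isHamDirection_fst {W : Set (P × ℝ)} {Γ' : P × ℝ → UnitAddCircle → X}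
    (h : HamExt D A η Γ W Γ') (hΓ : LoopFam D U Γ) (hq : (q, 0) ∈ W) (hqU : q ∈ U)
    (ha : IsHamDirection A ξ Γ q a) : IsHamDirection A ξ Γ' (q, 0) (a, 0) :=
  fun x e he hx => by
    have hx' : Γ q x ∈ e.source := by rwa [h.zero] at hx
    rw [fderiv_fst_line (g' := famCoord e Γ) (fun q x => by simp only [famCoord, h.zero])
      ((h.fam.famCoord_contDiffAt he (z := ((q, 0), x)) ⟨hq, hx⟩).differentiableAt (by simp))
      ((hΓ.famCoord_contDiffAt he (z := (q, x)) ⟨hqU, hx'⟩).differentiableAt (by simp)),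
      ha x e he hx', h.zero]

theorem IsHamDirection.paramVec_eq (h : IsHamDirection A ξ Γ q a) (hΓ : LoopFam D U Γ)
    (hq : q ∈ U) (x : ℝ) : paramVec Γ a q x = hamField A ξ (Γ q) x := by
  have he := isCoordinates_chartAt (N := N) (Γ q x)
  have hx := mem_chart_source (Euc N) (Γ q x)
  refine chartDeriv_injective he hx ?_
  rw [← h x _ he hx]
  exact hΓ.chartDeriv_paramVec he (z := (q, x)) ⟨hq, hx⟩ a

/-- Three successive extensions of the constant family, one for each field. The directions already
obtained survive because an extension restricts to the old family when the new parameter is `0`. -/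
theorem exists_three_hamDirections [T2Space X] (hD : IsOpen D) (hA : IsSkewOperator D A)
    (hI : HasVariationalDerivative D I ξ) (hJ : HasVariationalDerivative D J η)
    (hK : HasVariationalDerivative D K ζ) {γ : UnitAddCircle → X} (hγ : IsLoop D γ) :
    ∃ (U : Set (((ℝ × ℝ) × ℝ) × ℝ)) (Γ : ((ℝ × ℝ) × ℝ) × ℝ → UnitAddCircle → X)
      (q a b c : ((ℝ × ℝ) × ℝ) × ℝ), LoopFam D U Γ ∧ q ∈ U ∧ Γ q = γ ∧ IsHamDirection A ξ Γ q a ∧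
        IsHamDirection A η Γ q b ∧ IsHamDirection A ζ Γ q c := by
  obtain ⟨W₁, Γ₁, h1, hq1, -⟩ := exists_hamExt (q := (0 : ℝ)) hD hA hI (loopFam_const hγ)
    (mem_univ _)
  obtain ⟨W₂, Γ₂, h2, hq2, -⟩ := exists_hamExt hD hA hJ h1.fam hq1
  obtain ⟨W₃, Γ₃, h3, hq3, -⟩ := exists_hamExt hD hA hK h2.fam hq2
  refine ⟨W₃, Γ₃, (((0, 0), 0), 0), (((0, 1), 0), 0), ((0, 1), 0), (0, 1), h3.fam, hq3, ?_, ?_,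
    ?_, ?_⟩
  · rw [h3.zero, h2.zero, h1.zero]
  · exact h3.isHamDirection_fst h2.fam hq3 hq2
      (h2.isHamDirection_fst h1.fam hq2 hq1 (h1.isHamDirection_snd hq1))
  · exact h3.isHamDirection_fst h2.fam hq3 hq2 (h2.isHamDirection_snd hq2)
  · exact h3.isHamDirection_snd hq3

/-- The double bracket is `θ` paired with the field `Aζ`, that is, the derivative of the inner
bracket in the direction `c`. Differentiating under the integral computes the same number without
reference to `θ`. -/
theorem loopBracket_of_isHamDirection (hA : IsSkewOperator D A)
    (hI : HasVariationalDerivative D I ξ) (hJ : HasVariationalDerivative D J η)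
    {θ : CovectorField N X} (hIJ : HasVariationalDerivative D (loopBracket A ξ η) θ)
    (hΓ : LoopFam D U Γ) (hq : q ∈ U) (hc : IsHamDirection A ζ Γ q c) :
    loopBracket A θ ζ (Γ q) =
      ∫ x in (0 : ℝ)..1, fderiv ℝ (bracketDensity A ξ η Γ) (q, x) (c, 0) := by
  rw [HasDerivAt.unique (hasLineDerivAt_loopBracket hA hI hJ hΓ hq c)
    (hIJ.hasLineDerivAt hΓ hq c), loopBracket_eq A θ ζ (hΓ.isLoop q hq)]
  simp only [hc.paramVec_eq hΓ hq]

/-- Since `c` is the direction of `Aζ` at every point of the loop, symmetry of second derivatives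
turns `∂_c u_x` into the `x`-derivative of `Aζ` along that loop. -/
theorem IsHamDirection.fderiv_bracketDensity (hD : IsOpen D) (hA : IsSkewOperator D A)
    (hI : HasVariationalDerivative D I ξ) (hJ : HasVariationalDerivative D J η)
    (hΓ : LoopFam D U Γ) (hq : q ∈ U) (ha : IsHamDirection A ξ Γ q a)
    (hb : IsHamDirection A η Γ q b) (hc : IsHamDirection A ζ Γ q c) (he : IsCoordinates e) {x : ℝ}
    (hx : Γ q x ∈ e.source) :
    fderiv ℝ (bracketDensity A ξ η Γ) (q, x) (c, 0) =
      ∑ i, fderiv ℝ (cofieldCoord e ξ Γ i) (q, x) (c, 0) *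
          fderiv ℝ (famCoord e Γ) (q, x) (b, 0) i -
        ∑ i, fderiv ℝ (cofieldCoord e η Γ i) (q, x) (c, 0) *
          fderiv ℝ (famCoord e Γ) (q, x) (a, 0) i +
        jacobiTerm A e ξ η ζ (Γ q) x := by
  have hz : (q, x) ∈ chartDomain U Γ e := ⟨hq, hx⟩
  rw [LoopPoisson.fderiv_bracketDensity hD hA hI hJ hΓ he hz, ha x e he hx, hb x e he hx]
  congr 1
  unfold jacobiTerm
  have h1 : fderiv ℝ (fderiv ℝ (famCoord e Γ)) (q, x) (c, 0) (0, 1) =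
      deriv (fun y : ℝ => chartDeriv e (Γ q y) (hamField A ζ (Γ q) y)) x := by
    rw [hΓ.snd_symm he hz]
    have h2 : HasFDerivAt (fun z => fderiv ℝ (famCoord e Γ) z (c, 0)) _ (q, x) :=
      ((((hΓ.contDiffOn_deriv he (c, 0)).contDiffAt ((hΓ.isOpen_chartDomain e).mem_nhds hz))
        ).differentiableAt (by simp)).hasFDerivAt
    have h3 := ((((hΓ.famCoord_contDiffAt he hz).fderiv_right (m := ∞) (by simp)).differentiableAt
      (by simp)).hasFDerivAt).clm_apply (hasFDerivAt_const (c, (0 : ℝ)) (q, x))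
    have h4 := (HasFDerivAt.comp (g := fun z => fderiv ℝ (famCoord e Γ) z (c, 0))
      (f := fun y => (q, y)) x h3 (hasFDerivAt_prodMk_right q x)).hasDerivAt
    have h5 : (fun y : ℝ => chartDeriv e (Γ q y) (hamField A ζ (Γ q) y)) =ᶠ[𝓝 x]
        (fun z => fderiv ℝ (famCoord e Γ) z (c, 0)) ∘ fun y => (q, y) := by
      have h6 : ContinuousAt (fun y : ℝ => (q, y)) x := by fun_prop
      filter_upwards [h6.eventually ((hΓ.isOpen_chartDomain e).mem_nhds hz)] with y hy
      exact (hc y e he hy.2).symm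
    rw [h5.deriv_eq, h4.deriv]
    simp
  rw [h1, hc x e he hx]

/-- The Jacobi identity is the vanishing of the integral of a density. -/
theorem exists_jacobi_density [T2Space X] (hD : IsOpen D) (hA : IsSkewOperator D A)
    (hI : HasVariationalDerivative D I ξ) (hJ : HasVariationalDerivative D J η)
    (hK : HasVariationalDerivative D K ζ) {γ : UnitAddCircle → X} (hγ : IsLoop D γ) :
    ∃ T : ℝ → ℝ, Continuous T ∧
      (∀ x : ℝ, ∀ e : OpenPartialHomeomorph X (Euc N), IsCoordinates e → γ x ∈ e.source →
        T x = jacobiTerm A e ξ η ζ γ x + jacobiTerm A e η ζ ξ γ x + jacobiTerm A e ζ ξ η γ x) ∧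
      ∀ dIJ dJK dKI : CovectorField N X, HasVariationalDerivative D (loopBracket A ξ η) dIJ →
        HasVariationalDerivative D (loopBracket A η ζ) dJK →
        HasVariationalDerivative D (loopBracket A ζ ξ) dKI →
        loopBracket A dIJ ζ γ + loopBracket A dJK ξ γ + loopBracket A dKI η γ =
          ∫ x in (0 : ℝ)..1, T x := by
  obtain ⟨U, Γ, q, a, b, c, hΓ, hq, rfl, ha, hb, hc⟩ :=
    exists_three_hamDirections hD hA hI hJ hK hγ
  have c1 := continuous_fderiv_strip hΓ.isOpen (bracketDensity_contDiffOn hA hI hJ hΓ) hq (c, 0)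
  have c2 := continuous_fderiv_strip hΓ.isOpen (bracketDensity_contDiffOn hA hJ hK hΓ) hq (a, 0)
  have c3 := continuous_fderiv_strip hΓ.isOpen (bracketDensity_contDiffOn hA hK hI hΓ) hq (b, 0)
  have d1 := continuous_curl hI hΓ hq b c
  have d2 := continuous_curl hJ hΓ hq c a
  have d3 := continuous_curl hK hΓ hq a b
  -- The six terms with derivatives of `ξ`, `η`, `ζ` form exactly these three curls. Subtracting
  -- them leaves only derivatives of `A` and does not change the integral.
  refine ⟨fun x => (fderiv ℝ (bracketDensity A ξ η Γ) (q, x) (c, 0) - curl ξ Γ b c (q, x)) +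
    (fderiv ℝ (bracketDensity A η ζ Γ) (q, x) (a, 0) - curl η Γ c a (q, x)) +
    (fderiv ℝ (bracketDensity A ζ ξ Γ) (q, x) (b, 0) - curl ζ Γ a b (q, x)), ?_, ?_, ?_⟩
  · exact ((c1.sub d1).add (c2.sub d2)).add (c3.sub d3)
  · intro x e he hx
    have hz : (q, x) ∈ chartDomain U Γ e := ⟨hq, hx⟩
    simp only
    rw [IsHamDirection.fderiv_bracketDensity hD hA hI hJ hΓ hq ha hb hc he hx,
      IsHamDirection.fderiv_bracketDensity hD hA hJ hK hΓ hq hb hc ha he hx,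
      IsHamDirection.fderiv_bracketDensity hD hA hK hI hΓ hq hc ha hb he hx,
      curl_chart hI hΓ he hz, curl_chart hJ hΓ he hz, curl_chart hK hΓ he hz]
    simp only [Finset.sum_sub_distrib]
    ring
  · intro dIJ dJK dKI hIJ hJK hKI
    rw [loopBracket_of_isHamDirection hA hI hJ hIJ hΓ hq hc,
      loopBracket_of_isHamDirection hA hJ hK hJK hΓ hq ha,
      loopBracket_of_isHamDirection hA hK hI hKI hΓ hq hb,
      integral_add_three_sub c1 c2 c3 d1 d2 d3,
      integral_curl_eq_zero hI hΓ hq, integral_curl_eq_zero hJ hΓ hq,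
      integral_curl_eq_zero hK hΓ hq, sub_zero, sub_zero, sub_zero]

end HamDirection

end Jacobi

/-! ### Smoothness of the inverse matrix -/

section MatrixInverse

variable {F : Type*} [NormedAddCommGroup F] [NormedSpace ℝ F] {n : ℕ∞} {S : Set F} {m : Type*}
  [Fintype m] [DecidableEq m] {G : F → Matrix m m ℝ}

theorem contDiffOn_det (hG : ∀ i j, ContDiffOn ℝ n (fun z => G z i j) S) :
    ContDiffOn ℝ n (fun z => (G z).det) S := by
  simp only [Matrix.det_apply]
  exact ContDiffOn.sum fun σ _ => (contDiffOn_prod fun i _ => hG _ _).const_smul _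

/-- Cramer's rule: the entries are quotients of determinants. -/
theorem contDiffOn_matrix_inv (hG : ∀ i j, ContDiffOn ℝ n (fun z => G z i j) S)
    (h0 : ∀ z ∈ S, (G z).det ≠ 0) (i j : m) : ContDiffOn ℝ n (fun z => (G z)⁻¹ i j) S := by
  simp only [Matrix.inv_def, Matrix.smul_apply, Matrix.adjugate_apply, Ring.inverse_eq_inv',
    smul_eq_mul]
  refine ((contDiffOn_det hG).inv h0).mul (contDiffOn_det fun k l => ?_)
  by_cases h : k = j
  · subst h
    simp only [Matrix.updateRow_self]
    exact contDiffOn_const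
  · simp only [Matrix.updateRow_ne h]
    exact hG k l

end MatrixInverse

/-! ### The operator `B ω` and elimination of the inverse -/

section Twist

variable {N : ℕ} {X : Type*} [TopologicalSpace X] [ChartedSpace (Euc N) X]

/-- The operator `B^i_s ω^{sj}` is skew-symmetric, where `ω` is a bivector and `B` is the
inverse of the endomorphism field `M`. -/
structure IsTwist (D : Set (TangentBundle (𝓡 N) X))
    (om : (p : X) → Module.Dual ℝ (TangentSpace (𝓡 N) p) →ₗ[ℝ] TangentSpace (𝓡 N) p)
    (M B : (p : X) → TangentSpace (𝓡 N) p → Module.End ℝ (TangentSpace (𝓡 N) p)) : Prop where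
  bivector : IsBivector om
  smooth : IsSmoothEndoOn D M
  inv : ∀ (p : X) (v : TangentSpace (𝓡 N) p), (⟨p, v⟩ : TangentBundle (𝓡 N) X) ∈ D →
    B p v ∘ₗ M p v = LinearMap.id
  skew : ∀ (p : X) (v : TangentSpace (𝓡 N) p), (⟨p, v⟩ : TangentBundle (𝓡 N) X) ∈ D →
    ∀ θ η : Module.Dual ℝ (TangentSpace (𝓡 N) p),
      θ ((B p v ∘ₗ om p) η) = -η ((B p v ∘ₗ om p) θ)

/-- The operator `B^i_s ω^{sj}`. -/
abbrev twistOp (om : (p : X) → Module.Dual ℝ (TangentSpace (𝓡 N) p) →ₗ[ℝ] TangentSpace (𝓡 N) p)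
    (B : (p : X) → TangentSpace (𝓡 N) p → Module.End ℝ (TangentSpace (𝓡 N) p)) (p : X)
    (v : TangentSpace (𝓡 N) p) :
    Module.Dual ℝ (TangentSpace (𝓡 N) p) →ₗ[ℝ] TangentSpace (𝓡 N) p :=
  B p v ∘ₗ om p

variable [IsManifold (𝓡 N) ∞ X] {e : OpenPartialHomeomorph X (Euc N)}
  {D : Set (TangentBundle (𝓡 N) X)}
  {om : (p : X) → Module.Dual ℝ (TangentSpace (𝓡 N) p) →ₗ[ℝ] TangentSpace (𝓡 N) p}
  {M B : (p : X) → TangentSpace (𝓡 N) p → Module.End ℝ (TangentSpace (𝓡 N) p)}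

theorem endoComp_comp (he : IsCoordinates e)
    (M B : (p : X) → TangentSpace (𝓡 N) p → Module.End ℝ (TangentSpace (𝓡 N) p))
    {u : Euc N} (hu : u ∈ e.target) (v : Euc N) (i j : Fin N) :
    ∑ s, endoComp B e u v i s * endoComp M e u v s j =
      coordCovector e (e.symm u) i (B (e.symm u) (coordVector e (e.symm u) v)
        (M (e.symm u) (coordVector e (e.symm u) v) (coordFrame e (e.symm u) j))) := by
  have hp := e.map_target hu
  rw [coordCovector_apply, chartDeriv_endo he hp, e.right_inv hu, chartDeriv_coordVector he hp]
  rfl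

theorem endoComp_bivectorComp (he : IsCoordinates e)
    (om : (p : X) → Module.Dual ℝ (TangentSpace (𝓡 N) p) →ₗ[ℝ] TangentSpace (𝓡 N) p)
    (B : (p : X) → TangentSpace (𝓡 N) p → Module.End ℝ (TangentSpace (𝓡 N) p))
    {z : Euc N × Euc N} (hz : z.1 ∈ e.target) (i j : Fin N) :
    ∑ s, endoComp B e z.1 z.2 i s * bivectorComp om e z.1 s j = opComp (twistOp om B) e i j z := by
  have hp := e.map_target hz
  simp only [opComp, LinearMap.comp_apply]
  rw [coordCovector_apply, chartDeriv_endo he hp, e.right_inv hz, chartDeriv_coordVector he hp]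
  rfl

theorem coordCovector_coordFrame (he : IsCoordinates e) {p : X} (hp : p ∈ e.source) (i j : Fin N) :
    coordCovector e p i (coordFrame e p j) = if i = j then 1 else 0 := by
  rw [coordCovector_apply, chartDeriv_coordFrame he hp]

/-- In finite dimension a left inverse is a right inverse. -/
theorem IsTwist.comp_inv (h : IsTwist D om M B) {p : X} {v : TangentSpace (𝓡 N) p}
    (hv : (⟨p, v⟩ : TangentBundle (𝓡 N) X) ∈ D) (w : TangentSpace (𝓡 N) p) :
    M p v (B p v w) = w := by
  have : FiniteDimensional ℝ (TangentSpace (𝓡 N) p) :=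
    inferInstanceAs (FiniteDimensional ℝ (Euc N))
  have h1 : B p v * M p v = 1 := h.inv p v hv
  have h2 : M p v * B p v = 1 := mul_eq_one_comm.1 h1
  exact congrArg (fun f : Module.End ℝ (TangentSpace (𝓡 N) p) => f w) h2

theorem IsTwist.inv_comp (h : IsTwist D om M B) {p : X} {v : TangentSpace (𝓡 N) p}
    (hv : (⟨p, v⟩ : TangentBundle (𝓡 N) X) ∈ D) (w : TangentSpace (𝓡 N) p) :
    B p v (M p v w) = w :=
  congrArg (fun f : Module.End ℝ (TangentSpace (𝓡 N) p) => f w) (h.inv p v hv)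

theorem IsTwist.smooth_inv (h : IsTwist D om M B) : IsSmoothEndoOn D B := by
  intro e he i j
  let G : Euc N × Euc N → Matrix (Fin N) (Fin N) ℝ := fun z => Matrix.of (endoComp M e z.1 z.2)
  have h1 : ∀ z ∈ coordDomain D e, Matrix.of (endoComp B e z.1 z.2) * G z = 1 := by
    intro z hz
    ext k l
    rw [Matrix.mul_apply]
    refine (endoComp_comp he M B hz.1 z.2 k l).trans ?_
    rw [h.inv_comp hz.2, coordCovector_coordFrame he (e.map_target hz.1), Matrix.one_apply]
  have h2 : ∀ z ∈ coordDomain D e, (G z).det ≠ 0 := fun z hz h0 => by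
    have := congrArg Matrix.det (h1 z hz)
    rw [Matrix.det_mul, h0, mul_zero, Matrix.det_one] at this
    exact zero_ne_one this
  refine (contDiffOn_matrix_inv (G := G) (fun i j => h.smooth e he i j) h2 i j).congr
    fun z hz => ?_
  rw [Matrix.inv_eq_left_inv (h1 z hz), Matrix.of_apply]

theorem IsTwist.contDiffOn_bivector (h : IsTwist D om M B) (he : IsCoordinates e) (i j : Fin N) :
    ContDiffOn ℝ ∞ (fun z : Euc N × Euc N => bivectorComp om e z.1 i j) (coordDomain D e) :=
  (h.bivector.smooth e he i j).comp contDiffOn_fst fun _ hz => hz.1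

theorem IsTwist.isSkewOperator (h : IsTwist D om M B) : IsSkewOperator D (twistOp om B) where
  smooth e he i j := by
    refine (ContDiffOn.sum (s := Finset.univ) fun s _ => (h.smooth_inv e he i s).mul
      (h.contDiffOn_bivector he s j)).congr fun z hz => ?_
    exact (endoComp_bivectorComp he om B hz.1 i j).symm
  skew := h.skew

/-- `M^b_i A^{ij} = ω^{bj}`. -/
theorem IsTwist.endo_mul_op (h : IsTwist D om M B) (he : IsCoordinates e) {z : Euc N × Euc N}
    (hz : z ∈ coordDomain D e) (b j : Fin N) :
    ∑ i, endoComp M e z.1 z.2 b i * opComp (twistOp om B) e i j z = bivectorComp om e z.1 b j := by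
  have hp := e.map_target hz.1
  have h1 : ∀ i, opComp (twistOp om B) e i j z = chartDeriv e (e.symm z.1)
      (twistOp om B _ (coordVector e (e.symm z.1) z.2) (coordCovector e (e.symm z.1) j)) i :=
    fun i => coordCovector_apply _ _ _ _
  have h2 := chartDeriv_endo he hp M (coordVector e (e.symm z.1) z.2)
    (twistOp om B _ (coordVector e (e.symm z.1) z.2) (coordCovector e (e.symm z.1) j)) b
  rw [e.right_inv hz.1, chartDeriv_coordVector he hp] at h2
  simp only [h1]
  rw [← h2, LinearMap.comp_apply, h.comp_inv hz.2, ← coordCovector_apply]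
  rfl

/-- `A^{ij} M^b_j = ω^{ib}`. -/
theorem IsTwist.op_mul_endo (h : IsTwist D om M B) (he : IsCoordinates e) {z : Euc N × Euc N}
    (hz : z ∈ coordDomain D e) (i b : Fin N) :
    ∑ j, opComp (twistOp om B) e i j z * endoComp M e z.1 z.2 b j = bivectorComp om e z.1 i b := by
  have h1 : bivectorComp om e z.1 i b = -bivectorComp om e z.1 b i := h.bivector.skew _ _ _
  rw [h1, ← h.endo_mul_op he hz, ← Finset.sum_neg_distrib]
  refine Finset.sum_congr rfl fun j _ => ?_
  rw [h.isSkewOperator.opComp_skew hz j i]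
  ring

/-- From `A Mᵀ = ω` follows `dA Mᵀ = dω - A dMᵀ`. Multiplying by `M` and using `M A = ω` gives `M dA
Mᵀ = M dω - ω dMᵀ`, in which the inverse of `M` no longer occurs. -/
theorem IsTwist.sum_fderiv_op (h : IsTwist D om M B) (hD : IsOpen D) (he : IsCoordinates e)
    {z : Euc N × Euc N} (hz : z ∈ coordDomain D e) (α β : Fin N → ℝ) (du dv : Euc N) :
    ∑ i, ∑ j, (∑ s, α s * endoComp M e z.1 z.2 s i) * (∑ b, β b * endoComp M e z.1 z.2 b j) *
      fderiv ℝ (opComp (twistOp om B) e i j) z (du, dv) =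
    momentumForm (bivectorComp om e) (endoComp M e) z.1 z.2 α β du dv := by
  have hS := isOpen_coordDomain he hD
  have hM : ∀ i j, DifferentiableAt ℝ (fun z : Euc N × Euc N => endoComp M e z.1 z.2 i j) z :=
    fun i j => ((h.smooth e he i j).contDiffAt (hS.mem_nhds hz)).differentiableAt (by simp)
  have hO : ∀ i j, DifferentiableAt ℝ (fun z : Euc N × Euc N => bivectorComp om e z.1 i j) z :=
    fun i j => ((h.contDiffOn_bivector he i j).contDiffAt (hS.mem_nhds hz)).differentiableAt
      (by simp)
  have hA : ∀ i j, DifferentiableAt ℝ (opComp (twistOp om B) e i j) z := fun i j =>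
    (h.isSkewOperator.contDiffAt hD he hz i j).differentiableAt (by simp)
  have h1 : ∀ i b, ∑ j, endoComp M e z.1 z.2 b j * fderiv ℝ (opComp (twistOp om B) e i j) z (du, dv)
      = fderiv ℝ (fun z : Euc N × Euc N => bivectorComp om e z.1 i b) z (du, dv) -
        ∑ j, opComp (twistOp om B) e i j z *
          fderiv ℝ (fun z : Euc N × Euc N => endoComp M e z.1 z.2 b j) z (du, dv) := by
    intro i b
    have h2 : (fun z : Euc N × Euc N => bivectorComp om e z.1 i b) =ᶠ[𝓝 z]
        fun z => ∑ j, opComp (twistOp om B) e i j z * endoComp M e z.1 z.2 b j := by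
      filter_upwards [hS.mem_nhds hz] with y hy
      exact (h.op_mul_endo he hy i b).symm
    have h3 := HasFDerivAt.fun_sum (u := Finset.univ) fun j (_ : j ∈ Finset.univ) =>
      (hA i j).hasFDerivAt.mul (hM b j).hasFDerivAt
    rw [h2.fderiv_eq]
    erw [h3.fderiv]
    simp only [FunLike.coe_sum, Finset.sum_apply, FunLike.coe_add, FunLike.coe_smul, Pi.add_apply,
      Pi.smul_apply, smul_eq_mul, Finset.sum_add_distrib]
    ring
  have h4 : ∀ i b, ∑ r, du r * pderiv r (fun y => bivectorComp om e y i b) z.1 =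
      fderiv ℝ (fun z : Euc N × Euc N => bivectorComp om e z.1 i b) z (du, dv) := fun i b => by
    have := fderiv_eq_sum_pderiv (F := fun y _ => bivectorComp om e y i b) (u := z.1) (v := z.2)
      (hO i b) du dv
    rw [show z = (z.1, z.2) from rfl, this]
    simp [pderiv]
  have h5 : ∀ i b, ∑ r, (du r * pderiv r (fun y => endoComp M e y z.2 b i) z.1 +
      dv r * pderiv r (fun y => endoComp M e z.1 y b i) z.2) =
      fderiv ℝ (fun z : Euc N × Euc N => endoComp M e z.1 z.2 b i) z (du, dv) := fun i b =>
    (fderiv_eq_sum_pderiv (F := fun y y' => endoComp M e y y' b i) (u := z.1) (v := z.2)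
      (hM b i) du dv).symm
  have h6 : ∀ s b, ∑ i, ∑ j, endoComp M e z.1 z.2 s i * (endoComp M e z.1 z.2 b j *
      fderiv ℝ (opComp (twistOp om B) e i j) z (du, dv)) =
      ∑ i, (endoComp M e z.1 z.2 s i *
        fderiv ℝ (fun z : Euc N × Euc N => bivectorComp om e z.1 i b) z (du, dv) +
        bivectorComp om e z.1 i s *
        fderiv ℝ (fun z : Euc N × Euc N => endoComp M e z.1 z.2 b i) z (du, dv)) := by
    intro s b
    simp only [← Finset.mul_sum, h1, mul_sub, Finset.sum_sub_distrib, Finset.sum_add_distrib]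
    simp only [Finset.mul_sum]
    rw [Finset.sum_comm (f := fun i j => endoComp M e z.1 z.2 s i * _), sub_eq_add_neg,
      ← Finset.sum_neg_distrib]
    congr 1
    refine Finset.sum_congr rfl fun j _ => ?_
    have h7 : bivectorComp om e z.1 j s = -bivectorComp om e z.1 s j := h.bivector.skew _ _ _
    rw [h7, ← h.endo_mul_op he hz, neg_mul, Finset.sum_mul]
    simp only [mul_assoc]
  unfold momentumForm
  simp only [h4, h5, ← h6, Finset.sum_mul, Finset.mul_sum]
  rw [← sum_comm_three]
  conv_rhs => rw [Finset.sum_comm]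
  refine Finset.sum_congr rfl fun s _ => ?_
  rw [← sum_comm_three]
  exact Finset.sum_congr rfl fun b _ => Finset.sum_congr rfl fun i _ =>
    Finset.sum_congr rfl fun j _ => by ring

end Twist

/-! ### A single loop in coordinates -/

section LoopCharts

variable {N : ℕ} {X : Type*} [TopologicalSpace X] [ChartedSpace (Euc N) X]
  [IsManifold (𝓡 N) ∞ X] {e : OpenPartialHomeomorph X (Euc N)}
  {D : Set (TangentBundle (𝓡 N) X)} {γ : UnitAddCircle → X} {x : ℝ}

/-- The coordinates of the velocity of a loop. -/
def velocityCoord (e : OpenPartialHomeomorph X (Euc N)) (γ : UnitAddCircle → X)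
    (x : UnitAddCircle) : Euc N :=
  chartDeriv e (γ x) (circleVelocity γ x)

theorem IsLoop.circleVelocity_mem (hγ : IsLoop D γ) (x : ℝ) :
    (⟨γ x, circleVelocity γ x⟩ : TangentBundle (𝓡 N) X) ∈ D := by
  rw [hγ.circleVelocity_coe]
  exact hγ.2 x

theorem IsLoop.velocityCoord_mem (hγ : IsLoop D γ) (he : IsCoordinates e) (hx : γ x ∈ e.source) :
    (e (γ x), velocityCoord e γ x) ∈ coordDomain D e :=
  (chartDeriv_mem_coordDomain_iff he hx _).2 (hγ.circleVelocity_mem x)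

theorem mem_chartDomain_const (hx : γ x ∈ e.source) :
    ((0 : ℝ), x) ∈ chartDomain univ (fun _ : ℝ => γ) e := ⟨mem_univ _, hx⟩

theorem IsLoop.eventually_mem (hγ : IsLoop D γ) (hx : γ x ∈ e.source) :
    ∀ᶠ y : ℝ in 𝓝 x, γ y ∈ e.source :=
  hγ.1.continuous.continuousAt.eventually (e.open_source.mem_nhds hx)

theorem IsLoop.contDiffAt_slice {F : Type*} [NormedAddCommGroup F] [NormedSpace ℝ F]
    {G : ℝ × ℝ → F} (hγ : IsLoop D γ) (hx : γ x ∈ e.source)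
    (hG : ContDiffOn ℝ ∞ G (chartDomain univ (fun _ : ℝ => γ) e)) :
    ContDiffAt ℝ ∞ (fun y => G (0, y)) x :=
  (hG.contDiffAt (((loopFam_const hγ).isOpen_chartDomain e).mem_nhds
    (mem_chartDomain_const hx))).comp x (f := fun y => ((0 : ℝ), y)) (by fun_prop)

theorem IsLoop.contDiffAt_velocityCoord (hγ : IsLoop D γ) (he : IsCoordinates e)
    (hx : γ x ∈ e.source) : ContDiffAt ℝ ∞ (fun y : ℝ => velocityCoord e γ y) x := by
  have h := loopFam_const (P := ℝ) hγ
  refine hγ.contDiffAt_slice hx (G := fun z => velocityCoord e γ z.2)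
    ((h.contDiffOn_deriv he (0, 1)).congr fun z hz => ?_)
  exact h.chartDeriv_circleVelocity he hz

theorem IsLoop.hasDerivAt_coord (hγ : IsLoop D γ) (he : IsCoordinates e) (hx : γ x ∈ e.source) :
    HasDerivAt (fun y : ℝ => e (γ y)) (velocityCoord e γ x) x := by
  have h1 : ContDiffAt ℝ ∞ (fun y : ℝ => e (γ y)) x :=
    hγ.contDiffAt_slice hx ((loopFam_const (P := ℝ) hγ).famCoord_contDiffOn he)
  rw [velocityCoord, hγ.circleVelocity_coe, hγ.chartDeriv_velocity he hx]
  exact (h1.differentiableAt (by simp)).hasDerivAt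

theorem IsLoop.hasDerivAt_velocityCoord (hγ : IsLoop D γ) (he : IsCoordinates e)
    (hx : γ x ∈ e.source) : HasDerivAt (fun y : ℝ => velocityCoord e γ y)
      (deriv (fun y : ℝ => velocityCoord e γ y) x) x :=
  ((hγ.contDiffAt_velocityCoord he hx).differentiableAt (by simp)).hasDerivAt

end LoopCharts

theorem hasDerivAt_of_coord {N : ℕ} {f : ℝ → Euc N} {f' : Euc N} {x : ℝ}
    (h : ∀ k, HasDerivAt (fun y => f y k) (f' k) x) : HasDerivAt f f' x := by
  rw [← hasDerivWithinAt_univ, hasDerivWithinAt_iff_hasFDerivWithinAt, hasFDerivWithinAt_euclidean]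
  intro k
  refine (h k).hasDerivWithinAt.hasFDerivWithinAt.congr_fderiv ?_
  ext
  simp

/-! ### Rewriting the Jacobi density in the covectors `ξ B` -/

section Momentum

variable {N : ℕ} {X : Type*} [TopologicalSpace X] [ChartedSpace (Euc N) X]

/-- The covector field `ξ_i B^i_s`. -/
def momentum (B : (p : X) → TangentSpace (𝓡 N) p → Module.End ℝ (TangentSpace (𝓡 N) p))
    (ξ : CovectorField N X) : CovectorField N X :=
  fun γ x => ξ γ x ∘ₗ B (γ x) (circleVelocity γ x)

/-- The components of the covector field `ξ_i B^i_s`. -/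
def momentumCoord (B : (p : X) → TangentSpace (𝓡 N) p → Module.End ℝ (TangentSpace (𝓡 N) p))
    (e : OpenPartialHomeomorph X (Euc N)) (ξ : CovectorField N X) (γ : UnitAddCircle → X)
    (x : ℝ) (s : Fin N) : ℝ :=
  momentum B ξ γ x (coordFrame e (γ x) s)

variable [IsManifold (𝓡 N) ∞ X] {e : OpenPartialHomeomorph X (Euc N)}
  {D : Set (TangentBundle (𝓡 N) X)} {I J K : (UnitAddCircle → X) → ℝ} {ξ η ζ : CovectorField N X}
  {om : (p : X) → Module.Dual ℝ (TangentSpace (𝓡 N) p) →ₗ[ℝ] TangentSpace (𝓡 N) p}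
  {M B : (p : X) → TangentSpace (𝓡 N) p → Module.End ℝ (TangentSpace (𝓡 N) p)}
  {γ : UnitAddCircle → X} {x : ℝ}

theorem momentumCoord_contDiffAt (h : IsTwist D om M B) (hI : HasVariationalDerivative D I ξ)
    (hγ : IsLoop D γ) (he : IsCoordinates e) (hx : γ x ∈ e.source) (s : Fin N) :
    ContDiffAt ℝ ∞ (fun y : ℝ => momentumCoord B e ξ γ y s) x := by
  have hΓ := loopFam_const (P := ℝ) hγ
  refine hγ.contDiffAt_slice hx (G := fun z => momentumCoord B e ξ γ z.2 s)
    ((ContDiffOn.sum (s := Finset.univ) fun i _ => (cofieldCoord_contDiffOn hI hΓ he i).mul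
      ((h.smooth_inv e he i s).comp (hΓ.jetCoord_contDiffOn he) fun _ hz =>
        hΓ.jetCoord_mem he hz)).congr fun z hz => ?_)
  rw [momentumCoord, momentum, LinearMap.comp_apply, covector_apply he hz.2]
  refine Finset.sum_congr rfl fun i _ => ?_
  rw [← coordCovector_apply, Function.comp_apply, hΓ.jetCoord_eq he hz, endoComp_chart hz.2,
    coordVector_chartDeriv he hz.2]
  rfl

theorem hasDerivAt_momentumCoord (h : IsTwist D om M B) (hI : HasVariationalDerivative D I ξ)
    (hγ : IsLoop D γ) (he : IsCoordinates e) (hx : γ x ∈ e.source) (s : Fin N) :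
    HasDerivAt (fun y : ℝ => momentumCoord B e ξ γ y s)
      (deriv (fun y : ℝ => momentumCoord B e ξ γ y s) x) x :=
  ((momentumCoord_contDiffAt h hI hγ he hx s).differentiableAt (by simp)).hasDerivAt

theorem covector_coordFrame_eq (h : IsTwist D om M B) (hγ : IsLoop D γ) (he : IsCoordinates e)
    (hx : γ x ∈ e.source) (i : Fin N) : ξ γ x (coordFrame e (γ x) i) =
      ∑ s, momentumCoord B e ξ γ x s * endoComp M e (e (γ x)) (velocityCoord e γ x) s i := by
  have h1 : ξ γ x (coordFrame e (γ x) i) =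
      momentum B ξ γ x (M (γ x) (circleVelocity γ x) (coordFrame e (γ x) i)) := by
    rw [momentum, LinearMap.comp_apply, h.inv_comp (hγ.circleVelocity_mem x)]
  rw [h1, covector_apply he hx]
  refine Finset.sum_congr rfl fun s _ => ?_
  rw [endoComp_chart hx, velocityCoord, coordVector_chartDeriv he hx, coordCovector_apply]
  rfl

/-- For every covector `θ`, skew-symmetry of `Bω` and then of `ω` gives `θ(Bωξ) = -ξ(Bωθ) =
-(ξB)(ωθ) = θ(ω(ξB))`. -/
theorem hamField_twistOp (h : IsTwist D om M B) (hγ : IsLoop D γ) :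
    hamField (twistOp om B) ξ γ x = om (γ x) (momentum B ξ γ x) := by
  refine (Module.forall_dual_apply_eq_zero_iff ℝ _).1 (fun θ => ?_) |> sub_eq_zero.1
  have hv := hγ.circleVelocity_mem x
  rw [map_sub, sub_eq_zero, h.bivector.skew, momentum, LinearMap.comp_apply]
  exact h.skew _ _ hv _ _

theorem chartDeriv_hamField_twistOp (h : IsTwist D om M B) (hγ : IsLoop D γ)
    (he : IsCoordinates e) (hx : γ x ∈ e.source) (k : Fin N) :
    chartDeriv e (γ x) (hamField (twistOp om B) ξ γ x) k =
      ∑ c, bivectorComp om e (e (γ x)) k c * momentumCoord B e ξ γ x c := by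
  rw [hamField_twistOp h hγ, chartDeriv_bivector he hx]
  rfl

theorem IsTwist.differentiableAt_bivector (h : IsTwist D om M B) (hD : IsOpen D)
    (he : IsCoordinates e) {z : Euc N × Euc N} (hz : z ∈ coordDomain D e) (i j : Fin N) :
    DifferentiableAt ℝ (fun z : Euc N × Euc N => bivectorComp om e z.1 i j) z :=
  ((h.contDiffOn_bivector he i j).contDiffAt ((isOpen_coordDomain he hD).mem_nhds hz)
    ).differentiableAt (by simp)

theorem hasDerivAt_chartDeriv_hamField (h : IsTwist D om M B) (hD : IsOpen D)
    (hI : HasVariationalDerivative D I ξ) (hγ : IsLoop D γ)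
    (he : IsCoordinates e) (hx : γ x ∈ e.source) (k : Fin N) :
    HasDerivAt (fun y : ℝ => chartDeriv e (γ y) (hamField (twistOp om B) ξ γ y) k)
      (∑ c, (totalDeriv (fun y _ => bivectorComp om e y k c) (e (γ x)) (velocityCoord e γ x)
          (deriv (fun y : ℝ => velocityCoord e γ y) x) * momentumCoord B e ξ γ x c +
        bivectorComp om e (e (γ x)) k c *
          deriv (fun y : ℝ => momentumCoord B e ξ γ y c) x)) x := by
  have h1 := HasDerivAt.fun_sum (u := Finset.univ) fun c (_ : c ∈ Finset.univ) =>
    (hasDerivAt_totalDeriv (F := fun y _ => bivectorComp om e y k c)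
      (h.differentiableAt_bivector hD he (hγ.velocityCoord_mem he hx) k c)
      (hγ.hasDerivAt_coord he hx) (hγ.hasDerivAt_velocityCoord he hx)).mul
    (hasDerivAt_momentumCoord h hI hγ he hx c)
  refine h1.congr_of_eventuallyEq ?_
  filter_upwards [hγ.eventually_mem hx] with y hy
  exact chartDeriv_hamField_twistOp h hγ he hy k

/-- With `α`, `β`, `κ` the momenta of `ξ`, `η`, `ζ`, one substitutes `ξ = αM`, `η = βM` and the
field `ωκ`; the derivative of `A` is then eliminated by `IsTwist.sum_fderiv_op`. -/
theorem jacobiTerm_twistOp (h : IsTwist D om M B) (hD : IsOpen D)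
    (hK : HasVariationalDerivative D K ζ) (hγ : IsLoop D γ)
    (he : IsCoordinates e) (hx : γ x ∈ e.source) :
    jacobiTerm (twistOp om B) e ξ η ζ γ x =
      momentumForm (bivectorComp om e) (endoComp M e) (e (γ x)) (velocityCoord e γ x)
        (momentumCoord B e ξ γ x) (momentumCoord B e η γ x)
        (fun k => ∑ c, bivectorComp om e (e (γ x)) k c * momentumCoord B e ζ γ x c)
        (fun k => ∑ c, (totalDeriv (fun y _ => bivectorComp om e y k c) (e (γ x))
          (velocityCoord e γ x)
          (deriv (fun y : ℝ => velocityCoord e γ y) x) * momentumCoord B e ζ γ x c +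
          bivectorComp om e (e (γ x)) k c *
          deriv (fun y : ℝ => momentumCoord B e ζ γ y c) x)) := by
  set Z := chartDeriv e (γ x) (hamField (twistOp om B) ζ γ x) with hZ
  have hW : HasDerivAt (fun y : ℝ => chartDeriv e (γ y) (hamField (twistOp om B) ζ γ y))
      (WithLp.toLp 2 fun k => ∑ c, (totalDeriv (fun y _ => bivectorComp om e y k c) (e (γ x))
          (velocityCoord e γ x)
          (deriv (fun y : ℝ => velocityCoord e γ y) x) * momentumCoord B e ζ γ x c +
          bivectorComp om e (e (γ x)) k c *
          deriv (fun y : ℝ => momentumCoord B e ζ γ y c) x)) x :=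
    hasDerivAt_of_coord fun k => hasDerivAt_chartDeriv_hamField h hD hK hγ he hx k
  have h1 := h.sum_fderiv_op hD he (hγ.velocityCoord_mem he hx) (momentumCoord B e ξ γ x)
    (momentumCoord B e η γ x) Z (WithLp.toLp 2 fun k =>
      ∑ c, (totalDeriv (fun y _ => bivectorComp om e y k c) (e (γ x))
          (velocityCoord e γ x)
          (deriv (fun y : ℝ => velocityCoord e γ y) x) * momentumCoord B e ζ γ x c +
          bivectorComp om e (e (γ x)) k c *
          deriv (fun y : ℝ => momentumCoord B e ζ γ y c) x))
  have h2 : (Z : Fin N → ℝ) = fun k =>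
      ∑ c, bivectorComp om e (e (γ x)) k c * momentumCoord B e ζ γ x c := by
    funext k
    exact chartDeriv_hamField_twistOp h hγ he hx k
  rw [h2] at h1
  refine Eq.trans ?_ h1
  unfold jacobiTerm
  rw [hW.deriv, ← hZ]
  generalize WithLp.toLp 2 (fun k => ∑ c, (totalDeriv (fun y _ => bivectorComp om e y k c)
    (e (γ x)) (velocityCoord e γ x) (deriv (fun y : ℝ => velocityCoord e γ y) x) *
    momentumCoord B e ζ γ x c + bivectorComp om e (e (γ x)) k c *
    deriv (fun y : ℝ => momentumCoord B e ζ γ y c) x)) = W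
  simp only [opDerivSum, ← covector_coordFrame_eq h hγ he hx, Finset.sum_mul,
    ← Finset.sum_add_distrib]
  rw [sum_comm_three]
  refine Finset.sum_congr rfl fun i _ => Finset.sum_congr rfl fun j _ => ?_
  rw [show (Z, W) = (Z, 0) + (0, W) by simp, map_add, clm_fst_eq_sum, clm_snd_eq_sum,
    ← Finset.sum_add_distrib, Finset.mul_sum]
  refine Finset.sum_congr rfl fun k _ => ?_
  simp only [velocityCoord]
  ring

end Momentum

/-! ### The relations imply the Jacobi identity -/

section Sufficiency

variable {N : ℕ} {X : Type*} [TopologicalSpace X] [ChartedSpace (Euc N) X]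

/-- The primitive of the density of the Jacobi identity. -/
def jacobiPrimitive
    (om : (p : X) → Module.Dual ℝ (TangentSpace (𝓡 N) p) →ₗ[ℝ] TangentSpace (𝓡 N) p)
    (M B : (p : X) → TangentSpace (𝓡 N) p → Module.End ℝ (TangentSpace (𝓡 N) p))
    (ξ η ζ : CovectorField N X) (γ : UnitAddCircle → X) (x : UnitAddCircle) : ℝ :=
  deriv (fun ε : ℝ => momentum B η γ x (M (γ x) (circleVelocity γ x + ε •
    om (γ x) (momentum B ζ γ x)) (om (γ x) (momentum B ξ γ x)))) 0

variable [IsManifold (𝓡 N) ∞ X] {e : OpenPartialHomeomorph X (Euc N)}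
  {D : Set (TangentBundle (𝓡 N) X)} {I J K : (UnitAddCircle → X) → ℝ} {ξ η ζ : CovectorField N X}
  {om : (p : X) → Module.Dual ℝ (TangentSpace (𝓡 N) p) →ₗ[ℝ] TangentSpace (𝓡 N) p}
  {M B : (p : X) → TangentSpace (𝓡 N) p → Module.End ℝ (TangentSpace (𝓡 N) p)}
  {γ : UnitAddCircle → X} {x : ℝ}

/-- Identifies the coordinate-free primitive with the local one. The fibre derivative of `M` in the
direction `ωκ` is intrinsic, because it is taken inside one tangent space. -/
theorem jacobiPrimitive_chart (h : IsTwist D om M B) (hD : IsOpen D) (hγ : IsLoop D γ)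
    (he : IsCoordinates e) (hx : γ x ∈ e.source) :
    jacobiPrimitive om M B ξ η ζ γ x = ∑ a, ∑ b, ∑ c,
      momentumCoord B e ξ γ x a * momentumCoord B e η γ x b * momentumCoord B e ζ γ x c *
        boundaryTensor (bivectorComp om e) (endoComp M e) (e (γ x), velocityCoord e γ x) b a c := by
  set α := momentumCoord B e ξ γ x
  set β := momentumCoord B e η γ x
  set κ := momentumCoord B e ζ γ x
  set u := e (γ x)
  set v := velocityCoord e γ x
  set Z := chartDeriv e (γ x) (om (γ x) (momentum B ζ γ x)) with hZ
  have hZk : ∀ k, Z k = ∑ c, bivectorComp om e u k c * κ c := fun k =>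
    chartDeriv_bivector he hx om _ k
  have hYk : ∀ i, chartDeriv e (γ x) (om (γ x) (momentum B ξ γ x)) i =
      ∑ a, bivectorComp om e u i a * α a := fun i => chartDeriv_bivector he hx om _ i
  have h1 : (fun ε : ℝ => momentum B η γ x (M (γ x) (circleVelocity γ x + ε •
      om (γ x) (momentum B ζ γ x)) (om (γ x) (momentum B ξ γ x)))) = fun ε : ℝ =>
      ∑ b, β b * ∑ i, endoComp M e u (v + ε • Z) b i * ∑ a, bivectorComp om e u i a * α a := by
    funext ε
    rw [covector_apply he hx]
    refine Finset.sum_congr rfl fun b _ => ?_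
    rw [chartDeriv_endo he hx, map_add, map_smul]
    simp only [hYk]
    rfl
  have h2 : ∀ b i, HasDerivAt (fun ε : ℝ => endoComp M e u (v + ε • Z) b i)
      (∑ k, Z k * pderiv k (fun y => endoComp M e u y b i) v) 0 := by
    intro b i
    have hd : DifferentiableAt ℝ (fun z : Euc N × Euc N => endoComp M e z.1 z.2 b i) (u, v) :=
      ((h.smooth e he b i).contDiffAt ((isOpen_coordDomain he hD).mem_nhds
        (hγ.velocityCoord_mem he hx))).differentiableAt (by simp)
    have h3 : HasDerivAt (fun ε : ℝ => (u, v + ε • Z)) ((0 : Euc N), Z) 0 := by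
      have := ((hasDerivAt_id (0 : ℝ)).smul_const Z).const_add v
      exact (hasDerivAt_const (0 : ℝ) u).prodMk (by simpa using this)
    have h4 := HasFDerivAt.comp_hasDerivAt (l := fun z : Euc N × Euc N => endoComp M e z.1 z.2 b i)
      (f := fun ε : ℝ => (u, v + ε • Z)) 0
      (l' := fderiv ℝ (fun z : Euc N × Euc N => endoComp M e z.1 z.2 b i) (u, v))
      (by simpa using hd.hasFDerivAt) h3
    refine h4.congr_deriv ?_
    rw [fderiv_eq_sum_pderiv (F := fun y y' => endoComp M e y y' b i) hd]
    simp
  have h3 := HasDerivAt.fun_sum (u := Finset.univ) fun b (_ : b ∈ Finset.univ) =>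
    (HasDerivAt.fun_sum (u := Finset.univ) fun i (_ : i ∈ Finset.univ) =>
      (h2 b i).mul_const (∑ a, bivectorComp om e u i a * α a)).const_mul (β b)
  rw [jacobiPrimitive, h1, h3.deriv]
  have h4 : ∀ b, β b * ∑ i, (∑ k, Z k * pderiv k (fun y => endoComp M e u y b i) v) *
      ∑ a, bivectorComp om e u i a * α a = ∑ a, ∑ c, α a * β b * κ c *
        boundaryTensor (bivectorComp om e) (endoComp M e) (u, v) b a c := by
    intro b
    unfold boundaryTensor
    simp only [hZk, Finset.mul_sum, Finset.sum_mul]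
    rw [Finset.sum_comm]
    refine Finset.sum_congr rfl fun a _ => ?_
    rw [sum_comm_three, Finset.sum_comm]
    exact Finset.sum_congr rfl fun c _ => Finset.sum_congr rfl fun k _ =>
      Finset.sum_congr rfl fun i _ => by ring
  simp only [h4]
  exact Finset.sum_comm

theorem hasDerivAt_jacobiPrimitive (h : IsTwist D om M B) (hD : IsOpen D)
    (hI : HasVariationalDerivative D I ξ) (hJ : HasVariationalDerivative D J η)
    (hK : HasVariationalDerivative D K ζ) (hγ : IsLoop D γ)
    (he : IsCoordinates e) (hx : γ x ∈ e.source)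
    (h1 : Relation1 (bivectorComp om e) (endoComp M e) (e (γ x)) (velocityCoord e γ x))
    (h2 : Relation2 (bivectorComp om e) (endoComp M e) (e (γ x)) (velocityCoord e γ x)
      (deriv (fun y : ℝ => velocityCoord e γ y) x)) :
    HasDerivAt (fun y : ℝ => jacobiPrimitive om M B ξ η ζ γ y)
      (jacobiTerm (twistOp om B) e ξ η ζ γ x + jacobiTerm (twistOp om B) e η ζ ξ γ x +
        jacobiTerm (twistOp om B) e ζ ξ η γ x) x := by
  rw [jacobiTerm_twistOp h hD hK hγ he hx, jacobiTerm_twistOp h hD hI hγ he hx,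
    jacobiTerm_twistOp h hD hJ hγ he hx]
  have h3 := hasDerivAt_boundary_sum (isOpen_coordDomain he hD)
    (fun i j => h.contDiffOn_bivector he i j) (fun i j => h.smooth e he i j)
    (u := fun y : ℝ => e (γ y)) (v := fun y : ℝ => velocityCoord e γ y)
    (hγ.velocityCoord_mem he hx) (hγ.hasDerivAt_coord he hx) (hγ.hasDerivAt_velocityCoord he hx)
    (hasDerivAt_momentumCoord h hI hγ he hx) (hasDerivAt_momentumCoord h hJ hγ he hx)
    (hasDerivAt_momentumCoord h hK hγ he hx) h1 h2
  refine h3.congr_of_eventuallyEq ?_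
  filter_upwards [hγ.eventually_mem hx] with y hy
  exact jacobiPrimitive_chart h hD hγ he hy

/-- The density has the primitive `jacobiPrimitive` on the whole circle. Since neither depends on
coordinates, the derivative can be checked at each point in any chart of `C` containing it, so a
covering family of charts suffices. -/
theorem givesPoissonBracket_of_relations [T2Space X] (h : IsTwist D om M B) (hD : IsOpen D)
    (C : Set (OpenPartialHomeomorph X (Euc N))) (hC : ∀ e ∈ C, IsCoordinates e)
    (hcov : ∀ p : X, ∃ e ∈ C, p ∈ e.source)
    (hr : ∀ e ∈ C, ∀ u v w : Euc N, (u, v) ∈ coordDomain D e →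
      Relation1 (bivectorComp om e) (endoComp M e) u v ∧
        Relation2 (bivectorComp om e) (endoComp M e) u v w) :
    GivesPoissonBracket D (twistOp om B) where
  closed I J dI dJ hI hJ := ⟨_, hasVariationalDerivative_dBracket hD h.isSkewOperator hI hJ⟩
  skew I J dI dJ _ _ γ hγ := loopBracket_skew h.isSkewOperator dI dJ hγ
  jacobi I J K dI dJ dK dIJ dJK dKI hI hJ hK hIJ hJK hKI γ hγ := by
    obtain ⟨T, hTc, hT, hinteg⟩ := exists_jacobi_density hD h.isSkewOperator hI hJ hK hγ
    rw [hinteg dIJ dJK dKI hIJ hJK hKI]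
    have h1 : ∀ x : ℝ, HasDerivAt (fun y : ℝ => jacobiPrimitive om M B dI dJ dK γ y) (T x) x := by
      intro x
      obtain ⟨e, heC, hx⟩ := hcov (γ x)
      have he := hC e heC
      have h2 := hr e heC _ _ (deriv (fun y : ℝ => velocityCoord e γ y) x)
        (hγ.velocityCoord_mem he hx)
      rw [hT x e he hx]
      exact hasDerivAt_jacobiPrimitive h hD hI hJ hK hγ he hx h2.1 h2.2
    rw [intervalIntegral.integral_eq_sub_of_hasDerivAt (fun x _ => h1 x)
      (hTc.intervalIntegrable _ _)]
    have h3 : ((1 : ℝ) : UnitAddCircle) = ((0 : ℝ) : UnitAddCircle) := by simp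
    rw [h3, sub_self]

end Sufficiency

/-! ### The Jacobi identity implies the relations along a closed curve -/

section Necessity

variable {N : ℕ} {om : Euc N → Fin N → Fin N → ℝ} {M : Euc N → Euc N → Fin N → Fin N → ℝ}
  {S : Set (Euc N × Euc N)} {u v w : ℝ → Euc N}

/-- A smooth closed curve in coordinates, with its first two derivatives. -/
structure IsClosedCurve (S : Set (Euc N × Euc N)) (u v w : ℝ → Euc N) : Prop where
  smooth : ContDiff ℝ ∞ u
  smooth_fst : ContDiff ℝ ∞ v
  smooth_snd : ContDiff ℝ ∞ w
  deriv_fst : ∀ x, HasDerivAt u (v x) x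
  deriv_snd : ∀ x, HasDerivAt v (w x) x
  periodic : Function.Periodic u 1
  periodic_fst : Function.Periodic v 1
  periodic_snd : Function.Periodic w 1
  mem : ∀ x, (u x, v x) ∈ S

theorem IsClosedCurve.contDiff_comp (h : IsClosedCurve S u v w) {F : Type*} [NormedAddCommGroup F]
    [NormedSpace ℝ F] {G : Euc N × Euc N → F} (hG : ContDiffOn ℝ ∞ G S) :
    ContDiff ℝ ∞ fun x => G (u x, v x) := by
  rw [← contDiffOn_univ]
  exact hG.comp ((h.smooth.prodMk h.smooth_fst).contDiffOn) fun x _ => h.mem x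

theorem IsClosedCurve.contDiff_pderiv_fst (h : IsClosedCurve S u v w) (hS : IsOpen S)
    {F : Euc N → Euc N → ℝ} (hF : ContDiffOn ℝ ∞ (fun z : Euc N × Euc N => F z.1 z.2) S)
    (k : Fin N) : ContDiff ℝ ∞ fun x => pderiv k (fun y => F y (v x)) (u x) := by
  have h1 : ∀ x, pderiv k (fun y => F y (v x)) (u x) =
      fderiv ℝ (fun z : Euc N × Euc N => F z.1 z.2) (u x, v x) (EuclideanSpace.single k 1, 0) :=
    fun x => pderiv_fst_eq ((hF.contDiffAt (hS.mem_nhds (h.mem x))).differentiableAt (by simp)) k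
  simp only [h1]
  exact (h.contDiff_comp (hF.fderiv_of_isOpen (m := ∞) hS (by simp))).clm_apply contDiff_const

theorem IsClosedCurve.contDiff_pderiv_snd (h : IsClosedCurve S u v w) (hS : IsOpen S)
    {F : Euc N → Euc N → ℝ} (hF : ContDiffOn ℝ ∞ (fun z : Euc N × Euc N => F z.1 z.2) S)
    (k : Fin N) : ContDiff ℝ ∞ fun x => pderiv k (fun y => F (u x) y) (v x) := by
  have h1 : ∀ x, pderiv k (fun y => F (u x) y) (v x) =
      fderiv ℝ (fun z : Euc N × Euc N => F z.1 z.2) (u x, v x) (0, EuclideanSpace.single k 1) :=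
    fun x => pderiv_snd_eq ((hF.contDiffAt (hS.mem_nhds (h.mem x))).differentiableAt (by simp)) k
  simp only [h1]
  exact (h.contDiff_comp (hF.fderiv_of_isOpen (m := ∞) hS (by simp))).clm_apply contDiff_const

theorem contDiff_of_hasDerivAt {f f' : ℝ → ℝ} (hf : ContDiff ℝ ∞ f)
    (h : ∀ x, HasDerivAt f (f' x) x) : ContDiff ℝ ∞ f' := by
  have : f' = deriv f := funext fun x => (h x).deriv.symm
  rw [this]
  exact (contDiff_infty_iff_deriv.1 hf).2

theorem IsClosedCurve.contDiff_boundaryTensor (h : IsClosedCurve S u v w) (hS : IsOpen S)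
    (hO : ∀ i j, ContDiffOn ℝ ∞ (fun z : Euc N × Euc N => om z.1 i j) S)
    (hM : ∀ i j, ContDiffOn ℝ ∞ (fun z : Euc N × Euc N => M z.1 z.2 i j) S) (b a c : Fin N) :
    ContDiff ℝ ∞ fun x => boundaryTensor om M (u x, v x) b a c := by
  unfold boundaryTensor
  exact ContDiff.sum fun k _ => ContDiff.sum fun i _ => (h.contDiff_comp (hO k c)).mul
    ((h.contDiff_pderiv_snd hS (F := fun y z => M y z b i) (hM b i) k).mul (h.contDiff_comp (hO i a)))

/-- Terms containing total derivatives are smooth because, along the curve, they are `x`-derivatives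
of smooth functions. The others are partial derivatives composed with the curve. -/
theorem IsClosedCurve.contDiff_secondRelation (h : IsClosedCurve S u v w) (hS : IsOpen S)
    (hO : ∀ i j, ContDiffOn ℝ ∞ (fun z : Euc N × Euc N => om z.1 i j) S)
    (hM : ∀ i j, ContDiffOn ℝ ∞ (fun z : Euc N × Euc N => M z.1 z.2 i j) S) (a b c : Fin N) :
    ContDiff ℝ ∞ fun x => secondRelation om M (u x) (v x) (w x) c a b := by
  have h1 : ∀ b a c, ContDiff ℝ ∞ fun x => boundaryTensorDeriv om M (u x) (v x) (w x) b a c :=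
    fun b a c => contDiff_of_hasDerivAt (h.contDiff_boundaryTensor hS hO hM b a c) fun x =>
      hasDerivAt_boundaryTensor hS hO hM (h.mem x) (h.deriv_fst x) (h.deriv_snd x) b a c
  have h2 : ∀ r c, ContDiff ℝ ∞ fun x => totalDeriv (fun y _ => om y r c) (u x) (v x) (w x) :=
    fun r c => contDiff_of_hasDerivAt (f := fun x => om (u x) r c) (h.contDiff_comp (hO r c))
      fun x => hasDerivAt_totalDeriv (F := fun y _ => om y r c)
        (((hO r c).contDiffAt (hS.mem_nhds (h.mem x))).differentiableAt (by simp))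
        (h.deriv_fst x) (h.deriv_snd x)
  have h3 : ∀ a b c, ContDiff ℝ ∞ fun x => jacobiCoeff om M (u x) (v x) (w x) a b c := by
    intro a b c
    unfold jacobiCoeff
    refine ContDiff.sum fun i _ => ContDiff.sum fun r _ => ?_
    have o : ∀ i j, ContDiff ℝ ∞ fun x => om (u x) i j := fun i j => h.contDiff_comp (hO i j)
    exact ((((o r c).mul (h.contDiff_pderiv_fst hS (F := fun y _ => om y i b) (hO i b) r)).mul
      (h.contDiff_comp (hM a i))).add (((o i a).mul (o r c)).mul
      (h.contDiff_pderiv_fst hS (F := fun y z => M y z b i) (hM b i) r))).add (((o i a).mul (h2 r c)).mul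
      (h.contDiff_pderiv_snd hS (F := fun y z => M y z b i) (hM b i) r))
  simp only [secondRelation_eq]
  exact (((h3 a b c).add (h3 b c a)).add (h3 c a b)).sub (h1 b a c)

/-- The integrand of the Jacobi identity for covectors `α`, `β`, `κ`, with derivatives `α'`, `β'`,
`κ'`. -/
def jacobiForm (om : Euc N → Fin N → Fin N → ℝ) (M : Euc N → Euc N → Fin N → Fin N → ℝ)
    (u v w : Euc N) (α β κ α' β' κ' : Fin N → ℝ) : ℝ :=
  momentumForm om M u v α β (fun k => ∑ c, om u k c * κ c)
      (fun k => ∑ c, (totalDeriv (fun y _ => om y k c) u v w * κ c + om u k c * κ' c)) +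
    momentumForm om M u v β κ (fun k => ∑ c, om u k c * α c)
      (fun k => ∑ c, (totalDeriv (fun y _ => om y k c) u v w * α c + om u k c * α' c)) +
    momentumForm om M u v κ α (fun k => ∑ c, om u k c * β c)
      (fun k => ∑ c, (totalDeriv (fun y _ => om y k c) u v w * β c + om u k c * β' c))

/-- Test covectors with one component each pick out a single triple of indices. -/
theorem jacobiForm_single (u v w : Euc N) (a b c : Fin N) (f g h f' g' h' : ℝ) :
    jacobiForm om M u v w (Pi.single a f) (Pi.single b g) (Pi.single c h) (Pi.single a f')
      (Pi.single b g') (Pi.single c h') =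
      f * g * h' * boundaryTensor om M (u, v) b a c +
      f' * g * h * boundaryTensor om M (u, v) c b a +
      f * g' * h * boundaryTensor om M (u, v) a c b +
      f * g * h * (secondRelation om M u v w c a b + boundaryTensorDeriv om M u v w b a c) := by
  rw [jacobiForm, momentumForm_cyclic, Finset.sum_eq_single a, Finset.sum_eq_single b,
    Finset.sum_eq_single c]
  · simp
  · intro k _ hk
    simp [hk]
  · simp
  · intro k _ hk
    simp [hk]
  · simp
  · intro k _ hk
    simp [hk]
  · simp

theorem periodic_deriv {f f' : ℝ → ℝ} (hf : Function.Periodic f 1)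
    (h : ∀ x, HasDerivAt f (f' x) x) : Function.Periodic f' 1 := fun x => by
  have h1 := (h (x + 1)).comp_add_const x 1
  exact (h1.congr_of_eventuallyEq (Eventually.of_forall fun y => (hf y).symm)).unique (h x)

theorem integral_deriv_eq_zero {f f' : ℝ → ℝ} (hf : Function.Periodic f 1)
    (h : ∀ x, HasDerivAt f (f' x) x) (hc : Continuous f') : ∫ x in (0 : ℝ)..1, f' x = 0 := by
  rw [intervalIntegral.integral_eq_sub_of_hasDerivAt (fun x _ => h x) (hc.intervalIntegrable _ _),
    sub_eq_zero]
  simpa using hf 0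

/-- The Jacobi identity along a closed curve, localised by integration by parts. -/
theorem IsClosedCurve.factor_eq_zero (h : IsClosedCurve S u v w) (hS : IsOpen S)
    (hO : ∀ i j, ContDiffOn ℝ ∞ (fun z : Euc N × Euc N => om z.1 i j) S)
    (hM : ∀ i j, ContDiffOn ℝ ∞ (fun z : Euc N × Euc N => M z.1 z.2 i j) S)
    (hJ : ∀ α β κ α' β' κ' : ℝ → Fin N → ℝ,
      (∀ a, ContDiff ℝ ∞ fun x => α x a) → (∀ a, ContDiff ℝ ∞ fun x => β x a) →
      (∀ a, ContDiff ℝ ∞ fun x => κ x a) → Function.Periodic α 1 → Function.Periodic β 1 →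
      Function.Periodic κ 1 → (∀ x a, HasDerivAt (fun y => α y a) (α' x a) x) →
      (∀ x a, HasDerivAt (fun y => β y a) (β' x a) x) →
      (∀ x a, HasDerivAt (fun y => κ y a) (κ' x a) x) →
      ∫ x in (0 : ℝ)..1, jacobiForm om M (u x) (v x) (w x) (α x) (β x) (κ x) (α' x) (β' x) (κ' x)
        = 0)
    (a b c : Fin N) {f g f' g' : ℝ → ℝ} (hf : ContDiff ℝ ∞ f) (hg : ContDiff ℝ ∞ g)
    (pf : Function.Periodic f 1) (pg : Function.Periodic g 1) (df : ∀ x, HasDerivAt f (f' x) x)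
    (dg : ∀ x, HasDerivAt g (g' x) x) :
    f' 0 * g 0 * (boundaryTensor om M (u 0, v 0) c b a - boundaryTensor om M (u 0, v 0) b a c) +
      f 0 * g' 0 * (boundaryTensor om M (u 0, v 0) a c b - boundaryTensor om M (u 0, v 0) b a c) +
      f 0 * g 0 * secondRelation om M (u 0) (v 0) (w 0) c a b = 0 := by
  set P : Fin N → Fin N → Fin N → ℝ → ℝ := fun b a c x => boundaryTensor om M (u x, v x) b a c
  set P' : ℝ → ℝ := fun x => boundaryTensorDeriv om M (u x) (v x) (w x) b a c
  set R : ℝ → ℝ := fun x => secondRelation om M (u x) (v x) (w x) c a b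
  -- This is what multiplies the third test function after its derivative has been integrated by
  -- parts. It is smooth and periodic, hence admissible as the third test function itself.
  set G : ℝ → ℝ := fun x => f' x * g x * (P c b a x - P b a c x) +
    f x * g' x * (P a c b x - P b a c x) + f x * g x * R x with hG
  have sP : ∀ b a c, ContDiff ℝ ∞ (P b a c) := h.contDiff_boundaryTensor hS hO hM
  have sR : ContDiff ℝ ∞ R := h.contDiff_secondRelation hS hO hM a b c
  have sf' := contDiff_of_hasDerivAt hf df
  have sg' := contDiff_of_hasDerivAt hg dg
  have sG : ContDiff ℝ ∞ G := by
    exact (((sf'.mul hg).mul ((sP c b a).sub (sP b a c))).add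
      ((hf.mul sg').mul ((sP a c b).sub (sP b a c)))).add ((hf.mul hg).mul sR)
  have pP : ∀ b a c, Function.Periodic (P b a c) 1 := fun b a c x => by
    simp only [P, h.periodic x, h.periodic_fst x]
  have pG : Function.Periodic G 1 := fun x => by
    simp only [hG, pP _ _ _ x, pf x, pg x, periodic_deriv pf df x, periodic_deriv pg dg x]
    simp only [R, h.periodic x, h.periodic_fst x, h.periodic_snd x]
  set G' := deriv G
  have dG : ∀ x, HasDerivAt G (G' x) x := fun x =>
    (sG.differentiable (by simp) x).hasDerivAt
  have dP : ∀ x, HasDerivAt (P b a c) (P' x) x := fun x =>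
    hasDerivAt_boundaryTensor hS hO hM (h.mem x) (h.deriv_fst x) (h.deriv_snd x) b a c
  have dsingle : ∀ (a : Fin N) {f f' : ℝ → ℝ}, (∀ x, HasDerivAt f (f' x) x) → ∀ x k,
      HasDerivAt (fun y => (Pi.single a (f y) : Fin N → ℝ) k)
        ((Pi.single a (f' x) : Fin N → ℝ) k) x := by
    intro a f f' hf x k
    by_cases hk : k = a
    · subst hk; simpa using hf x
    · simpa [hk] using hasDerivAt_const x (0 : ℝ)
  have ssingle : ∀ (a : Fin N) {f : ℝ → ℝ}, ContDiff ℝ ∞ f → ∀ k,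
      ContDiff ℝ ∞ fun x => (Pi.single a (f x) : Fin N → ℝ) k := by
    intro a f hf k
    by_cases hk : k = a
    · subst hk; simpa using hf
    · simpa [hk] using contDiff_const
  have psingle : ∀ (a : Fin N) {f : ℝ → ℝ}, Function.Periodic f 1 →
      Function.Periodic (fun x => (Pi.single a (f x) : Fin N → ℝ)) 1 := fun a f hf x => by
    simp only [hf x]
  have h1 := hJ (fun x => Pi.single a (f x)) (fun x => Pi.single b (g x))
    (fun x => Pi.single c (G x)) (fun x => Pi.single a (f' x)) (fun x => Pi.single b (g' x))
    (fun x => Pi.single c (G' x)) (ssingle a hf) (ssingle b hg) (ssingle c sG) (psingle a pf)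
    (psingle b pg) (psingle c pG) (dsingle a df) (dsingle b dg) (dsingle c dG)
  have d1 : ∀ x, HasDerivAt (fun x => f x * g x * G x * P b a c x)
      (((f' x * g x + f x * g' x) * G x + f x * g x * G' x) * P b a c x +
        f x * g x * G x * P' x) x := fun x => (((df x).mul (dg x)).mul (dG x)).mul (dP x)
  have s1 : ContDiff ℝ ∞ fun x => f x * g x * G x * P b a c x :=
    ((hf.mul hg).mul sG).mul (sP b a c)
  have c1 := (contDiff_of_hasDerivAt s1 d1).continuous
  have h2 := integral_deriv_eq_zero (fun x => by simp only [pf x, pg x, pG x, pP b a c x]) d1 c1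
  -- The Jacobi integrand for the test functions `f`, `g`, `G` is `G²` plus the derivative of `f g G
  -- P^{bac}`.
  have h3 : ∫ x in (0 : ℝ)..1, G x * G x = 0 := by
    have c2 : Continuous fun x => G x * G x := sG.continuous.mul sG.continuous
    have h4 := intervalIntegral.integral_add (μ := MeasureTheory.volume)
      (c2.intervalIntegrable 0 1) (c1.intervalIntegrable 0 1)
    rw [h2, add_zero] at h4
    rw [← h4]
    refine Eq.trans ?_ h1
    apply intervalIntegral.integral_congr
    intro x _
    simp only [jacobiForm_single]
    simp only [hG, P, P', R]
    ring
  have h5 := eq_zero_of_integral_sq (sG.continuous.mul sG.continuous)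
    (fun x => mul_self_nonneg (G x)) h3 (x := 0) (by simp)
  exact mul_self_eq_zero.1 h5

/-- With `g = 1`, a function `f` with `f(0) = 0` and `f'(0) = 1` isolates the cyclic invariance of
`boundaryTensor` at time `0`; constant `f = g = 1` isolates (r2). -/
theorem IsClosedCurve.relations (h : IsClosedCurve S u v w) (hS : IsOpen S)
    (hO : ∀ i j, ContDiffOn ℝ ∞ (fun z : Euc N × Euc N => om z.1 i j) S)
    (hM : ∀ i j, ContDiffOn ℝ ∞ (fun z : Euc N × Euc N => M z.1 z.2 i j) S)
    (hJ : ∀ α β κ α' β' κ' : ℝ → Fin N → ℝ,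
      (∀ a, ContDiff ℝ ∞ fun x => α x a) → (∀ a, ContDiff ℝ ∞ fun x => β x a) →
      (∀ a, ContDiff ℝ ∞ fun x => κ x a) → Function.Periodic α 1 → Function.Periodic β 1 →
      Function.Periodic κ 1 → (∀ x a, HasDerivAt (fun y => α y a) (α' x a) x) →
      (∀ x a, HasDerivAt (fun y => β y a) (β' x a) x) →
      (∀ x a, HasDerivAt (fun y => κ y a) (κ' x a) x) →
      ∫ x in (0 : ℝ)..1, jacobiForm om M (u x) (v x) (w x) (α x) (β x) (κ x) (α' x) (β' x) (κ' x)
        = 0) :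
    Relation1 om M (u 0) (v 0) ∧ Relation2 om M (u 0) (v 0) (w 0) := by
  have p1 : Function.Periodic (fun _ : ℝ => (1 : ℝ)) 1 := fun _ => rfl
  constructor
  · refine relation1_iff.2 fun a b c => ?_
    have d : ∀ x : ℝ, HasDerivAt (fun x => Real.sin (2 * Real.pi * x) / (2 * Real.pi))
        (Real.cos (2 * Real.pi * x)) x := fun x => by
      have h1 := (((hasDerivAt_id (𝕜 := ℝ) x).const_mul (2 * Real.pi)).sin).div_const (2 * Real.pi)
      refine h1.congr_deriv ?_
      have := Real.pi_ne_zero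
      simp only [id, mul_one]
      field_simp
    have p : Function.Periodic (fun x => Real.sin (2 * Real.pi * x) / (2 * Real.pi)) 1 :=
      fun x => by simp only [mul_add, mul_one, Real.sin_add_two_pi]
    have h1 := h.factor_eq_zero hS hO hM hJ a b c
      (f := fun x => Real.sin (2 * Real.pi * x) / (2 * Real.pi)) (g := fun _ => 1) (by fun_prop)
      contDiff_const p p1 d (fun x => hasDerivAt_const x (1 : ℝ))
    simp at h1
    linarith
  · refine relation2_iff.2 fun c a b => ?_
    have h1 := h.factor_eq_zero hS hO hM hJ a b c (f := fun _ => 1) (g := fun _ => 1)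
      contDiff_const contDiff_const p1 p1 (fun x => hasDerivAt_const x (1 : ℝ))
      (fun x => hasDerivAt_const x (1 : ℝ))
    simpa using h1

end Necessity

/-! ### Closed curves with prescribed position, velocity and acceleration -/

section Curves

/-- The derivative of a periodic function has mean zero, so `f'` cannot stay in `[0, 1]`. A sharp
peak at `0` balanced by slightly negative values elsewhere keeps it within `δ` of that interval. The
profile `f'` is even, so its derivative vanishes at `0` and the acceleration remains free to be
prescribed. -/
theorem exists_periodic_profile {δ : ℝ} (hδ : 0 < δ) : ∃ f f' : ℝ → ℝ, ContDiff ℝ ∞ f ∧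
    (∀ x, HasDerivAt f (f' x) x) ∧ Function.Periodic f 1 ∧ f 0 = 0 ∧ f' 0 = 1 ∧
    HasDerivAt f' 0 0 ∧ ∀ x, |f x| ≤ δ ∧ -δ ≤ f' x ∧ f' x ≤ 1 := by
  -- Closeness of `r` to `1` controls both `|f| ≤ (1 - r) / (4r)` and the minimum `-(1 - r) / (1 +
  -- r)` of `f'`; the bound `r ≥ 1/2` keeps `1 / r` under control.
  obtain ⟨r, hr, hr1, hrδ⟩ : ∃ r : ℝ, 1 / 2 ≤ r ∧ r < 1 ∧ 1 - r ≤ δ := by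
    refine ⟨max (1 / 2) (1 - δ), le_max_left _ _, max_lt (by norm_num) (by linarith), ?_⟩
    have := le_max_right (1 / 2) (1 - δ)
    linarith
  have hr0 : 0 < r := by linarith
  have hpi := Real.pi_pos
  have hc : ∀ c : ℝ, c ≤ 1 → 0 < 1 - 2 * r * c + r ^ 2 := fun c h => by nlinarith
  have hc' : ∀ c : ℝ, c ≤ 1 → 0 < 1 - r * c := fun c h => by nlinarith
  have hcos := fun x => Real.cos_le_one (2 * Real.pi * x)
  -- The arctangent is the argument of `1 / (1 - r e^{2πix})`, that is, the sum of `r^n sin(2πnx) /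
  -- n` over `n ≥ 1`. Its derivative is of Poisson kernel type, and the prefactor normalises `f'(0)`
  -- to `1`.
  refine ⟨fun x => (1 - r) / (r * (2 * Real.pi)) * Real.arctan (r * Real.sin (2 * Real.pi * x) /
      (1 - r * Real.cos (2 * Real.pi * x))),
    fun x => (1 - r) * (Real.cos (2 * Real.pi * x) - r) /
      (1 - 2 * r * Real.cos (2 * Real.pi * x) + r ^ 2), ?_, ?_, ?_, ?_, ?_, ?_, ?_⟩
  · refine contDiff_const.mul (Real.contDiff_arctan.comp (ContDiff.div (by fun_prop) (by fun_prop)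
      fun x => (hc' _ (hcos x)).ne'))
  · intro x
    have h0 : HasDerivAt (fun x : ℝ => 2 * Real.pi * x) (2 * Real.pi) x := by
      simpa using (hasDerivAt_id x).const_mul (2 * Real.pi)
    have h1 := ((h0.sin.const_mul r).div ((h0.cos.const_mul r).const_sub 1)
      (hc' _ (hcos x)).ne').arctan.const_mul ((1 - r) / (r * (2 * Real.pi)))
    refine h1.congr_deriv ?_
    have e1 := (hc' _ (hcos x)).ne'
    have e2 := (hc _ (hcos x)).ne'
    have e3 := Real.sin_sq_add_cos_sq (2 * Real.pi * x)
    simp only [Pi.div_apply]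
    set s := Real.sin (2 * Real.pi * x)
    set c := Real.cos (2 * Real.pi * x)
    have e4 : 1 + (r * s / (1 - r * c)) ^ 2 = (1 - 2 * r * c + r ^ 2) / (1 - r * c) ^ 2 := by
      field_simp
      linear_combination r ^ 2 * e3
    have e5 : r * (c * (2 * Real.pi)) * (1 - r * c) - r * s * -(r * (-s * (2 * Real.pi))) =
        r * (2 * Real.pi) * (c - r) := by
      linear_combination (-2) * r ^ 2 * Real.pi * e3
    rw [e4, e5]
    field_simp
  · intro x
    simp only [mul_add, mul_one, Real.sin_add_two_pi, Real.cos_add_two_pi]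
  · simp
  · simp only [mul_zero, Real.cos_zero, mul_one]
    have := (hc 1 le_rfl).ne'
    rw [mul_one] at this
    rw [div_eq_one_iff_eq this]
    ring
  · have h0 : HasDerivAt (fun x : ℝ => Real.cos (2 * Real.pi * x)) 0 0 := by
      simpa using ((hasDerivAt_id (0 : ℝ)).const_mul (2 * Real.pi)).cos
    have h1 : DifferentiableAt ℝ (fun c : ℝ => (1 - r) * (c - r) / (1 - 2 * r * c + r ^ 2))
        (Real.cos (2 * Real.pi * 0)) :=
      DifferentiableAt.div (by fun_prop) (by fun_prop) (hc _ (hcos 0)).ne'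
    exact (h1.hasDerivAt.comp (0 : ℝ) h0).congr_deriv (mul_zero _)
  · intro x
    have h1 := hc _ (hcos x)
    have h2 := Real.neg_one_le_cos (2 * Real.pi * x)
    have h3 := hcos x
    set c := Real.cos (2 * Real.pi * x)
    refine ⟨?_, ?_, ?_⟩
    · have h4 : 0 ≤ (1 - r) / (r * (2 * Real.pi)) :=
        div_nonneg (by linarith) (mul_nonneg hr0.le (by linarith))
      rw [abs_mul, abs_of_nonneg h4]
      refine (mul_le_mul_of_nonneg_left (abs_lt.2 ⟨Real.neg_pi_div_two_lt_arctan _,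
        Real.arctan_lt_pi_div_two _⟩).le h4).trans ?_
      have h5 : (1 - r) / (r * (2 * Real.pi)) * (Real.pi / 2) = (1 - r) / (4 * r) := by
        field_simp
        ring
      rw [h5, div_le_iff₀ (by linarith)]
      nlinarith
    · rw [le_div_iff₀ h1]
      have h4 : 0 ≤ (c - r) + (1 - 2 * r * c + r ^ 2) := by nlinarith
      nlinarith
    · rw [div_le_one h1]
      nlinarith

/-- A rapid oscillation `(1 - cos νx) / ν²` with `ν` a large multiple of `2π` is small together with
its first derivative but has second derivative `1` at `0`. -/
theorem exists_periodic_bend {δ : ℝ} (hδ : 0 < δ) : ∃ g g' g'' : ℝ → ℝ, ContDiff ℝ ∞ g ∧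
    (∀ x, HasDerivAt g (g' x) x) ∧ (∀ x, HasDerivAt g' (g'' x) x) ∧ Function.Periodic g 1 ∧
    g 0 = 0 ∧ g' 0 = 0 ∧ g'' 0 = 1 ∧ ∀ x, |g x| ≤ δ ∧ |g' x| ≤ δ := by
  obtain ⟨n, hn⟩ := exists_nat_gt (max 1 δ⁻¹)
  have hn1 : (1 : ℝ) < n := (le_max_left _ _).trans_lt hn
  have hn2 : δ⁻¹ < n := (le_max_right _ _).trans_lt hn
  set ν : ℝ := n * (2 * Real.pi) with hν
  have hpi := Real.pi_gt_three
  have hνn : 2 * n ≤ ν := by rw [hν]; nlinarith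
  have hν0 : 0 < ν := by linarith
  have hν' : ν⁻¹ ≤ δ := by
    rw [inv_le_comm₀ hν0 hδ]
    linarith
  have h0 : ∀ x, HasDerivAt (fun x : ℝ => ν * x) ν x := fun x => by
    simpa using (hasDerivAt_id x).const_mul ν
  refine ⟨fun x => (1 - Real.cos (ν * x)) / ν ^ 2, fun x => Real.sin (ν * x) / ν,
    fun x => Real.cos (ν * x), by fun_prop, ?_, ?_, ?_, by simp, by simp, by simp, ?_⟩
  · intro x
    refine (((h0 x).cos.const_sub 1).div_const (ν ^ 2)).congr_deriv ?_
    field_simp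
  · intro x
    refine ((h0 x).sin.div_const ν).congr_deriv ?_
    field_simp
  · intro x
    simp only [mul_add, mul_one]
    rw [hν, Real.cos_add_nat_mul_two_pi]
  · intro x
    constructor
    · rw [abs_div, abs_of_pos (pow_pos hν0 2), div_le_iff₀ (pow_pos hν0 2)]
      have h1 : |1 - Real.cos (ν * x)| ≤ 2 := by
        rw [abs_le]
        constructor <;> linarith [Real.cos_le_one (ν * x), Real.neg_one_le_cos (ν * x)]
      have h2 : 1 ≤ δ * ν := by
        rw [inv_le_iff_one_le_mul₀ hν0] at hν'
        linarith
      nlinarith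
    · rw [abs_div, abs_of_pos hν0, div_le_iff₀ hν0]
      have h2 : 1 ≤ δ * ν := by
        rw [inv_le_iff_one_le_mul₀ hν0] at hν'
        linarith
      exact (Real.abs_sin_le_one _).trans h2

variable {N : ℕ}

/-- The curve is `u₀ + f v₀ + g w₀`, with the profile for the velocity and the bend for the
acceleration. Its position and velocity stay close to the compact segment of pairs `(u₀, t v₀)` with
`t ∈ [0, 1]`, hence in the open set `S`. -/
theorem exists_isClosedCurve {S : Set (Euc N × Euc N)} (hS : IsOpen S) {u₀ v₀ : Euc N}
    (w₀ : Euc N) (hseg : ∀ t ∈ Icc (0 : ℝ) 1, (u₀, t • v₀) ∈ S) :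
    ∃ u v w, IsClosedCurve S u v w ∧ u 0 = u₀ ∧ v 0 = v₀ ∧ w 0 = w₀ := by
  have hK : IsCompact ((fun t : ℝ => (u₀, t • v₀)) '' Icc (0 : ℝ) 1) :=
    isCompact_Icc.image (by fun_prop)
  obtain ⟨ε, hε, hεS⟩ := hK.exists_thickening_subset_open hS (by
    rintro _ ⟨t, ht, rfl⟩
    exact hseg t ht)
  -- Chosen so that `δ‖v₀‖ + δ‖w₀‖ < ε`.
  set δ := ε / (2 * (‖v₀‖ + ‖w₀‖ + 1)) with hδd
  have hpos : 0 < 2 * (‖v₀‖ + ‖w₀‖ + 1) := by positivity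
  have hδ : 0 < δ := div_pos hε hpos
  have hδε : δ * ‖v₀‖ + δ * ‖w₀‖ < ε := by
    have : δ * (2 * (‖v₀‖ + ‖w₀‖ + 1)) = ε := div_mul_cancel₀ _ hpos.ne'
    nlinarith [norm_nonneg v₀, norm_nonneg w₀]
  obtain ⟨f, f', sf, df, pf, f0, f0', df', bf⟩ := exists_periodic_profile hδ
  obtain ⟨g, g', g'', sg, dg, dg', pg, g0, g0', g0'', bg⟩ := exists_periodic_bend hδ
  have sf' := contDiff_of_hasDerivAt sf df
  have sg' := contDiff_of_hasDerivAt sg dg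
  have df'' : ∀ x, HasDerivAt f' (deriv f' x) x := fun x =>
    (sf'.differentiable (by simp) x).hasDerivAt
  have sf'' := contDiff_of_hasDerivAt sf' df''
  have sg'' := contDiff_of_hasDerivAt sg' dg'
  have pf' := periodic_deriv pf df
  have pg' := periodic_deriv pg dg
  refine ⟨fun x => u₀ + (f x • v₀ + g x • w₀), fun x => f' x • v₀ + g' x • w₀,
    fun x => deriv f' x • v₀ + g'' x • w₀, ⟨by fun_prop, by fun_prop, by fun_prop, ?_, ?_, ?_, ?_,
    ?_, ?_⟩, ?_, ?_, ?_⟩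
  · exact fun x => (((df x).smul_const v₀).add ((dg x).smul_const w₀)).const_add u₀
  · exact fun x => ((df'' x).smul_const v₀).add ((dg' x).smul_const w₀)
  · intro x
    simp only [pf x, pg x]
  · intro x
    simp only [pf' x, pg' x]
  · intro x
    simp only [periodic_deriv pf' df'' x, periodic_deriv pg' dg' x]
  · intro x
    apply hεS
    rw [Metric.mem_thickening_iff]
    -- The comparison point on the segment replaces the possibly negative `f' x` by `max (f' x) 0`,
    -- an error of at most `δ`.
    refine ⟨_, mem_image_of_mem _ (x := max (f' x) 0) ⟨le_max_right _ _,
      max_le (bf x).2.2 zero_le_one⟩, ?_⟩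
    have h1 : ‖f x • v₀ + g x • w₀‖ < ε := by
      refine (norm_add_le _ _).trans_lt (lt_of_le_of_lt ?_ hδε)
      rw [norm_smul, norm_smul]
      exact add_le_add (mul_le_mul_of_nonneg_right (bf x).1 (norm_nonneg _))
        (mul_le_mul_of_nonneg_right (bg x).1 (norm_nonneg _))
    have h2 : ‖(f' x - max (f' x) 0) • v₀ + g' x • w₀‖ < ε := by
      refine (norm_add_le _ _).trans_lt (lt_of_le_of_lt ?_ hδε)
      rw [norm_smul, norm_smul]
      refine add_le_add (mul_le_mul_of_nonneg_right ?_ (norm_nonneg _))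
        (mul_le_mul_of_nonneg_right (bg x).2 (norm_nonneg _))
      rw [Real.norm_eq_abs, abs_le]
      rcases le_total (f' x) 0 with h | h
      · rw [max_eq_right h]
        constructor <;> linarith [(bf x).2.1]
      · rw [max_eq_left h]
        constructor <;> linarith
    rw [Prod.dist_eq, max_lt_iff, dist_eq_norm, dist_eq_norm]
    refine ⟨by simpa using h1, ?_⟩
    have h3 : (f' x - max (f' x) 0) • v₀ + g' x • w₀ =
        (f' x • v₀ + g' x • w₀) - max (f' x) 0 • v₀ := by
      rw [sub_smul]
      abel
    rwa [h3] at h2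
  · simp [f0, g0]
  · simp [f0', g0']
  · simp [df'.deriv, g0'']

end Curves

/-! ### Test functionals `∫ a_i(x) h^i(u) dx` -/

section LinearFunctionals

variable {N : ℕ} {X : Type*} [TopologicalSpace X] [ChartedSpace (Euc N) X]

/-- The functional `∫ a_i(x) h^i(u(x)) dx`. -/
def linFunctional (a : Fin N → UnitAddCircle → ℝ) (h : Fin N → X → ℝ) (γ : UnitAddCircle → X) : ℝ :=
  ∫ x in (0 : ℝ)..1, ∑ i, a i x * h i (γ x)

/-- The covector `dh` at a point. -/
def differential (h : X → ℝ) (p : X) : Module.Dual ℝ (TangentSpace (𝓡 N) p) where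
  toFun V := (mfderiv (𝓡 N) 𝓘(ℝ, ℝ) h p V : ℝ)
  map_add' V W := by
    rw [map_add]
    rfl
  map_smul' c V := by
    rw [map_smul]
    rfl

/-- The variational derivative of `∫ a_i(x) h^i(u(x)) dx`. -/
def linDeriv (a : Fin N → UnitAddCircle → ℝ) (h : Fin N → X → ℝ) : CovectorField N X :=
  fun γ x => ∑ i, a i x • differential (h i) (γ x)

variable [IsManifold (𝓡 N) ∞ X] {e : OpenPartialHomeomorph X (Euc N)}
  {D : Set (TangentBundle (𝓡 N) X)} {a : Fin N → UnitAddCircle → ℝ} {h : Fin N → X → ℝ}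

theorem differential_coordVector {f : X → ℝ} (hf : ContMDiff (𝓡 N) 𝓘(ℝ, ℝ) ∞ f)
    (he : IsCoordinates e) {p : X} (hp : p ∈ e.source) (v : Euc N) :
    differential f p (coordVector e p v) = fderiv ℝ (f ∘ e.symm) (e p) v := by
  have h1 : ContDiffAt ℝ ∞ (f ∘ e.symm) (e p) := by
    rw [← contMDiffAt_iff_contDiffAt]
    exact (hf.contMDiffAt).comp _ ((contMDiffOn_symm_of_mem_maximalAtlas he).contMDiffAt
      (e.open_target.mem_nhds (e.map_source hp)))
  have h2 : f =ᶠ[𝓝 p] (f ∘ e.symm) ∘ e := by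
    filter_upwards [e.open_source.mem_nhds hp] with y hy
    simp [e.left_inv hy]
  have h3 := mfderiv_comp (I := 𝓡 N) (I' := 𝓡 N) (I'' := 𝓘(ℝ, ℝ)) p
    (h1.differentiableAt (by simp)).mdifferentiableAt (he.mdifferentiableAt hp)
  change mfderiv (𝓡 N) 𝓘(ℝ, ℝ) f p (coordVector e p v) = _
  rw [h2.mfderiv_eq, h3, mfderiv_eq_fderiv]
  exact congrArg (fderiv ℝ (f ∘ e.symm) (e p)) (chartDeriv_coordVector he hp v)

theorem contDiffOn_comp_symm {f : X → ℝ} (hf : ContMDiff (𝓡 N) 𝓘(ℝ, ℝ) ∞ f)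
    (he : IsCoordinates e) : ContDiffOn ℝ ∞ (f ∘ e.symm) e.target := by
  rw [← contMDiffOn_iff_contDiffOn]
  exact hf.comp_contMDiffOn (contMDiffOn_symm_of_mem_maximalAtlas he)

/-- Differentiation under the integral and the chain rule for `h i`. The explicit dependence of the
coefficients on `x` is what allows the variational derivative to be prescribed along one loop. -/
theorem hasVariationalDerivative_linFunctional (ha : ∀ i, ContDiff ℝ ∞ fun x : ℝ => a i x)
    (hh : ∀ i, ContMDiff (𝓡 N) 𝓘(ℝ, ℝ) ∞ (h i)) :
    HasVariationalDerivative D (linFunctional a h) (linDeriv (N := N) a h) where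
  smooth m U Γ hΓ e he i := by
    have hΓ := hΓ.loopFam
    have h1 : ContDiffOn ℝ ∞ (fun z : EuclideanSpace ℝ (Fin m) × ℝ => ∑ k, a k z.2 *
        fderiv ℝ (h k ∘ e.symm) (famCoord e Γ z) (EuclideanSpace.single i 1))
        (chartDomain U Γ e) := by
      refine ContDiffOn.sum fun k _ => ((ha k).comp contDiff_snd).contDiffOn.mul ?_
      exact (((contDiffOn_comp_symm (hh k) he).fderiv_of_isOpen (m := ∞) e.open_target
        (by simp)).comp (hΓ.famCoord_contDiffOn he)
        fun z hz => e.map_source hz.2).clm_apply contDiffOn_const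
    refine h1.congr fun z hz => ?_
    simp only [linDeriv, LinearMap.sum_apply, LinearMap.smul_apply, smul_eq_mul]
    refine Finset.sum_congr rfl fun k _ => ?_
    rw [coordFrame, differential_coordVector (hh k) he hz.2]
    rfl
  variation m U Γ hΓ q hq b := by
    have hG : ContDiffOn ℝ ∞ (fun z : EuclideanSpace ℝ (Fin m) × ℝ =>
        ∑ i, a i z.2 * h i (Γ z.1 z.2)) (U ×ˢ univ) :=
      ContDiffOn.sum fun k _ => ((ha k).comp contDiff_snd).contDiffOn.mul
        (hΓ.loopFam.contDiffOn_comp_fun (hh k))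
    refine (hasLineDerivAt_integral_strip hΓ.isOpen hG hq b).congr_deriv ?_
    refine intervalIntegral.integral_congr fun x _ => ?_
    have h1 : MDifferentiableAt 𝓘(ℝ, EuclideanSpace ℝ (Fin m)) (𝓡 N) (fun q' => Γ q' x) q := by
      have h2 : MDifferentiableAt 𝓘(ℝ, EuclideanSpace ℝ (Fin m) × ℝ) (𝓡 N)
          (fun z : EuclideanSpace ℝ (Fin m) × ℝ => Γ z.1 z.2) (q, x) :=
        (hΓ.smooth.contMDiffAt ((hΓ.isOpen.prod isOpen_univ).mem_nhds
          ⟨hq, mem_univ _⟩)).mdifferentiableAt (by simp)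
      exact MDifferentiableAt.comp (I' := 𝓘(ℝ, EuclideanSpace ℝ (Fin m) × ℝ))
        (g := fun z : EuclideanSpace ℝ (Fin m) × ℝ => Γ z.1 z.2) (f := fun q' => (q', x)) q h2
        (DifferentiableAt.mdifferentiableAt (by fun_prop))
    have h3 := (((contDiffAt_strip hΓ.isOpen hG (z := (q, x)) hq).differentiableAt
      (by simp)).hasFDerivAt).comp q (f := fun q' => (q', x)) (hasFDerivAt_prodMk_left q x)
    have h4 : ∀ i, HasFDerivAt (fun q' => h i (Γ q' x)) (fderiv ℝ (fun q' => h i (Γ q' x)) q) q := by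
      intro i
      exact (MDifferentiableAt.comp q ((hh i).mdifferentiable (by simp) (Γ q x))
        h1).differentiableAt.hasFDerivAt
    have h5 := HasFDerivAt.fun_sum (u := Finset.univ) fun i (_ : i ∈ Finset.univ) =>
      (h4 i).const_mul (a i x)
    have h6 := congrArg (fun L => L b) (h3.unique h5)
    simp only [linDeriv, LinearMap.sum_apply, LinearMap.smul_apply, smul_eq_mul]
    refine Eq.trans h6 ?_
    simp only [FunLike.coe_sum, Finset.sum_apply, FunLike.coe_smul, Pi.smul_apply, smul_eq_mul]
    refine Finset.sum_congr rfl fun i _ => ?_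
    congr 1
    rw [← mfderiv_eq_fderiv]
    have h7 := mfderiv_comp (I := 𝓘(ℝ, EuclideanSpace ℝ (Fin m))) (I' := 𝓡 N) (I'' := 𝓘(ℝ, ℝ)) q
      ((hh i).mdifferentiable (by simp) (Γ q x)) h1
    exact congrArg (fun L => L b) h7

end LinearFunctionals

/-! ### From periodic curves in a chart to loops in the manifold -/

section CurveLoops

variable {N : ℕ} {X : Type*} [TopologicalSpace X] [ChartedSpace (Euc N) X]

/-- A periodic function as a function on the circle. -/
def circleFun {Y : Type*} (f : ℝ → Y) (x : UnitAddCircle) : Y := f (circleRep x)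

theorem circleFun_coe {Y : Type*} {f : ℝ → Y} (hf : Function.Periodic f 1) (x : ℝ) :
    circleFun f (x : UnitAddCircle) = f x := by
  obtain ⟨n, hn⟩ := circleRep_coe x
  rw [circleFun, hn]
  simpa using hf.int_mul n x

variable [IsManifold (𝓡 N) ∞ X] {e : OpenPartialHomeomorph X (Euc N)}
  {D : Set (TangentBundle (𝓡 N) X)} {χ : X → ℝ} {δ : ℝ} {u v w : ℝ → Euc N}

theorem IsStep.contMDiff_mul_coord (h : IsStep e χ δ) (i : Fin N) :
    ContMDiff (𝓡 N) 𝓘(ℝ, ℝ) ∞ fun p => χ p * e p i := fun p => by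
  by_cases hp : p ∈ e.source
  · have h1 : ContMDiffAt (𝓡 N) (𝓡 N) ∞ e p :=
      (contMDiffOn_of_mem_maximalAtlas h.coord).contMDiffAt (e.open_source.mem_nhds hp)
    have h2 : ContMDiff (𝓡 N) 𝓘(ℝ, ℝ) ∞ fun y : Euc N => y i :=
      ContDiff.contMDiff (by fun_prop)
    exact (h.smooth p).mul (h2.contMDiffAt.comp p h1)
  · refine (contMDiffAt_const (c := (0 : ℝ))).congr_of_eventuallyEq ?_
    filter_upwards [h.eventually_eq_zero hp] with y hy
    simp [hy]

theorem IsStep.differential_mul_coord (h : IsStep e χ δ) {p : X} (hp : p ∈ e.source)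
    (h1 : χ =ᶠ[𝓝 p] 1) (i k : Fin N) :
    differential (N := N) (fun p => χ p * e p i) p (coordFrame e p k) = if i = k then 1 else 0 := by
  rw [coordFrame, differential_coordVector (h.contMDiff_mul_coord i) h.coord hp]
  have h2 : ((fun p => χ p * e p i) ∘ e.symm) =ᶠ[𝓝 (e p)] fun y => y i := by
    have h3 : ContinuousAt e.symm (e p) := e.continuousAt_symm (e.map_source hp)
    have h4 : ∀ᶠ y in 𝓝 (e.symm (e p)), χ y = 1 := by
      rw [e.left_inv hp]
      exact h1
    filter_upwards [h3.eventually h4, e.open_target.mem_nhds (e.map_source hp)] with y hy hyt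
    simp [hy, e.right_inv hyt]
  have h5 : HasFDerivAt (fun y : Euc N => y i) (EuclideanSpace.proj i : Euc N →L[ℝ] ℝ) (e p) :=
    (EuclideanSpace.proj i : Euc N →L[ℝ] ℝ).hasFDerivAt
  rw [h2.fderiv_eq, h5.fderiv]
  simp

theorem IsClosedCurve.loop_coe {S : Set (Euc N × Euc N)} (h : IsClosedCurve S u v w) (x : ℝ) :
    circleFun (e.symm ∘ u) (x : UnitAddCircle) = e.symm (u x) :=
  circleFun_coe (h.periodic.comp e.symm) x

theorem IsClosedCurve.mono {S S' : Set (Euc N × Euc N)} (h : IsClosedCurve S u v w) (hS : S ⊆ S') :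
    IsClosedCurve S' u v w :=
  { h with mem := fun x => hS (h.mem x) }

theorem IsClosedCurve.isLoop (h : IsClosedCurve (coordDomain D e) u v w) (he : IsCoordinates e) :
    IsLoop D (circleFun (e.symm ∘ u)) := by
  have h1 : (fun x : ℝ => circleFun (e.symm ∘ u) (x : UnitAddCircle)) = e.symm ∘ u :=
    funext h.loop_coe
  have h2 : IsLoop (N := N) (X := X) univ (circleFun (e.symm ∘ u)) := by
    refine ⟨?_, fun _ => mem_univ _⟩
    rw [h1]
    intro x
    exact ((contMDiffOn_symm_of_mem_maximalAtlas he).contMDiffAt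
      (e.open_target.mem_nhds (h.mem x).1)).comp x h.smooth.contMDiff.contMDiffAt
  refine ⟨h2.1, fun x => ?_⟩
  have h3 : circleFun (e.symm ∘ u) (x : UnitAddCircle) ∈ e.source := by
    rw [h.loop_coe]
    exact e.map_target (h.mem x).1
  rw [← chartDeriv_mem_coordDomain_iff he h3, h2.chartDeriv_velocity he h3]
  have h4 : (fun y : ℝ => e (circleFun (e.symm ∘ u) (y : UnitAddCircle))) = u := funext fun y => by
    rw [h.loop_coe, e.right_inv (h.mem y).1]
  rw [h4, (h.deriv_fst x).deriv, h.loop_coe, e.right_inv (h.mem x).1]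
  exact h.mem x

theorem IsClosedCurve.coord_loop (h : IsClosedCurve (coordDomain D e) u v w) (x : ℝ) :
    e (circleFun (e.symm ∘ u) (x : UnitAddCircle)) = u x := by
  rw [h.loop_coe, e.right_inv (h.mem x).1]

theorem IsClosedCurve.loop_mem (h : IsClosedCurve (coordDomain D e) u v w) (x : ℝ) :
    circleFun (e.symm ∘ u) (x : UnitAddCircle) ∈ e.source := by
  rw [h.loop_coe]
  exact e.map_target (h.mem x).1

theorem IsClosedCurve.velocityCoord_loop (h : IsClosedCurve (coordDomain D e) u v w)
    (he : IsCoordinates e) (x : ℝ) : velocityCoord e (circleFun (e.symm ∘ u)) x = v x := by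
  have h1 := (h.isLoop he).hasDerivAt_coord he (h.loop_mem x)
  simp only [h.coord_loop] at h1
  exact h1.unique (h.deriv_fst x)

end CurveLoops

/-! ### Realising arbitrary covector fields; necessity of the relations -/

section TestFunctionals

variable {N : ℕ} {X : Type*} [TopologicalSpace X] [ChartedSpace (Euc N) X]
  [IsManifold (𝓡 N) ∞ X] {e : OpenPartialHomeomorph X (Euc N)}
  {D : Set (TangentBundle (𝓡 N) X)} {χ : X → ℝ} {δ : ℝ} {u v w : ℝ → Euc N}
  {om : (p : X) → Module.Dual ℝ (TangentSpace (𝓡 N) p) →ₗ[ℝ] TangentSpace (𝓡 N) p}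
  {M B : (p : X) → TangentSpace (𝓡 N) p → Module.End ℝ (TangentSpace (𝓡 N) p)}

/-- Every covector field along a loop in a chart is the momentum of some functional. -/
theorem exists_functional_momentumCoord (hT : IsTwist D om M B) (he : IsCoordinates e)
    (hstep : IsStep e χ δ)
    (h : IsClosedCurve (coordDomain D e) u v w) (hχ : ∀ x, χ =ᶠ[𝓝 (e.symm (u x))] 1)
    {α : ℝ → Fin N → ℝ} (hα : ∀ s, ContDiff ℝ ∞ fun x => α x s) (pα : Function.Periodic α 1) :
    ∃ (I : (UnitAddCircle → X) → ℝ) (ξ : CovectorField N X), HasVariationalDerivative D I ξ ∧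
      ∀ x : ℝ, momentumCoord B e ξ (circleFun (e.symm ∘ u)) x = α x := by
  -- The variational derivative should be `αM`, so that multiplication by the inverse `B` returns
  -- `α`. The functions `χ u^i` have differentials `du^i` along the curve because `χ = 1` near it.
  let f : Fin N → ℝ → ℝ := fun i x => ∑ s, α x s * endoComp M e (u x) (v x) s i
  have sf : ∀ i, ContDiff ℝ ∞ (f i) := fun i => ContDiff.sum fun s _ =>
    (hα s).mul (h.contDiff_comp (hT.smooth e he s i))
  have pf : ∀ i, Function.Periodic (f i) 1 := fun i x => by
    simp only [f, pα x, h.periodic x, h.periodic_fst x]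
  have hf : ∀ i, (fun x : ℝ => circleFun (f i) (x : UnitAddCircle)) = f i := fun i =>
    funext fun x => circleFun_coe (pf i) x
  refine ⟨_, _, hasVariationalDerivative_linFunctional (a := fun i => circleFun (f i))
    (h := fun i p => χ p * e p i) (fun i => by rw [hf]; exact sf i)
    fun i => hstep.contMDiff_mul_coord i, fun x => funext fun s => ?_⟩
  set γ : UnitAddCircle → X := circleFun (e.symm ∘ u) with hγ
  have hx : γ x ∈ e.source := h.loop_mem x
  have hl : IsLoop D γ := h.isLoop he
  have h1 : linDeriv (fun i => circleFun (f i)) (fun i p => χ p * e p i) γ x =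
      (∑ s, α x s • coordCovector e (γ x) s) ∘ₗ M (γ x) (circleVelocity γ x) := by
    refine covector_ext he hx fun k => ?_
    have h2 : ∀ i, differential (N := N) (fun p => χ p * e p i) (γ x) (coordFrame e (γ x) k) =
        if i = k then 1 else 0 := fun i => hstep.differential_mul_coord hx
          (by rw [hγ, h.loop_coe]; exact hχ x) i k
    simp only [linDeriv, LinearMap.sum_apply, LinearMap.smul_apply, smul_eq_mul, h2,
      LinearMap.comp_apply, mul_ite, mul_one, mul_zero, Finset.sum_ite_eq', Finset.mem_univ,
      if_true]
    rw [circleFun_coe (pf k)]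
    refine Finset.sum_congr rfl fun s _ => ?_
    have h3 := endoComp_chart hx M (v x) s k
    rw [h.coord_loop] at h3
    rw [h3, ← h.velocityCoord_loop he x, velocityCoord, coordVector_chartDeriv he hx]
  rw [momentumCoord, momentum, h1, LinearMap.comp_apply, LinearMap.comp_apply,
    hT.comp_inv (hl.circleVelocity_mem x)]
  simp only [LinearMap.sum_apply, LinearMap.smul_apply, smul_eq_mul,
    coordCovector_coordFrame he hx]
  simp

/-- The given values of `u`, `u_x`, `u_xx` are those of a closed curve at time `0`. Along it the
Jacobi identity for the test functionals becomes the vanishing of the integral of `jacobiForm` for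
arbitrary periodic covectors, to which `IsClosedCurve.relations` applies. -/
theorem relations_of_givesPoissonBracket [T2Space X] (hT : IsTwist D om M B) (hD : IsOpen D)
    (hstar : ∀ (p : X) (v : TangentSpace (𝓡 N) p), (⟨p, v⟩ : TangentBundle (𝓡 N) X) ∈ D →
      ∀ t ∈ Icc (0 : ℝ) 1, (⟨p, t • v⟩ : TangentBundle (𝓡 N) X) ∈ D)
    (hA : GivesPoissonBracket D (twistOp om B)) (he : IsCoordinates e) {u₀ v₀ : Euc N}
    (w₀ : Euc N) (huv : (u₀, v₀) ∈ coordDomain D e) :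
    Relation1 (bivectorComp om e) (endoComp M e) u₀ v₀ ∧
      Relation2 (bivectorComp om e) (endoComp M e) u₀ v₀ w₀ := by
  have hp₀ : e.symm u₀ ∈ e.source := e.map_target huv.1
  obtain ⟨χ, δ, hstep, hχ⟩ := exists_isStep he hp₀
  have hS := isOpen_coordDomain he hD
  -- The curve must also stay where `χ` is locally constant equal to `1`. This is an open condition
  -- on the base point alone, so it does not disturb the segment of velocities.
  obtain ⟨V, hVχ, hVo, hVu⟩ := eventually_nhds_iff.1 hχ.eventually_nhds
  have hS' : IsOpen (coordDomain D e ∩ (fun z => e.symm z.1) ⁻¹' V) := by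
    have hc : ContinuousOn (fun z : Euc N × Euc N => e.symm z.1) (coordDomain D e) :=
      e.continuousOn_symm.comp continuousOn_fst fun z hz => hz.1
    exact hc.isOpen_inter_preimage hS hVo
  obtain ⟨u, v, w, hcurve, rfl, rfl, rfl⟩ := exists_isClosedCurve (u₀ := u₀) (v₀ := v₀) hS' w₀
    fun t ht => ⟨⟨huv.1, by
      simp only
      rw [coordVector_smul he hp₀]
      exact hstar _ _ huv.2 t ht⟩, hVu⟩
  have h := hcurve.mono inter_subset_left
  have hχ' : ∀ x, χ =ᶠ[𝓝 (e.symm (u x))] 1 := fun x => hVχ _ (hcurve.mem x).2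
  have hl := h.isLoop he
  refine h.relations hS (fun i j => hT.contDiffOn_bivector he i j)
    (fun i j => hT.smooth e he i j) fun α β κ α' β' κ' sα sβ sκ pα pβ pκ dα dβ dκ => ?_
  obtain ⟨I, ξ, hI, hξ⟩ := exists_functional_momentumCoord (B := B) hT he hstep h hχ' sα pα
  obtain ⟨J, η, hJ, hη⟩ := exists_functional_momentumCoord (B := B) hT he hstep h hχ' sβ pβ
  obtain ⟨K, ζ, hK, hζ⟩ := exists_functional_momentumCoord (B := B) hT he hstep h hχ' sκ pκ
  obtain ⟨dIJ, hIJ⟩ := hA.closed I J ξ η hI hJ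
  obtain ⟨dJK, hJK⟩ := hA.closed J K η ζ hJ hK
  obtain ⟨dKI, hKI⟩ := hA.closed K I ζ ξ hK hI
  obtain ⟨T, -, hTx, hinteg⟩ := exists_jacobi_density hD hT.isSkewOperator hI hJ hK hl
  refine Eq.trans ?_ ((hinteg dIJ dJK dKI hIJ hJK hKI).symm.trans
    (hA.jacobi I J K ξ η ζ dIJ dJK dKI hI hJ hK hIJ hJK hKI _ hl))
  apply intervalIntegral.integral_congr
  intro x _
  have hx := h.loop_mem x
  simp only
  rw [hTx x e he hx, jacobiTerm_twistOp hT hD hK hl he hx, jacobiTerm_twistOp hT hD hI hl he hx,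
    jacobiTerm_twistOp hT hD hJ hl he hx]
  simp only [hξ, hη, hζ, h.coord_loop, h.velocityCoord_loop he, (dα x _).deriv, (dβ x _).deriv,
    (dκ x _).deriv, (h.deriv_snd x).deriv]
  rfl

end TestFunctionals

/-! ### The gauge matrix satisfies the relations: computation in coordinates -/

section GaugeMatrix

variable {N : ℕ}

/-- The matrix `δ^s_r + ω^{sp} T_{prk} v^k`. -/
def gaugeMatrix (om : Euc N → Fin N → Fin N → ℝ) (T : Euc N → Fin N → Fin N → Fin N → ℝ)
    (u v : Euc N) (s r : Fin N) : ℝ :=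
  (if s = r then 1 else 0) + ∑ p, om u s p * ∑ k, T u p r k * v k

theorem totalDeriv_congr {F G : Euc N → Euc N → ℝ} {u : Euc N} (h : ∀ᶠ y in 𝓝 u, F y = G y)
    (v w : Euc N) : totalDeriv F u v w = totalDeriv G u v w := by
  unfold totalDeriv pderiv
  have h1 : (fun y => F y v) =ᶠ[𝓝 u] fun y => G y v := h.mono fun y hy => congrFun hy v
  rw [h1.fderiv_eq, h.self_of_nhds]

theorem totalDeriv_fst {f : Euc N → ℝ} (u v w : Euc N) :
    totalDeriv (fun y _ => f y) u v w = fderiv ℝ f u v := by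
  unfold totalDeriv pderiv
  conv_rhs => rw [euc_eq_sum v, map_sum]
  refine Finset.sum_congr rfl fun k _ => ?_
  simp

/-- The relations involve `M` only through its values over a neighbourhood of `u`, so a formula
valid in the chart may be substituted. -/
theorem relations_congr {om : Euc N → Fin N → Fin N → ℝ}
    {M M' : Euc N → Euc N → Fin N → Fin N → ℝ} {u v w : Euc N} (h : ∀ᶠ y in 𝓝 u, M y = M' y)
    (hr : Relation1 om M' u v ∧ Relation2 om M' u v w) :
    Relation1 om M u v ∧ Relation2 om M u v w := by
  have h0 : M u = M' u := h.self_of_nhds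
  refine ⟨by simpa only [Relation1, h0] using hr.1, ?_⟩
  have h1 : ∀ s r i, pderiv i (fun y => M y v s r) u = pderiv i (fun y => M' y v s r) u := by
    intro s r i
    have : (fun y => M y v s r) =ᶠ[𝓝 u] fun y => M' y v s r := h.mono fun y hy => by simp only [hy]
    unfold pderiv
    rw [this.fderiv_eq]
  have h2 : ∀ i s r p, totalDeriv (fun y z => pderiv i (fun z' => M y z' s r) z * om y r p) u v w =
      totalDeriv (fun y z => pderiv i (fun z' => M' y z' s r) z * om y r p) u v w :=
    fun i s r p => totalDeriv_congr (h.mono fun y hy => by simp only [hy]) v w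
  simpa only [Relation2, h0, h1, h2] using hr.2

theorem sum_reverse_three {F : Fin N → Fin N → Fin N → ℝ} :
    ∑ i, ∑ r, ∑ p, F i r p = ∑ p, ∑ r, ∑ i, F i r p := by
  rw [sum_comm_three, Finset.sum_comm]

variable {om : Euc N → Fin N → Fin N → ℝ} {T : Euc N → Fin N → Fin N → Fin N → ℝ} {u : Euc N}

theorem pderiv_gaugeMatrix_snd (y v : Euc N) (s r i : Fin N) :
    pderiv i (fun z => gaugeMatrix om T y z s r) v = ∑ p, om y s p * T y p r i := by
  have h : HasFDerivAt (fun z => gaugeMatrix om T y z s r)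
      (∑ p, om y s p • ∑ k, T y p r k • (EuclideanSpace.proj k : Euc N →L[ℝ] ℝ)) v := by
    unfold gaugeMatrix
    refine HasFDerivAt.const_add _ (HasFDerivAt.fun_sum fun p _ => HasFDerivAt.const_mul
      (HasFDerivAt.fun_sum fun k _ => ?_) _)
    exact (EuclideanSpace.proj k : Euc N →L[ℝ] ℝ).hasFDerivAt.const_mul _
  rw [pderiv, h.fderiv]
  simp

theorem pderiv_gaugeMatrix_fst (hom : ∀ i j, DifferentiableAt ℝ (fun y => om y i j) u)
    (hT : ∀ i j k, DifferentiableAt ℝ (fun y => T y i j k) u) (v : Euc N) (s r i : Fin N) :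
    pderiv i (fun y => gaugeMatrix om T y v s r) u =
      ∑ p, (pderiv i (fun y => om y s p) u * ∑ k, T u p r k * v k +
        om u s p * ∑ k, pderiv i (fun y => T y p r k) u * v k) := by
  have h := (HasFDerivAt.fun_sum (u := Finset.univ) fun p (_ : p ∈ Finset.univ) =>
    (hom s p).hasFDerivAt.mul (HasFDerivAt.fun_sum (u := Finset.univ)
      fun k (_ : k ∈ Finset.univ) => (hT p r k).hasFDerivAt.mul_const (v k))).const_add
    (if s = r then (1 : ℝ) else 0)
  have h' : HasFDerivAt (fun y => gaugeMatrix om T y v s r) _ u := h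
  rw [pderiv, h'.fderiv]
  simp only [FunLike.coe_sum, Finset.sum_apply, FunLike.coe_add, FunLike.coe_smul, Pi.add_apply,
      Pi.smul_apply, smul_eq_mul, pderiv]
  refine Finset.sum_congr rfl fun p _ => ?_
  rw [add_comm, mul_comm]
  congr 2
  exact Finset.sum_congr rfl fun k _ => mul_comm _ _

/-- The `T`-part of `M^a_i` multiplied by `∂ω^{ib}` cancels against the derivative of `ω` inside
`M^b_i`, by skew-symmetry of `ω` and of `T`. What is left is one term of the Jacobi identity of `ω`,
a term with `∂T`, and a term with `dω/dx`. -/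
theorem jacobiCoeff_gaugeMatrix (hsk : ∀ y i j, om y i j = -om y j i)
    (hT1 : ∀ y i j k, T y i j k = -T y j i k)
    (hom : ∀ i j, DifferentiableAt ℝ (fun y => om y i j) u)
    (hT : ∀ i j k, DifferentiableAt ℝ (fun y => T y i j k) u) (v w : Euc N) (a b c : Fin N) :
    jacobiCoeff om (gaugeMatrix om T) u v w a b c =
      ∑ r, pderiv r (fun y => om y a b) u * om u r c +
      ∑ i, ∑ r, ∑ p, om u i a * om u r c * om u b p *
        (∑ l, pderiv r (fun y => T y p i l) u * v l) +
      ∑ i, ∑ r, ∑ p, om u i a * fderiv ℝ (fun y => om y r c) u v * om u b p * T u p i r := by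
  have hd : ∀ r i j, pderiv r (fun y => om y i j) u = -pderiv r (fun y => om y j i) u := by
    intro r i j
    have : (fun y => om y i j) = fun y => -om y j i := funext fun y => hsk y i j
    unfold pderiv
    rw [this, fderiv_fun_neg]
    rfl
  have h0 : ∑ r, pderiv r (fun y => om y a b) u * om u r c =
      ∑ i, ∑ r, om u r c * pderiv r (fun y => om y i b) u * (if a = i then 1 else 0) := by
    rw [Finset.sum_comm]
    refine Finset.sum_congr rfl fun r _ => ?_
    simp [mul_comm]
  have h1 : ∑ i, ∑ r, ∑ p, om u i a * om u r c * (pderiv r (fun y => om y b p) u *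
        ∑ k, T u p i k * v k) = -∑ i, ∑ r, ∑ p, om u r c * pderiv r (fun y => om y i b) u *
        (om u a p * ∑ k, T u p i k * v k) := by
    rw [sum_reverse_three]
    simp only [← Finset.sum_neg_distrib]
    refine Finset.sum_congr rfl fun i _ => Finset.sum_congr rfl fun r _ =>
      Finset.sum_congr rfl fun p _ => ?_
    have h2 : ∑ k, T u i p k * v k = -∑ k, T u p i k * v k := by
      rw [← Finset.sum_neg_distrib]
      exact Finset.sum_congr rfl fun k _ => by rw [hT1, neg_mul]
    rw [h2, hd r b i, hsk u p a]
    ring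
  have h3 : jacobiCoeff om (gaugeMatrix om T) u v w a b c =
      ∑ i, ∑ r, om u r c * pderiv r (fun y => om y i b) u * (if a = i then 1 else 0) +
      (∑ i, ∑ r, ∑ p, om u r c * pderiv r (fun y => om y i b) u *
        (om u a p * ∑ k, T u p i k * v k) +
      ∑ i, ∑ r, ∑ p, om u i a * om u r c * (pderiv r (fun y => om y b p) u *
        ∑ k, T u p i k * v k)) +
      ∑ i, ∑ r, ∑ p, om u i a * om u r c * om u b p *
        (∑ l, pderiv r (fun y => T y p i l) u * v l) +
      ∑ i, ∑ r, ∑ p, om u i a * fderiv ℝ (fun y => om y r c) u v * om u b p * T u p i r := by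
    unfold jacobiCoeff
    simp only [pderiv_gaugeMatrix_fst hom hT, pderiv_gaugeMatrix_snd, totalDeriv_fst,
      ← Finset.sum_add_distrib]
    refine Finset.sum_congr rfl fun i _ => Finset.sum_congr rfl fun r _ => ?_
    rw [gaugeMatrix]
    simp only [mul_add, Finset.mul_sum, Finset.sum_add_distrib]
    simp only [← mul_assoc]
    ring
  rw [h3, h1, h0]
  ring

theorem boundaryTensor_gaugeMatrix (v : Euc N) (b a c : Fin N) :
    boundaryTensor om (gaugeMatrix om T) (u, v) b a c =
      ∑ p, ∑ i, ∑ k, om u b p * om u i a * om u k c * T u p i k := by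
  unfold boundaryTensor
  simp only [pderiv_gaugeMatrix_snd, Finset.sum_mul, Finset.mul_sum]
  rw [sum_reverse_three]
  exact Finset.sum_congr rfl fun p _ => Finset.sum_congr rfl fun i _ =>
    Finset.sum_congr rfl fun k _ => by ring

theorem boundaryTensorDeriv_gaugeMatrix (hom : ∀ i j, DifferentiableAt ℝ (fun y => om y i j) u)
    (hT : ∀ i j k, DifferentiableAt ℝ (fun y => T y i j k) u) (v w : Euc N) (b a c : Fin N) :
    boundaryTensorDeriv om (gaugeMatrix om T) u v w b a c =
      ∑ p, ∑ i, ∑ k, (fderiv ℝ (fun y => om y b p) u v * om u i a * om u k c * T u p i k +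
        om u b p * fderiv ℝ (fun y => om y i a) u v * om u k c * T u p i k +
        om u b p * om u i a * fderiv ℝ (fun y => om y k c) u v * T u p i k +
        om u b p * om u i a * om u k c * fderiv ℝ (fun y => T y p i k) u v) := by
  unfold boundaryTensorDeriv
  have h1 : ∀ k i, fderiv ℝ (fun y => (∑ p, om y b p * T y p i k) * om y i a) u v =
      ∑ p, ((fderiv ℝ (fun y => om y b p) u v * T u p i k +
        om u b p * fderiv ℝ (fun y => T y p i k) u v) * om u i a +
        om u b p * T u p i k * fderiv ℝ (fun y => om y i a) u v) := by
    intro k i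
    have h := (HasFDerivAt.fun_sum (u := Finset.univ) fun p (_ : p ∈ Finset.univ) =>
      (hom b p).hasFDerivAt.mul (hT p i k).hasFDerivAt).mul (hom i a).hasFDerivAt
    have h' : HasFDerivAt (fun y => (∑ p, om y b p * T y p i k) * om y i a) _ u := h
    rw [h'.fderiv]
    simp only [FunLike.coe_sum, Finset.sum_apply, FunLike.coe_add, FunLike.coe_smul, Pi.add_apply,
      Pi.smul_apply, smul_eq_mul, Pi.mul_apply]
    rw [Finset.mul_sum, Finset.sum_mul, ← Finset.sum_add_distrib]
    exact Finset.sum_congr rfl fun p _ => by ring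
  simp only [pderiv_gaugeMatrix_snd, totalDeriv_fst, h1]
  simp only [Finset.sum_mul, Finset.mul_sum, ← Finset.sum_add_distrib]
  rw [sum_reverse_three]
  exact Finset.sum_congr rfl fun p _ => Finset.sum_congr rfl fun i _ =>
    Finset.sum_congr rfl fun k _ => by ring

/-- Here `boundaryTensor` is `T` with its indices raised by `ω`, and an alternating tensor is
cyclically invariant, which is (r1). In (r2) the second derivative `w` drops out because `M` is
affine in `u_x`. The terms free of `T` form the Jacobi identity of `ω`, the terms with `dω/dx`
cancel, and the terms with derivatives of `T` combine into `dT`. -/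
theorem relations_gaugeMatrix (hsk : ∀ y i j, om y i j = -om y j i)
    (hT1 : ∀ y i j k, T y i j k = -T y j i k) (hT2 : ∀ y i j k, T y i j k = -T y i k j)
    (hom : ∀ i j, DifferentiableAt ℝ (fun y => om y i j) u)
    (hT : ∀ i j k, DifferentiableAt ℝ (fun y => T y i j k) u)
    (hjac : ∀ i j k, ∑ r, (pderiv r (fun y => om y i j) u * om u r k
        + pderiv r (fun y => om y j k) u * om u r i
        + pderiv r (fun y => om y k i) u * om u r j) = 0)
    (hcl : ∀ i j k l, pderiv i (fun y => T y j k l) u - pderiv j (fun y => T y i k l) u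
        + pderiv k (fun y => T y i j l) u - pderiv l (fun y => T y i j k) u = 0) (v w : Euc N) :
    Relation1 om (gaugeMatrix om T) u v ∧ Relation2 om (gaugeMatrix om T) u v w := by
  have hcyc : ∀ y i j k, T y k i j = T y i j k := fun y i j k => by rw [hT1, hT2, neg_neg]
  constructor
  · refine relation1_iff.2 fun j p s => ?_
    rw [boundaryTensor_gaugeMatrix, boundaryTensor_gaugeMatrix, sum_comm_three]
    refine Finset.sum_congr rfl fun x _ => Finset.sum_congr rfl fun y _ =>
      Finset.sum_congr rfl fun z _ => ?_
    rw [hcyc, hsk u s z, hsk u x p]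
    ring
  · refine relation2_iff.2 fun c a b => ?_
    have hd : ∀ i j, fderiv ℝ (fun y => om y i j) u v = -fderiv ℝ (fun y => om y j i) u v := by
      intro i j
      have : (fun y => om y i j) = fun y => -om y j i := funext fun y => hsk y i j
      rw [this, fderiv_fun_neg]
      rfl
    have hdT : ∀ r i j k, pderiv r (fun y => T y i j k) u = -pderiv r (fun y => T y j i k) u := by
      intro r i j k
      have : (fun y => T y i j k) = fun y => -T y j i k := funext fun y => hT1 y i j k
      unfold pderiv
      rw [this, fderiv_fun_neg]
      rfl
    rw [secondRelation_eq, boundaryTensorDeriv_gaugeMatrix hom hT,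
      jacobiCoeff_gaugeMatrix hsk hT1 hom hT, jacobiCoeff_gaugeMatrix hsk hT1 hom hT,
      jacobiCoeff_gaugeMatrix hsk hT1 hom hT]
    have h1 := hjac a b c
    rw [Finset.sum_add_distrib, Finset.sum_add_distrib] at h1
    rw [← sum_comm_three (F := fun p i r => om u i a * om u r c * om u b p *
        (∑ l, pderiv r (fun y => T y p i l) u * v l)),
      ← sum_comm_three (F := fun p i r => om u i a * fderiv ℝ (fun y => om y r c) u v * om u b p *
        T u p i r),
      sum_comm_three (F := fun i r p => om u i c * om u r b * om u a p *
        (∑ l, pderiv r (fun y => T y p i l) u * v l)),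
      sum_comm_three (F := fun i r p => om u i c * fderiv ℝ (fun y => om y r b) u v * om u a p *
        T u p i r)]
    have h2 : ∀ p i k, om u b p * om u i a * om u k c * fderiv ℝ (fun y => T y p i k) u v =
        om u b p * om u i a * om u k c * ∑ l, pderiv l (fun y => T y p i k) u * v l := by
      intro p i k
      rw [← totalDeriv_fst u v v, totalDeriv]
      congr 1
      refine Finset.sum_congr rfl fun l _ => ?_
      simp [pderiv, mul_comm]
    -- Closedness of `T` with its last index contracted with the velocity.
    have h3 : ∀ p i k, ∑ l, pderiv k (fun y => T y p i l) u * v l +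
        ∑ l, pderiv i (fun y => T y k p l) u * v l + ∑ l, pderiv p (fun y => T y i k l) u * v l -
        ∑ l, pderiv l (fun y => T y p i k) u * v l = 0 := by
      intro p i k
      rw [← Finset.sum_add_distrib, ← Finset.sum_add_distrib, ← Finset.sum_sub_distrib]
      refine Finset.sum_eq_zero fun l _ => ?_
      rw [hdT i k p l]
      linear_combination v l * hcl p i k l
    -- Splits (r2) by the form of its terms: `A`, `B`, `C` come from the Jacobi identity of `ω`, the
    -- `K` terms contain derivatives of `T`, the `L` terms contain `dω/dx`, and `R` is the total
    -- derivative of `boundaryTensor`.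
    have h4 : ∀ A B C K1 K2 K3 L1 L2 L3 R : ℝ, A + B + C = 0 → K1 + K2 + K3 + L1 + L2 + L3 - R = 0 →
        A + K1 + L1 + (B + K2 + L2) + (C + K3 + L3) - R = 0 := fun A B C K1 K2 K3 L1 L2 L3 R h h' => by
      linear_combination h + h'
    refine h4 _ _ _ _ _ _ _ _ _ _ h1 ?_
    simp only [← Finset.sum_add_distrib, ← Finset.sum_sub_distrib]
    refine Finset.sum_eq_zero fun p _ => Finset.sum_eq_zero fun i _ =>
      Finset.sum_eq_zero fun k _ => ?_
    rw [h2, hsk u p b, hsk u c k, hsk u a i, hd p b, hcyc u p i k, hcyc u k p i, hcyc u p i k]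
    linear_combination om u b p * om u i a * om u k c * h3 p i k

end GaugeMatrix

/-! ### The gauge endomorphism in coordinates -/

section GaugeEndo

variable {N : ℕ} {X : Type*} [TopologicalSpace X] [ChartedSpace (Euc N) X]
  [IsManifold (𝓡 N) ∞ X] {e : OpenPartialHomeomorph X (Euc N)}
  {om : (p : X) → Module.Dual ℝ (TangentSpace (𝓡 N) p) →ₗ[ℝ] TangentSpace (𝓡 N) p}
  {T : (p : X) → TangentSpace (𝓡 N) p [⋀^Fin 3]→ₗ[ℝ] ℝ}

theorem endoComp_gaugeEndo (he : IsCoordinates e) {u : Euc N} (hu : u ∈ e.target) :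
    endoComp (gaugeEndo om T) e u = gaugeMatrix (bivectorComp om e) (formComp T e) u := by
  funext v s r
  have hp := e.map_target hu
  have h1 : ∀ a b, contractForm (T (e.symm u)) (coordVector e (e.symm u) v) a b =
      T (e.symm u) ![b, a, coordVector e (e.symm u) v] := fun _ _ => rfl
  have h2 : ∀ a b, T (e.symm u) ![b, a, coordVector e (e.symm u) v] =
      ∑ k, T (e.symm u) ![b, a, coordFrame e (e.symm u) k] * v k := by
    intro a b
    have h3 : ∀ w, Function.update ![b, a, 0] 2 w = ![b, a, w] := fun w => by
      ext i; fin_cases i <;> rfl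
    have h4 : ∀ w, T (e.symm u) ![b, a, w] =
        T (e.symm u) (Function.update ![b, a, 0] 2 w) := fun w => by rw [h3]
    rw [coordVector_eq_sum he hp, h4, (T (e.symm u)).map_update_sum]
    exact Finset.sum_congr rfl fun k _ => by
      rw [(T (e.symm u)).map_update_smul, ← h4, smul_eq_mul, mul_comm]
  unfold endoComp gaugeEndo gaugeMatrix
  rw [LinearMap.add_apply, map_add, LinearMap.id_apply, coordCovector_coordFrame he hp,
    LinearMap.comp_apply, coordCovector_apply, chartDeriv_bivector he hp, e.right_inv hu]
  congr 1
  refine Finset.sum_congr rfl fun p _ => ?_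
  rw [h1, h2]
  rfl

theorem formComp_swap_fst (y : Euc N) (i j k : Fin N) :
    formComp T e y i j k = -formComp T e y j i k := by
  unfold formComp
  rw [← (T (e.symm y)).map_swap _ (show (0 : Fin 3) ≠ 1 by decide)]
  congr 1
  ext l
  fin_cases l <;> rfl

theorem formComp_swap_snd (y : Euc N) (i j k : Fin N) :
    formComp T e y i j k = -formComp T e y i k j := by
  unfold formComp
  rw [← (T (e.symm y)).map_swap _ (show (1 : Fin 3) ≠ 2 by decide)]
  congr 1
  ext l
  fin_cases l <;> rfl

theorem relations_gaugeEndo (hom : IsPoissonStructure om) (hT : IsClosedThreeForm T)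
    (he : IsCoordinates e) {u : Euc N} (hu : u ∈ e.target) (v w : Euc N) :
    Relation1 (bivectorComp om e) (endoComp (gaugeEndo om T) e) u v ∧
      Relation2 (bivectorComp om e) (endoComp (gaugeEndo om T) e) u v w := by
  refine relations_congr (M' := gaugeMatrix (bivectorComp om e) (formComp T e)) ?_ ?_
  · filter_upwards [e.open_target.mem_nhds hu] with y hy
    exact endoComp_gaugeEndo he hy
  · have hsk : ∀ y i j, bivectorComp om e y i j = -bivectorComp om e y j i :=
      fun y i j => hom.toIsBivector.skew _ _ _
    have hT1 : ∀ y i j k, formComp T e y i j k = -formComp T e y j i k := formComp_swap_fst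
    have hT2 : ∀ y i j k, formComp T e y i j k = -formComp T e y i k j := formComp_swap_snd
    have hd1 : ∀ i j, DifferentiableAt ℝ (fun y => bivectorComp om e y i j) u := fun i j =>
      ((hom.smooth e he i j).contDiffAt (e.open_target.mem_nhds hu)).differentiableAt (by simp)
    have hd2 : ∀ i j k, DifferentiableAt ℝ (fun y => formComp T e y i j k) u := fun i j k =>
      ((hT.smooth e he i j k).contDiffAt (e.open_target.mem_nhds hu)).differentiableAt (by simp)
    exact relations_gaugeMatrix hsk hT1 hT2 hd1 hd2 (hom.jacobi e he u hu)
      (hT.closed e he u hu) v w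

end GaugeEndo

end

end LoopPoisson

/-! ### The theorem -/

theorem mainTheorem2 {N : ℕ} {X : Type*} [TopologicalSpace X] [T2Space X]
    [SecondCountableTopology X] [ChartedSpace (EuclideanSpace ℝ (Fin N)) X]
    [IsManifold (𝓡 N) ∞ X] :
    (∀ (om : (p : X) → Module.Dual ℝ (TangentSpace (𝓡 N) p) →ₗ[ℝ] TangentSpace (𝓡 N) p)
      (D : Set (TangentBundle (𝓡 N) X))
      (M B : (p : X) → TangentSpace (𝓡 N) p → Module.End ℝ (TangentSpace (𝓡 N) p))
      (C : Set (OpenPartialHomeomorph X (EuclideanSpace ℝ (Fin N)))),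
      LoopPoisson.IsBivector om →
      IsOpen D →
      (∀ (p : X) (v : TangentSpace (𝓡 N) p), (⟨p, v⟩ : TangentBundle (𝓡 N) X) ∈ D →
        ∀ t ∈ Set.Icc (0 : ℝ) 1, (⟨p, t • v⟩ : TangentBundle (𝓡 N) X) ∈ D) →
      LoopPoisson.IsSmoothEndoOn D M →
      (∀ (p : X) (v : TangentSpace (𝓡 N) p), (⟨p, v⟩ : TangentBundle (𝓡 N) X) ∈ D →
        B p v ∘ₗ M p v = LinearMap.id) →
      (∀ (p : X) (v : TangentSpace (𝓡 N) p), (⟨p, v⟩ : TangentBundle (𝓡 N) X) ∈ D →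
        ∀ θ η : Module.Dual ℝ (TangentSpace (𝓡 N) p),
          θ ((B p v ∘ₗ om p) η) = -η ((B p v ∘ₗ om p) θ)) →
      (∀ e ∈ C, LoopPoisson.IsCoordinates e) →
      (∀ p : X, ∃ e ∈ C, p ∈ e.source) →
      (LoopPoisson.GivesPoissonBracket D (fun p v => B p v ∘ₗ om p) ↔
        ∀ e ∈ C, ∀ u v w : EuclideanSpace ℝ (Fin N),
          (u, v) ∈ LoopPoisson.coordDomain D e →
          LoopPoisson.Relation1 (LoopPoisson.bivectorComp om e)
              (LoopPoisson.endoComp M e) u v ∧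
            LoopPoisson.Relation2 (LoopPoisson.bivectorComp om e)
              (LoopPoisson.endoComp M e) u v w)) ∧
    (∀ (om : (p : X) → Module.Dual ℝ (TangentSpace (𝓡 N) p) →ₗ[ℝ] TangentSpace (𝓡 N) p)
      (T : (p : X) → TangentSpace (𝓡 N) p [⋀^Fin 3]→ₗ[ℝ] ℝ),
      LoopPoisson.IsPoissonStructure om →
      LoopPoisson.IsClosedThreeForm T →
      ∀ e : OpenPartialHomeomorph X (EuclideanSpace ℝ (Fin N)),
        LoopPoisson.IsCoordinates e →
        ∀ u ∈ e.target, ∀ v w : EuclideanSpace ℝ (Fin N),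
          LoopPoisson.Relation1 (LoopPoisson.bivectorComp om e)
              (LoopPoisson.endoComp (LoopPoisson.gaugeEndo om T) e) u v ∧
            LoopPoisson.Relation2 (LoopPoisson.bivectorComp om e)
              (LoopPoisson.endoComp (LoopPoisson.gaugeEndo om T) e) u v w) := by
  refine ⟨?_, fun om T hom hT e he u hu v w => LoopPoisson.relations_gaugeEndo hom hT he hu v w⟩
  intro om D M B C hom hD hstar hM hinv hskew hC hcov
  have h : LoopPoisson.IsTwist D om M B := ⟨hom, hM, hinv, hskew⟩
  exact ⟨fun hA e he u v w huv =>
      LoopPoisson.relations_of_givesPoissonBracket h hD hstar hA (hC e he) w huv,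
    fun hr => LoopPoisson.givesPoissonBracket_of_relations h hD C hC hcov hr⟩
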